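/- Let $d\ge 2$ and $c_0>0$. Put $Y=[-1/2,1/2]^d$ and $Q_R=(-R/2,R/2)^d$. There is a constant $C>0$ depending only on $d$ and $c_0$ with the following property. Let $T$ be the closure of an open subset of $Y$ with Lipschitz boundary such that $Y\setminus T$ is connected, $B(0,c_0)\subset T$ and $\mathrm{dist}(\partial T,\partial Y)\ge c_0$. Let $\varepsilon,\eta\in(0,1]$ and $$\omega_{\varepsilon,\eta}=\mathbb{R}^d\setminus\bigcup_{k\in\mathbb{Z}^d}\varepsilon(k+\eta T).$$ Let $R\ge\varepsilon$ and let $u\in W^{1,2}(Q_R)$ be real-valued, with $\Delta u=0$ in $Q_R\cap\omega_{\varepsilon,\eta}$ in the weak sense and $u=0$ almost everywhere in $Q_R\setminus\omega_{\varepsilon,\eta}$. Then, for every $\varepsilon\le r\le R$, $$\left(\frac{1}{|Q_r|}\int_{Q_r}|\nabla u|^2\,dx\right)^{1/2}\le C\left(\frac{1}{|Q_R|}\int_{Q_R}|\nabla u|^2\,dx\right)^{1/2}.$$ -/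

import Mathlib

open MeasureTheory
open scoped ContDiff

namespace Perforated

/-- The Euclidean space `ℝ^d`. -/
abbrev E (d : ℕ) : Type := EuclideanSpace ℝ (Fin d)

/-- The closed unit cube `Y = [-1/2, 1/2]^d`. -/
def unitCell (d : ℕ) : Set (E d) := {x | ∀ i, x i ∈ Set.Icc (-(1 / 2) : ℝ) (1 / 2)}

/-- The open cube `Q_R = (-R/2, R/2)^d` of side length `R` centred at the origin. -/
def cube (d : ℕ) (R : ℝ) : Set (E d) := {x | ∀ i, x i ∈ Set.Ioo (-(R / 2)) (R / 2)}

/-- The set `D` has Lipschitz boundary: near each of its boundary points, in some orthonormal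
coordinate system, `D` is the region strictly above the graph of a Lipschitz function. The last
coordinate axis is spanned by the unit vector `e`; the remaining coordinates of `y` are encoded by
its orthogonal projection `y - ⟪e, y⟫ e` to the hyperplane orthogonal to `e`. -/
def HasLipschitzBoundary {d : ℕ} (D : Set (E d)) : Prop :=
  ∀ x ∈ frontier D, ∃ ρ : ℝ, 0 < ρ ∧ ∃ e : E d, ‖e‖ = 1 ∧
    ∃ (ψ : E d → ℝ) (K : NNReal), LipschitzWith K ψ ∧
      ∀ y ∈ Metric.ball x ρ, (y ∈ D ↔ ψ (y - inner ℝ e y • e) < inner ℝ e y)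

/-- The standing assumptions on the model hole `T`: it is the closure of an open subset of `Y` with
Lipschitz boundary, `Y \ T` is connected, `B(0, c₀) ⊆ T` and `dist(∂T, ∂Y) ≥ c₀`. -/
structure IsModelHole (d : ℕ) (c₀ : ℝ) (T : Set (E d)) : Prop where
  exists_open : ∃ D : Set (E d), IsOpen D ∧ D ⊆ unitCell d ∧ HasLipschitzBoundary D ∧ T = closure D
  connected : IsConnected (unitCell d \ T)
  ball_subset : Metric.ball 0 c₀ ⊆ T
  le_dist : ∀ x ∈ frontier T, ∀ y ∈ frontier (unitCell d), c₀ ≤ dist x y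

/-- The lattice point `k ∈ ℤ^d`, as a point of `ℝ^d`. -/
def latticePt {d : ℕ} (k : Fin d → ℤ) : E d := WithLp.toLp 2 fun i => (k i : ℝ)

/-- The perforated domain `ω_{ε,η} = ℝ^d \ ⋃_{k ∈ ℤ^d} ε (k + η T)`. -/
def perforated {d : ℕ} (T : Set (E d)) (ε η : ℝ) : Set (E d) :=
  (⋃ k : Fin d → ℤ, (fun y => ε • (latticePt k + η • y)) '' T)ᶜ

/-- `φ ∈ C_c^∞(U)`. -/
structure IsTestFunction {d : ℕ} (U : Set (E d)) (φ : E d → ℝ) : Prop where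
  smooth : ContDiff ℝ ∞ φ
  compact : HasCompactSupport φ
  support_subset : tsupport φ ⊆ U

/-- `u ∈ W^{1,2}(U)` with weak gradient `G = ∇u`, for an open set `U`: both `u` and `G` are square
integrable on `U` and `∫_U u ∂ᵢφ = -∫_U Gᵢ φ` for all `φ ∈ C_c^∞(U)` and all `i`. -/
structure IsW12WithGrad {d : ℕ} (U : Set (E d)) (u : E d → ℝ) (G : E d → E d) : Prop where
  memLp : MemLp u 2 (volume.restrict U)
  memLp_grad : MemLp G 2 (volume.restrict U)
  integral_eq : ∀ φ : E d → ℝ, IsTestFunction U φ → ∀ i : Fin d,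
    ∫ x in U, u x * fderiv ℝ φ x (EuclideanSpace.single i 1) = -∫ x in U, G x i * φ x

/-- A function with weak gradient `G` is (weakly) harmonic in the open set `U`:
`∫_U ∇u · ∇φ = 0` for all `φ ∈ C_c^∞(U)`. -/
def IsWeaklyHarmonic {d : ℕ} (U : Set (E d)) (G : E d → E d) : Prop :=
  ∀ φ : E d → ℝ, IsTestFunction U φ → ∫ x in U, inner ℝ (G x) (gradient φ x) = 0

/-- The `L²` average `(⨍_U |G|²)^{1/2}`. -/
noncomputable def l2Average {d : ℕ} (U : Set (E d)) (G : E d → E d) : ℝ :=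
  Real.sqrt (⨍ x in U, ‖G x‖ ^ 2)

end Perforated

/-!
The constant does not depend on `η` because all that matters about the holes is one number `κ`,
comparable to the capacity of a hole in a unit cell (after rescaling to `ε = 1`). On scales larger
than `1` the function `u` behaves like a solution of `Δu = κ u`, for which the estimate is
elementary: below the scale `κ^(-1/2)` the equation is a small perturbation of the Laplace equation,
and above this scale the zeroth order term makes the energy decay towards the centre.

Only two facts about the equation are used in this comparison. The first is the energy identity
`Δ(u²) = 2 |∇u|²`, which holds weakly across the holes (`HasWeakGrad.integral_sq_mul_lap`). It says
that `u θ` is an admissible test function for every smooth `θ`; the Lipschitz boundary enters here,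
through the exterior cone property, which allows `u θ` to be mollified without its support touching
the holes. The second is harmonicity off the holes. They give two bounds with the same `κ`
(`exists_capacity_bounds`):

* the Poincaré inequality `∫ u² ≤ C κ⁻¹ ∫ |∇u|²`, obtained by testing the energy identity with a sum
  of translates of a radial potential that is subharmonic away from the hole (`exists_poincare`);
* the flux bound, that `Δu` acts on smooth test functions at scales `s ≥ 1` like a density of size
  `C κ sup |u|`, obtained by multiplying the test function by a cutoff which vanishes on the holes
  and whose Laplacian has mass `C κ` in each cell (`fluxBound_of_cutoff`).

Let `a(r) = r⁻ᵈ ∫_{B(0,r)} |∇u|²`. From these bounds `a(r) ≤ A a(R)` for `1 ≤ r ≤ R` follows as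
below (`scaledEnergy_le_of_bounds`). For `r ≥ K κ^(-1/2)`, Caccioppoli's inequality and the Poincaré
inequality give the contraction `a(r) ≤ a(4r)/2` (`scaledEnergy_contraction`). At the scale
`S = min(κ^(-1/2), R/K)`, subharmonicity of `u²` bounds `κ sup u²` on `B(0, 4S)` by `a(K S)`, and the flux
bound then keeps the averages of `∇u` at unit scale bounded by `a(K S)^(1/2)`
(`exists_avg_grad_bound`), so that the averages of `u` at unit scale are Lipschitz. For `r ≤ S`,
Caccioppoli's inequality is applied to `u - c`, with `c` the average of `u` at the origin, and
combined with the unit-scale Poincaré inequality for `u` minus its averages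
(`HasWeakGrad.integral_sq_sub_avg_le`). This gives `a(r) ≤ a(4r)/2 + B` with a source
`B` bounded by a multiple of `a(K S)` (`scaledEnergy_le_of_small_scale`). Cubes are compared with
balls at the end.

All averages are taken with one family of radial mollifiers `ρₛ` whose derivative in the scale is a
Laplacian, `∂ₛρₛ = Δζₛ` with `ζₛ ≥ 0`. Hence averages of subharmonic functions increase with `s`,
and the flux bound controls how averages of `∇u` vary with `s`.
-/

namespace Perforated

section

variable {d : ℕ}

/-! ### Partial derivatives, the Laplacian and test functions -/

/-- The partial derivative `∂ᵢφ`. -/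
noncomputable def pd (φ : E d → ℝ) (i : Fin d) (x : E d) : ℝ :=
  fderiv ℝ φ x (EuclideanSpace.single i 1)

/-- The Laplacian `∑ᵢ ∂ᵢ∂ᵢφ` of a scalar function, in coordinates. -/
noncomputable def lap (φ : E d → ℝ) (x : E d) : ℝ := ∑ i, pd (pd φ i) i x

lemma contDiff_pd {φ : E d → ℝ} (h : ContDiff ℝ ∞ φ) (i : Fin d) : ContDiff ℝ ∞ (pd φ i) :=
  (h.fderiv_right (m := ∞) le_rfl).clm_apply contDiff_const

lemma contDiff_lap {φ : E d → ℝ} (h : ContDiff ℝ ∞ φ) : ContDiff ℝ ∞ (lap φ) := by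
  unfold lap
  exact ContDiff.sum fun i _ => contDiff_pd (contDiff_pd h i) i

lemma _root_.ContDiff.diff_infty {φ : E d → ℝ} (h : ContDiff ℝ ∞ φ) : Differentiable ℝ φ :=
  h.differentiable (by simp)

lemma pd_eq_zero_of_notMem {φ : E d → ℝ} {x : E d} (hx : x ∉ tsupport φ) (i : Fin d) :
    pd φ i x = 0 := by
  have h := notMem_tsupport_iff_eventuallyEq.1 hx
  simp [pd, h.fderiv_eq]

lemma tsupport_pd_subset (φ : E d → ℝ) (i : Fin d) : tsupport (pd φ i) ⊆ tsupport φ :=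
  closure_minimal (fun x hx => by
    by_contra h
    exact hx (pd_eq_zero_of_notMem h i)) (isClosed_tsupport φ)

lemma lap_eq_zero_of_notMem {φ : E d → ℝ} {x : E d} (hx : x ∉ tsupport φ) : lap φ x = 0 :=
  Finset.sum_eq_zero fun i _ =>
    pd_eq_zero_of_notMem (fun h => hx (tsupport_pd_subset φ i h)) i

lemma tsupport_lap_subset (φ : E d → ℝ) : tsupport (lap φ) ⊆ tsupport φ :=
  closure_minimal (fun x hx => by
    by_contra h
    exact hx (lap_eq_zero_of_notMem h)) (isClosed_tsupport φ)

lemma pd_congr {φ ψ : E d → ℝ} {x : E d} (h : φ =ᶠ[nhds x] ψ) (i : Fin d) :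
    pd φ i x = pd ψ i x := by simp [pd, h.fderiv_eq]

lemma pd_add {φ ψ : E d → ℝ} (hφ : Differentiable ℝ φ) (hψ : Differentiable ℝ ψ) (i : Fin d) :
    pd (fun x => φ x + ψ x) i = fun x => pd φ i x + pd ψ i x := by
  funext x
  simp [pd, fderiv_fun_add (hφ x) (hψ x)]

lemma pd_const_mul {φ : E d → ℝ} (hφ : Differentiable ℝ φ) (c : ℝ) (i : Fin d) :
    pd (fun x => c * φ x) i = fun x => c * pd φ i x := by
  funext x
  simp [pd, fderiv_const_mul (hφ x)]

lemma pd_mul {φ ψ : E d → ℝ} (hφ : Differentiable ℝ φ) (hψ : Differentiable ℝ ψ) (i : Fin d) :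
    pd (fun x => φ x * ψ x) i = fun x => φ x * pd ψ i x + ψ x * pd φ i x := by
  funext x
  simp [pd, fderiv_fun_mul (hφ x) (hψ x)]

lemma pd_sum {ι : Type*} (s : Finset ι) {φ : ι → E d → ℝ}
    (hφ : ∀ j ∈ s, Differentiable ℝ (φ j)) (i : Fin d) :
    pd (fun x => ∑ j ∈ s, φ j x) i = fun x => ∑ j ∈ s, pd (φ j) i x := by
  funext x
  simp [pd, fderiv_fun_sum fun j hj => hφ j hj x]

lemma lap_add {φ ψ : E d → ℝ} (hφ : ContDiff ℝ ∞ φ) (hψ : ContDiff ℝ ∞ ψ) :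
    lap (fun x => φ x + ψ x) = fun x => lap φ x + lap ψ x := by
  funext x
  simp only [lap, ← Finset.sum_add_distrib]
  refine Finset.sum_congr rfl fun i _ => ?_
  rw [pd_add hφ.diff_infty hψ.diff_infty,
    pd_add (contDiff_pd hφ i).diff_infty (contDiff_pd hψ i).diff_infty]

lemma lap_const_mul {φ : E d → ℝ} (hφ : ContDiff ℝ ∞ φ) (c : ℝ) :
    lap (fun x => c * φ x) = fun x => c * lap φ x := by
  funext x
  simp only [lap, Finset.mul_sum]
  refine Finset.sum_congr rfl fun i _ => ?_
  rw [pd_const_mul hφ.diff_infty, pd_const_mul (contDiff_pd hφ i).diff_infty]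

lemma lap_sum {ι : Type*} (s : Finset ι) {φ : ι → E d → ℝ} (hφ : ∀ j, ContDiff ℝ ∞ (φ j)) :
    lap (fun x => ∑ j ∈ s, φ j x) = fun x => ∑ j ∈ s, lap (φ j) x := by
  funext x
  simp only [lap]
  rw [Finset.sum_comm]
  refine Finset.sum_congr rfl fun i _ => ?_
  rw [pd_sum s (fun j _ => (hφ j).diff_infty),
    pd_sum s (fun j _ => (contDiff_pd (hφ j) i).diff_infty)]

lemma lap_mul {φ ψ : E d → ℝ} (hφ : ContDiff ℝ ∞ φ) (hψ : ContDiff ℝ ∞ ψ) :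
    lap (fun x => φ x * ψ x) =
      fun x => φ x * lap ψ x + 2 * ∑ i, pd φ i x * pd ψ i x + ψ x * lap φ x := by
  funext x
  simp only [lap, Finset.mul_sum, ← Finset.sum_add_distrib]
  refine Finset.sum_congr rfl fun i _ => ?_
  have hφ' := (contDiff_pd hφ i)
  have hψ' := (contDiff_pd hψ i)
  rw [pd_mul hφ.diff_infty hψ.diff_infty,
    pd_add (hφ.mul hψ').diff_infty (hψ.mul hφ').diff_infty,
    pd_mul hφ.diff_infty hψ'.diff_infty, pd_mul hψ.diff_infty hφ'.diff_infty]
  ring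

lemma pd_comm {φ : E d → ℝ} (hφ : ContDiff ℝ ∞ φ) (i j : Fin d) :
    pd (pd φ i) j = pd (pd φ j) i := by
  funext x
  have hd : DifferentiableAt ℝ (fderiv ℝ φ) x :=
    ((hφ.fderiv_right (m := ∞) le_rfl).differentiable (by simp)) x
  have key : ∀ a b : Fin d, pd (pd φ a) b x =
      fderiv ℝ (fderiv ℝ φ) x (EuclideanSpace.single b 1) (EuclideanSpace.single a 1) := by
    intro a b
    unfold pd
    rw [fderiv_clm_apply hd (differentiableAt_const _)]
    simp
  rw [key, key]
  exact ((hφ.of_le (m := 2) (by norm_cast)).contDiffAt.isSymmSndFDerivAt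
    (by simp)).eq _ _

lemma pd_lap {φ : E d → ℝ} (hφ : ContDiff ℝ ∞ φ) (i : Fin d) : pd (lap φ) i = lap (pd φ i) := by
  funext x
  have : lap φ = fun x => ∑ j, pd (pd φ j) j x := rfl
  rw [this, pd_sum _ (fun j _ => (contDiff_pd (contDiff_pd hφ j) j).diff_infty)]
  refine Finset.sum_congr rfl fun j _ => ?_
  rw [pd_comm (contDiff_pd hφ j) j i, pd_comm hφ j i]

lemma fderiv_eq_sum_pd (φ : E d → ℝ) (x v : E d) : fderiv ℝ φ x v = ∑ i, v i * pd φ i x := by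
  have hv : v = ∑ i, v i • (EuclideanSpace.single i (1 : ℝ) : E d) := by
    have := (EuclideanSpace.basisFun (Fin d) ℝ).sum_repr v
    simpa using this.symm
  conv_lhs => rw [hv]
  simp [pd]

/-- The chain rule for an affine change of variables `y ↦ c • (y - a)`. -/
lemma pd_comp_affine (φ : E d → ℝ) (c : ℝ) (a : E d) (i : Fin d) :
    pd (fun y => φ (c • (y - a))) i = fun y => c * pd φ i (c • (y - a)) := by
  funext y
  have h1 : fderiv ℝ (fun y => φ (c • (y - a))) y = c • fderiv ℝ φ (c • (y - a)) := by
    have h2 := fderiv_comp_smul (𝕜 := ℝ) (f := φ) (x := y - a) c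
    have h3 := fderiv_comp_sub (𝕜 := ℝ) (f := fun z => φ (c • z)) (x := y) a
    rw [h3, h2]
  simp [pd, h1]

lemma lap_comp_affine {φ : E d → ℝ} (hφ : ContDiff ℝ ∞ φ) (c : ℝ) (a : E d) :
    lap (fun y => φ (c • (y - a))) = fun y => c ^ 2 * lap φ (c • (y - a)) := by
  funext y
  simp only [lap, Finset.mul_sum]
  refine Finset.sum_congr rfl fun i _ => ?_
  have h1 : Differentiable ℝ fun y : E d => pd φ i (c • (y - a)) :=
    (contDiff_pd hφ i).diff_infty.comp (by fun_prop)
  rw [pd_comp_affine, pd_const_mul h1, pd_comp_affine]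
  ring

lemma pd_comp_sub (φ : E d → ℝ) (a : E d) (i : Fin d) :
    pd (fun y => φ (y - a)) i = fun y => pd φ i (y - a) := by
  simpa using pd_comp_affine φ 1 a i

lemma lap_comp_sub {φ : E d → ℝ} (hφ : ContDiff ℝ ∞ φ) (a : E d) :
    lap (fun y => φ (y - a)) = fun y => lap φ (y - a) := by
  simpa using lap_comp_affine hφ 1 a

lemma contDiff_radial {f : ℝ → ℝ} (hf : ContDiff ℝ ∞ f) :
    ContDiff ℝ ∞ fun y : E d => f (‖y‖ ^ 2) :=
  hf.comp (contDiff_norm_sq ℝ)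

lemma pd_radial {f : ℝ → ℝ} (hf : Differentiable ℝ f) (i : Fin d) :
    pd (fun y : E d => f (‖y‖ ^ 2)) i = fun y => 2 * y i * deriv f (‖y‖ ^ 2) := by
  funext y
  have h1 : HasFDerivAt (fun y : E d => ‖y‖ ^ 2) (2 • innerSL ℝ y) y :=
    (hasStrictFDerivAt_norm_sq y).hasFDerivAt
  have h2 := ((hf (‖y‖ ^ 2)).hasDerivAt.comp_hasFDerivAt y h1).fderiv
  have h3 : pd (fun y : E d => f (‖y‖ ^ 2)) i y
      = fderiv ℝ (f ∘ fun y : E d => ‖y‖ ^ 2) y (EuclideanSpace.single i 1) := rfl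
  rw [h3, h2]
  simp [EuclideanSpace.inner_single_right]
  ring

/-- In terms of `t = |y|²`, the Laplacian of a radial function `f(t)` is `2 d f' + 4 t f''`. -/
lemma lap_radial {f : ℝ → ℝ} (hf : ContDiff ℝ ∞ f) :
    lap (fun y : E d => f (‖y‖ ^ 2)) =
      fun y => 2 * d * deriv f (‖y‖ ^ 2) + 4 * ‖y‖ ^ 2 * deriv (deriv f) (‖y‖ ^ 2) := by
  funext y
  have hf1 : Differentiable ℝ f := hf.differentiable (by simp)
  have hf2 : ContDiff ℝ ∞ (deriv f) := (contDiff_infty_iff_deriv.1 hf).2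
  have hf3 : Differentiable ℝ (deriv f) := hf2.differentiable (by simp)
  have hc : ∀ i : Fin d, ContDiff ℝ ∞ fun y : E d => 2 * y i := fun i => by fun_prop
  have hpc : ∀ i : Fin d, pd (fun y : E d => 2 * y i) i y = 2 := fun i => by
    have h0 : HasFDerivAt (fun y : E d => y i) (EuclideanSpace.proj (𝕜 := ℝ) i : E d →L[ℝ] ℝ) y :=
      (EuclideanSpace.proj (𝕜 := ℝ) i : E d →L[ℝ] ℝ).hasFDerivAt
    have h1 : HasFDerivAt (fun y : E d => 2 * y i)
        ((2 : ℝ) • (EuclideanSpace.proj (𝕜 := ℝ) i : E d →L[ℝ] ℝ)) y :=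
      h0.const_mul 2
    simp [pd, h1.fderiv]
  have key : ∀ i : Fin d, pd (pd (fun y : E d => f (‖y‖ ^ 2)) i) i y =
      2 * deriv f (‖y‖ ^ 2) + 4 * (y i) ^ 2 * deriv (deriv f) (‖y‖ ^ 2) := by
    intro i
    rw [pd_radial hf1, pd_mul (hc i).diff_infty (contDiff_radial hf2).diff_infty]
    simp only [hpc, pd_radial hf3]
    ring
  simp only [lap, key, Finset.sum_add_distrib, Finset.sum_const, Finset.card_univ,
    Fintype.card_fin, ← Finset.sum_mul, ← Finset.mul_sum]
  rw [EuclideanSpace.real_norm_sq_eq]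
  simp
  ring

namespace IsTestFunction

variable {U V : Set (E d)} {φ ψ : E d → ℝ}

lemma mono (h : IsTestFunction U φ) (hUV : U ⊆ V) : IsTestFunction V φ :=
  ⟨h.smooth, h.compact, h.support_subset.trans hUV⟩

lemma pd (h : IsTestFunction U φ) (i : Fin d) : IsTestFunction U (pd φ i) :=
  ⟨contDiff_pd h.smooth i, h.compact.mono' (subset_closure.trans (tsupport_pd_subset φ i)),
    (tsupport_pd_subset φ i).trans h.support_subset⟩

lemma lap (h : IsTestFunction U φ) : IsTestFunction U (lap φ) :=
  ⟨contDiff_lap h.smooth, h.compact.mono' (subset_closure.trans (tsupport_lap_subset φ)),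
    (tsupport_lap_subset φ).trans h.support_subset⟩

lemma mul_smooth (h : IsTestFunction U φ) (hψ : ContDiff ℝ ∞ ψ) :
    IsTestFunction U fun x => φ x * ψ x :=
  ⟨h.smooth.mul hψ, h.compact.mul_right, (tsupport_mul_subset_left).trans h.support_subset⟩

lemma smooth_mul (h : IsTestFunction U φ) (hψ : ContDiff ℝ ∞ ψ) :
    IsTestFunction U fun x => ψ x * φ x := by
  simpa only [mul_comm] using h.mul_smooth hψ

lemma continuous (h : IsTestFunction U φ) : Continuous φ := h.smooth.continuous

lemma exists_bound (h : IsTestFunction U φ) : ∃ C, ∀ x, ‖φ x‖ ≤ C :=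
  h.compact.exists_bound_of_continuous h.continuous

lemma eq_zero (h : IsTestFunction U φ) {x : E d} (hx : x ∉ U) : φ x = 0 :=
  image_eq_zero_of_notMem_tsupport fun h' => hx (h.support_subset h')

lemma integrable_mul (h : IsTestFunction U φ) {g : E d → ℝ} (hg : Integrable g) :
    Integrable fun x => g x * φ x := by
  obtain ⟨C, hC⟩ := h.exists_bound
  exact hg.mul_bdd (c := C) h.continuous.aestronglyMeasurable (Filter.Eventually.of_forall hC)

lemma memLp (h : IsTestFunction U φ) (p : ENNReal) : MemLp φ p volume :=
  h.continuous.memLp_of_hasCompactSupport h.compact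

lemma memLp_mul (h : IsTestFunction U φ) {g : E d → ℝ} (hg : MemLp g 2 volume) :
    MemLp (fun x => g x * φ x) 2 volume := by
  obtain ⟨C, hC⟩ := h.exists_bound
  exact MemLp.mul (p := 2) (q := ⊤) (r := 2) (memLp_top_of_bound
    h.continuous.aestronglyMeasurable C (Filter.Eventually.of_forall hC)) hg

lemma integrable_mul_of_memLp (h : IsTestFunction U φ) {g : E d → ℝ} (hg : MemLp g 2 volume) :
    Integrable fun x => g x * φ x :=
  hg.integrable_mul (h.memLp 2)

end IsTestFunction

end

section

variable {d : ℕ}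

/-! ### Mollification of square-integrable functions -/

/-- `|∫ g w(· - a)|` is bounded uniformly in the translation `a`. -/
lemma abs_integral_mul_translate_le {g w : E d → ℝ} (hg : MemLp g 2 volume)
    (hw : MemLp w 2 volume) (a : E d) :
    ∫ y, ‖g y * w (y - a)‖ ≤ (∫ y, g y ^ 2) + ∫ y, w y ^ 2 := by
  have hwa : MemLp (fun y => w (y - a)) 2 volume :=
    hw.comp_measurePreserving (measurePreserving_sub_right volume a)
  have h1 : ∫ y, w y ^ 2 = ∫ y, w (y - a) ^ 2 :=
    (integral_sub_right_eq_self (fun y => w y ^ 2) a).symm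
  rw [h1, ← integral_add hg.integrable_sq hwa.integrable_sq]
  refine integral_mono_of_nonneg (Filter.Eventually.of_forall fun _ => norm_nonneg _)
    (hg.integrable_sq.add hwa.integrable_sq) (Filter.Eventually.of_forall fun y => ?_)
  simp only [Real.norm_eq_abs, abs_mul]
  nlinarith [sq_nonneg (|g y| - |w (y - a)|), sq_abs (g y), sq_abs (w (y - a)),
    sq_nonneg (g y), sq_nonneg (w (y - a))]

/-- Translations act continuously on `L²`, tested weakly. -/
lemma continuous_integral_mul_translate {g w : E d → ℝ} (hg : MemLp g 2 volume)
    (hw : MemLp w 2 volume) : Continuous fun a => ∫ y, g y * w (y - a) := by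
  have : Fact ((2 : ENNReal) ≠ ⊤) := ⟨by simp⟩
  have h1 : Continuous fun a : E d => (DomAddAct.mk (-a) +ᵥ hw.toLp w : Lp ℝ 2 volume) := by
    have : Continuous fun a : E d => (DomAddAct.mk (-a)) := by
      fun_prop
    exact this.vadd continuous_const
  have h2 : Continuous fun a : E d =>
      inner ℝ (hg.toLp g) (DomAddAct.mk (-a) +ᵥ hw.toLp w : Lp ℝ 2 volume) :=
    continuous_const.inner h1
  refine h2.congr fun a => ?_
  rw [L2.inner_def]
  refine integral_congr_ae ?_
  have h3 : ∀ᵐ y, hw.toLp w (-a +ᵥ y) = w (-a +ᵥ y) :=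
    (measurePreserving_add_left volume (-a)).quasiMeasurePreserving.ae
      (p := fun y => hw.toLp w y = w y) hw.coeFn_toLp
  filter_upwards [hg.coeFn_toLp, DomAddAct.vadd_Lp_ae_eq (DomAddAct.mk (-a)) (hw.toLp w), h3]
    with y h4 h5 h6
  rw [h4, h5]
  have h7 : DomAddAct.mk.symm (DomAddAct.mk (-a)) +ᵥ y = -a +ᵥ y := by simp
  have h8 : -a +ᵥ y = y - a := by simp [sub_eq_neg_add]
  rw [h7, h6, h8]
  simp [mul_comm]

/-- The rescaled kernel `t⁻ᵈ K(·/t)`. -/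
noncomputable def dilate (K : E d → ℝ) (t : ℝ) (z : E d) : ℝ := (t ^ d)⁻¹ * K (t⁻¹ • z)

/-- The convolution `w * K_t` with the rescaled kernel. -/
noncomputable def mollify (K : E d → ℝ) (t : ℝ) (w : E d → ℝ) (y : E d) : ℝ :=
  ∫ x, w x * dilate K t (y - x)

lemma integral_dilate_mul (K f : E d → ℝ) {t : ℝ} (ht : 0 < t) :
    ∫ z, f z * dilate K t z = ∫ z, f (t • z) * K z := by
  have := Measure.integral_comp_smul (volume : Measure (E d)) (fun z => f z * dilate K t z) t
  simp only [dilate, inv_smul_smul₀ ht.ne', finrank_euclideanSpace, Fintype.card_fin] at this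
  rw [abs_of_pos (by positivity)] at this
  have h2 : (fun z => f (t • z) * ((t ^ d)⁻¹ * K z))
      = fun z => (t ^ d)⁻¹ * (f (t • z) * K z) := by
    funext z; ring
  rw [h2, integral_const_mul, smul_eq_mul] at this
  exact (mul_left_cancel₀ (by positivity) this).symm

lemma continuous_dilate {K : E d → ℝ} (hK : Continuous K) (t : ℝ) : Continuous (dilate K t) := by
  unfold dilate; fun_prop

lemma contDiff_dilate {K : E d → ℝ} (hK : ContDiff ℝ ∞ K) (t : ℝ) :
    ContDiff ℝ ∞ (dilate K t) := by
  unfold dilate; fun_prop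

lemma hasCompactSupport_dilate {K : E d → ℝ} (hK : HasCompactSupport K) {t : ℝ} (ht : 0 < t) :
    HasCompactSupport (dilate K t) :=
  (hK.comp_smul (inv_ne_zero ht.ne')).mul_left

lemma mollify_eq_swap (K : E d → ℝ) (t : ℝ) (w : E d → ℝ) (y : E d) :
    mollify K t w y = ∫ z, w (y - z) * dilate K t z := by
  rw [mollify, ← integral_sub_left_eq_self _ volume y]
  simp

/-- Mollifications converge weakly in `L²`. -/
lemma tendsto_integral_mul_mollify {g w K : E d → ℝ} (hg : MemLp g 2 volume)
    (hw : MemLp w 2 volume) (hK : Continuous K) (hKc : HasCompactSupport K)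
    (hK1 : ∫ z, K z = 1) :
    Filter.Tendsto (fun t : ℝ => ∫ y, g y * mollify K t w y) (nhdsWithin 0 (Set.Ioi 0))
      (nhds (∫ y, g y * w y)) := by
  set c : E d → ℝ := fun a => ∫ y, g y * w (y - a) with hc
  have hcc : Continuous c := continuous_integral_mul_translate hg hw
  set B : ℝ := (∫ y, g y ^ 2) + ∫ y, w y ^ 2 with hB
  have hcB : ∀ a, ‖c a‖ ≤ B := fun a =>
    (norm_integral_le_integral_norm _).trans (abs_integral_mul_translate_le hg hw a)
  have key : ∀ t : ℝ, 0 < t → ∫ y, g y * mollify K t w y = ∫ z, c (t • z) * K z := by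
    intro t ht
    rw [← integral_dilate_mul K c ht]
    have hKt := continuous_dilate hK t
    have hKtc := hasCompactSupport_dilate hKc ht
    have hm : AEStronglyMeasurable (fun p : E d × E d => g p.1 * (w (p.1 - p.2) * dilate K t p.2))
        (volume.prod volume) := by
      refine hg.1.comp_fst.mul (AEStronglyMeasurable.mul ?_ ?_)
      · exact hw.1.comp_quasiMeasurePreserving (quasiMeasurePreserving_sub volume volume)
      · exact (hKt.comp continuous_snd).aestronglyMeasurable
    have hwa : ∀ a, MemLp (fun y => w (y - a)) 2 volume := fun a =>
      hw.comp_measurePreserving (measurePreserving_sub_right volume a)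
    have hint : Integrable (fun p : E d × E d => g p.1 * (w (p.1 - p.2) * dilate K t p.2))
        (volume.prod volume) := by
      rw [integrable_prod_iff' hm]
      constructor
      · refine Filter.Eventually.of_forall fun z => ?_
        have := (hg.integrable_mul (hwa z)).mul_const (dilate K t z)
        simpa [mul_assoc] using this
      · refine Integrable.mono' (g := fun z => B * ‖dilate K t z‖)
          ((hKt.integrable_of_hasCompactSupport hKtc).norm.const_mul B)
          hm.norm.prod_swap.integral_prod_right' (Filter.Eventually.of_forall fun z => ?_)
        rw [Real.norm_of_nonneg (integral_nonneg fun _ => norm_nonneg _)]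
        have h1 : ∀ y, ‖g y * (w (y - z) * dilate K t z)‖
            = ‖g y * w (y - z)‖ * ‖dilate K t z‖ := fun y => by
          rw [← mul_assoc, norm_mul]
        simp only [h1, integral_mul_const]
        exact mul_le_mul_of_nonneg_right (abs_integral_mul_translate_le hg hw z) (norm_nonneg _)
    have h2 : ∀ y, g y * mollify K t w y = ∫ z, g y * (w (y - z) * dilate K t z) := fun y => by
      rw [mollify_eq_swap, integral_const_mul]
    simp only [h2]
    rw [integral_integral_swap hint]
    refine integral_congr_ae (Filter.Eventually.of_forall fun z => ?_)
    simp only [hc, ← mul_assoc, integral_mul_const]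
  have hlim : Filter.Tendsto (fun t : ℝ => ∫ z, c (t • z) * K z) (nhdsWithin 0 (Set.Ioi 0))
      (nhds (∫ z, c 0 * K z)) := by
    refine tendsto_integral_filter_of_dominated_convergence (fun z => B * ‖K z‖) ?_ ?_ ?_ ?_
    · refine Filter.Eventually.of_forall fun t => ?_
      exact ((hcc.comp (continuous_const_smul t)).mul hK).aestronglyMeasurable
    · refine Filter.Eventually.of_forall fun t => Filter.Eventually.of_forall fun z => ?_
      rw [norm_mul]
      exact mul_le_mul_of_nonneg_right (hcB _) (norm_nonneg _)
    · exact (hK.integrable_of_hasCompactSupport hKc).norm.const_mul B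
    · refine Filter.Eventually.of_forall fun z => ?_
      have : Continuous fun t : ℝ => c (t • z) * K z := by fun_prop
      have := this.tendsto 0
      simp only [zero_smul] at this
      exact this.mono_left nhdsWithin_le_nhds
  have h0 : ∫ z, c 0 * K z = ∫ y, g y * w y := by
    rw [integral_const_mul, hK1, mul_one]; simp [hc]
  rw [h0] at hlim
  refine hlim.congr' ?_
  filter_upwards [self_mem_nhdsWithin] with t ht using (key t ht).symm

lemma contDiff_mollify {K w : E d → ℝ} (hK : ContDiff ℝ ∞ K) (hKc : HasCompactSupport K)
    (hw : LocallyIntegrable w) {t : ℝ} (ht : 0 < t) : ContDiff ℝ ∞ (mollify K t w) := by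
  exact (hasCompactSupport_dilate hKc ht).contDiff_convolution_right (n := ⊤)
    (ContinuousLinearMap.lsmul ℝ ℝ) hw (contDiff_dilate hK t)

lemma pd_mollify {K w : E d → ℝ} (hK : ContDiff ℝ ∞ K) (hKc : HasCompactSupport K)
    (hw : LocallyIntegrable w) {t : ℝ} (ht : 0 < t) (i : Fin d) (y : E d) :
    pd (mollify K t w) i y = ∫ x, w x * pd (dilate K t) i (y - x) := by
  have hKt := contDiff_dilate hK t
  have h := ((hasCompactSupport_dilate hKc ht).hasFDerivAt_convolution_right
    (ContinuousLinearMap.lsmul ℝ ℝ) hw (hKt.of_le (by norm_cast)) y).fderiv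
  have h' : pd (mollify K t w) i y = fderiv ℝ (convolution w (dilate K t)
    (ContinuousLinearMap.lsmul ℝ ℝ) volume) y (EuclideanSpace.single i 1) := rfl
  rw [h', h]
  rw [convolution_precompR_apply (ContinuousLinearMap.lsmul ℝ ℝ) hw
    ((hasCompactSupport_dilate hKc ht).fderiv (𝕜 := ℝ)) (hKt.continuous_fderiv (by simp))]
  rfl

end

section

variable {d : ℕ}

/-! ### The energy identity for functions vanishing on the holes -/

/-- The exterior cone property of a set `H`: near every point there is a fixed direction `e` such
that moving from a point outside `H` by a small multiple of a vector close to `e` does not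
enter `H`. -/
def HasConeProperty (H : Set (E d)) : Prop :=
  ∀ x, ∃ δ > 0, ∃ e : E d, ∃ c > 0, ∀ y ∈ Metric.ball x δ, y ∉ H → ∀ t ∈ Set.Ioo 0 δ,
    ∀ z ∈ Metric.ball e c, y + t • z ∉ H

/-- A square-integrable pair `(u, G)` on the whole space, such that `G` is the weak gradient of `u`
inside the open set `U`. -/
structure HasWeakGrad (U : Set (E d)) (u : E d → ℝ) (G : E d → E d) : Prop where
  memLp : MemLp u 2 volume
  memLp_grad : MemLp G 2 volume
  integral_eq : ∀ φ : E d → ℝ, IsTestFunction U φ → ∀ i : Fin d,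
    ∫ x, u x * pd φ i x = -∫ x, G x i * φ x

lemma memLp_coord {G : E d → E d} (hG : MemLp G 2 volume) (i : Fin d) :
    MemLp (fun x => G x i) 2 volume :=
  hG.continuousLinearMap_comp (EuclideanSpace.proj (𝕜 := ℝ) i : E d →L[ℝ] ℝ)

variable {U : Set (E d)} {u : E d → ℝ} {G : E d → E d}

lemma HasWeakGrad.memLp_coord (h : HasWeakGrad U u G) (i : Fin d) :
    MemLp (fun x => G x i) 2 volume := Perforated.memLp_coord h.memLp_grad i

lemma HasWeakGrad.mono {V : Set (E d)} (h : HasWeakGrad U u G) (hV : V ⊆ U) :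
    HasWeakGrad V u G :=
  ⟨h.memLp, h.memLp_grad, fun φ hφ => h.integral_eq φ (hφ.mono hV)⟩

/-- The product rule `∂ᵢ(u θ) = Gᵢ θ + u ∂ᵢθ`, in mollified form. -/
lemma HasWeakGrad.pd_mollify (h : HasWeakGrad U u G) {θ K : E d → ℝ} (hθ : IsTestFunction U θ)
    (hK : ContDiff ℝ ∞ K) (hKc : HasCompactSupport K) {t : ℝ} (ht : 0 < t) (i : Fin d) (y : E d) :
    pd (mollify K t fun x => u x * θ x) i y =
      mollify K t (fun x => G x i * θ x + u x * pd θ i x) y := by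
  have hw : LocallyIntegrable fun x => u x * θ x :=
    (hθ.integrable_mul_of_memLp h.memLp).locallyIntegrable
  rw [Perforated.pd_mollify hK hKc hw ht, mollify]
  have hKt := contDiff_dilate hK t
  have hc : ContDiff ℝ ∞ fun x => dilate K t (y - x) := hKt.comp (by fun_prop)
  have hpd : pd (fun x => dilate K t (y - x)) i = fun x => - pd (dilate K t) i (y - x) := by
    have := pd_comp_affine (dilate K t) (-1) y i
    simpa using this
  have h1 := h.integral_eq _ (hθ.mul_smooth hc) i
  rw [pd_mul hθ.smooth.diff_infty hc.diff_infty, hpd] at h1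
  have i1 : Integrable fun x => u x * θ x * pd (dilate K t) i (y - x) := by
    have := (hθ.mul_smooth ((contDiff_pd hKt i).comp
      (contDiff_const.sub contDiff_id : ContDiff ℝ ∞ fun x => y - x))).integrable_mul_of_memLp
      h.memLp
    simpa [mul_assoc] using this
  have i2 : Integrable fun x => u x * pd θ i x * dilate K t (y - x) := by
    have := ((hθ.pd i).mul_smooth hc).integrable_mul_of_memLp h.memLp
    simpa [mul_assoc] using this
  have i3 : Integrable fun x => G x i * θ x * dilate K t (y - x) := by
    have := (hθ.mul_smooth hc).integrable_mul_of_memLp (h.memLp_coord i)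
    simpa [mul_assoc] using this
  have e1 : ∫ x, u x * (θ x * -pd (dilate K t) i (y - x) + dilate K t (y - x) * pd θ i x)
      = -(∫ x, u x * θ x * pd (dilate K t) i (y - x))
        + ∫ x, u x * pd θ i x * dilate K t (y - x) := by
    rw [← integral_neg, ← integral_add (by exact i1.neg) i2]
    congr 1; funext x; ring
  have e2 : ∫ x, (G x i * θ x + u x * pd θ i x) * dilate K t (y - x)
      = (∫ x, G x i * θ x * dilate K t (y - x)) + ∫ x, u x * pd θ i x * dilate K t (y - x) := by
    rw [← integral_add i3 i2]
    congr 1; funext x; ring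
  have e3 : ∫ x, G x i * (θ x * dilate K t (y - x)) = ∫ x, G x i * θ x * dilate K t (y - x) := by
    congr 1; funext x; ring
  rw [e2]
  rw [e1, e3] at h1
  linarith

open scoped Pointwise in
/-- If `w` is supported, up to a null set, in a compact part of `U` outside `H`, from which moving
in directions near `e` does not enter `H`, then the mollifications of `w` with kernels supported
near `e` are test functions in `U \ H`. -/
lemma isTestFunction_mollify {H A : Set (E d)} {w K : E d → ℝ} {x e : E d} {δ c : ℝ}
    (hU : IsOpen U)
    (hA : IsCompact A) (hAU : A ⊆ U ∩ Metric.ball x δ) (hδ : 0 < δ) (hc : 0 < c)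
    (hcone : ∀ y ∈ Metric.ball x δ, y ∉ H → ∀ t ∈ Set.Ioo 0 δ,
      ∀ z ∈ Metric.ball e c, y + t • z ∉ H)
    (hw : LocallyIntegrable w) (hwA : ∀ᵐ y, y ∉ A ∩ Hᶜ → w y = 0)
    (hK : ContDiff ℝ ∞ K) (hKs : ∀ z, z ∉ Metric.closedBall e (c / 2) → K z = 0) :
    ∀ᶠ t in nhdsWithin (0 : ℝ) (Set.Ioi 0), IsTestFunction (U ∩ Hᶜ) (mollify K t w) := by
  have hKc : HasCompactSupport K := HasCompactSupport.intro (isCompact_closedBall e (c / 2)) hKs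
  obtain ⟨r, hr, hrU⟩ := hA.exists_cthickening_subset_open hU (hAU.trans Set.inter_subset_left)
  have hM : 0 < ‖e‖ + c := by positivity
  have hlt : ∀ᶠ t in nhdsWithin (0 : ℝ) (Set.Ioi 0), t < min δ (r / (‖e‖ + c)) :=
    nhdsWithin_le_nhds (Iio_mem_nhds (lt_min hδ (by positivity)))
  filter_upwards [hlt, self_mem_nhdsWithin] with t htlt ht
  have ht : 0 < t := ht
  set S : Set (E d) := closure (A ∩ Hᶜ) + t • Metric.closedBall e (c / 2) with hS
  have hcA : closure (A ∩ Hᶜ) ⊆ A := closure_minimal Set.inter_subset_left hA.isClosed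
  have hScomp : IsCompact S :=
    (hA.of_isClosed_subset isClosed_closure hcA).add ((isCompact_closedBall e (c / 2)).smul t)
  have hsupp : ∀ y, y ∉ S → mollify K t w y = 0 := by
    intro y hy
    rw [mollify]
    refine integral_eq_zero_of_ae ?_
    filter_upwards [hwA] with z hz
    by_cases hzA : z ∈ A ∩ Hᶜ
    · have : K (t⁻¹ • (y - z)) = 0 := by
        apply hKs
        intro hmem
        apply hy
        refine Set.mem_add.2 ⟨z, subset_closure hzA, y - z,
          Set.mem_smul_set.2 ⟨_, hmem, smul_inv_smul₀ ht.ne' _⟩, by abel⟩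
      simp [dilate, this]
    · simp [hz hzA]
  have hts : tsupport (mollify K t w) ⊆ S :=
    closure_minimal (fun y hy => by
      by_contra h
      exact hy (hsupp y h)) hScomp.isClosed
  refine ⟨contDiff_mollify hK hKc hw ht, HasCompactSupport.intro hScomp hsupp, hts.trans ?_⟩
  intro y hy
  obtain ⟨a, ha, b, hb, rfl⟩ := Set.mem_add.1 hy
  obtain ⟨z, hz, rfl⟩ := Set.mem_smul_set.1 hb
  have hzn : ‖z‖ ≤ ‖e‖ + c / 2 := by
    have := norm_le_norm_add_norm_sub' z e
    rw [Metric.mem_closedBall, dist_eq_norm] at hz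
    linarith
  constructor
  · apply hrU
    refine Metric.mem_cthickening_of_dist_le _ a r A (hcA ha) ?_
    rw [dist_eq_norm, add_sub_cancel_left, norm_smul, Real.norm_of_nonneg ht.le]
    have h1 : t * (‖e‖ + c) < r := (lt_div_iff₀ hM).1 (htlt.trans_le (min_le_right _ _))
    nlinarith
  · -- Replace the limit point `a` by a nearby point outside `H`, at the cost of moving `z` a little.
    obtain ⟨a', ha', haa⟩ := Metric.mem_closure_iff.1 ha (t * (c / 2)) (by positivity)
    have hz' : z + t⁻¹ • (a - a') ∈ Metric.ball e c := by
      rw [Metric.mem_ball, dist_eq_norm]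
      rw [Metric.mem_closedBall, dist_eq_norm] at hz
      rw [dist_eq_norm] at haa
      have h1 : ‖t⁻¹ • (a - a')‖ < c / 2 := by
        rw [norm_smul, norm_inv, Real.norm_of_nonneg ht.le, inv_mul_lt_iff₀ ht]
        exact haa
      calc ‖z + t⁻¹ • (a - a') - e‖ = ‖(z - e) + t⁻¹ • (a - a')‖ := by congr 1; abel
        _ ≤ ‖z - e‖ + ‖t⁻¹ • (a - a')‖ := norm_add_le _ _
        _ < c := by linarith
    have := hcone a' (hAU ha'.1).2 ha'.2 t ⟨ht, htlt.trans_le (min_le_left _ _)⟩ _ hz'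
    rw [smul_add, smul_inv_smul₀ ht.ne'] at this
    convert this using 2
    abel

/-- A smooth kernel of integral one, supported in a closed ball. -/
lemma exists_kernel (e : E d) {r : ℝ} (hr : 0 < r) : ∃ K : E d → ℝ, ContDiff ℝ ∞ K ∧
    (∀ z, z ∉ Metric.closedBall e r → K z = 0) ∧ ∫ z, K z = 1 := by
  let f : ContDiffBump e := ⟨r / 2, r, by positivity, by linarith⟩
  refine ⟨f.normed volume, f.contDiff_normed, fun z hz => ?_, f.integral_normed⟩
  by_contra h
  have : z ∈ Function.support (f.normed volume) := h
  rw [f.support_normed_eq] at this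
  exact hz (Metric.ball_subset_closedBall this)

/-- The weak gradient of `u θ`, tested against `G`. It is the first variation of the energy of `u`
in the direction `u θ`. -/
noncomputable def energyVariation (u : E d → ℝ) (G : E d → E d) (θ : E d → ℝ) : ℝ :=
  ∑ i, ∫ x, G x i * (G x i * θ x + u x * pd θ i x)

/-- The variation vanishes for `θ` supported where one cone direction is available: mollified towards
the cone, `u θ` becomes an admissible test function in `U \ H`, and the mollification parameter can
be sent to zero. -/
lemma HasWeakGrad.energyVariation_eq_zero_of_local (h : HasWeakGrad U u G) (hU : IsOpen U)
    {H : Set (E d)} (hu0 : ∀ᵐ x, x ∈ H → u x = 0)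
    (hharm : ∀ φ, IsTestFunction (U ∩ Hᶜ) φ → ∑ i, ∫ x, G x i * pd φ i x = 0)
    {x e : E d} {δ c : ℝ} (hδ : 0 < δ) (hc : 0 < c)
    (hcone : ∀ y ∈ Metric.ball x δ, y ∉ H → ∀ t ∈ Set.Ioo 0 δ,
      ∀ z ∈ Metric.ball e c, y + t • z ∉ H)
    {θ : E d → ℝ} (hθ : IsTestFunction (U ∩ Metric.ball x δ) θ) :
    energyVariation u G θ = 0 := by
  have hθU : IsTestFunction U θ := hθ.mono Set.inter_subset_left
  obtain ⟨K, hK, hKs, hK1⟩ := exists_kernel e (half_pos hc)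
  have hKc : HasCompactSupport K := HasCompactSupport.intro (isCompact_closedBall e (c / 2)) hKs
  have hev := isTestFunction_mollify (w := fun x => u x * θ x) hU hθ.compact hθ.support_subset hδ hc
    hcone (hθU.integrable_mul_of_memLp h.memLp).locallyIntegrable (by
      filter_upwards [hu0] with y hy hyn
      by_cases hyH : y ∈ H
      · simp [hy hyH]
      · have : θ y = 0 := image_eq_zero_of_notMem_tsupport fun h' => hyn ⟨h', hyH⟩
        simp [this]) hK hKs
  have hW : ∀ i, MemLp (fun x => G x i * θ x + u x * pd θ i x) 2 volume := fun i =>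
    (hθU.memLp_mul (h.memLp_coord i)).add ((hθU.pd i).memLp_mul h.memLp)
  have hlim := tendsto_finsetSum Finset.univ fun i _ =>
    tendsto_integral_mul_mollify (h.memLp_coord i) (hW i) hK.continuous hKc hK1
  refine tendsto_nhds_unique hlim (tendsto_const_nhds.congr' ?_)
  filter_upwards [hev, self_mem_nhdsWithin] with t ht ht0
  rw [← hharm _ ht]
  refine Finset.sum_congr rfl fun i _ => ?_
  congr 1
  funext y
  rw [h.pd_mollify hθU hK hKc ht0]

lemma HasWeakGrad.energyVariation_sum (h : HasWeakGrad U u G) {ι : Type*} (s : Finset ι)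
    {θ : ι → E d → ℝ} (hθ : ∀ j ∈ s, IsTestFunction U (θ j)) :
    energyVariation u G (fun x => ∑ j ∈ s, θ j x) = ∑ j ∈ s, energyVariation u G (θ j) := by
  simp only [energyVariation]
  rw [Finset.sum_comm]
  refine Finset.sum_congr rfl fun i _ => ?_
  rw [← integral_finsetSum]
  · rw [pd_sum s fun j hj => (hθ j hj).smooth.diff_infty]
    simp only [Finset.mul_sum, ← Finset.sum_add_distrib]
  · intro j hj
    exact (h.memLp_coord i).integrable_mul (((hθ j hj).memLp_mul (h.memLp_coord i)).add
      (((hθ j hj).pd i).memLp_mul h.memLp))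

/-- The function `u θ` may be used as a test function although it need not have compact support
off the holes. A partition of unity reduces this to `θ` supported where one cone direction is
available. -/
lemma HasWeakGrad.energyVariation_eq_zero (h : HasWeakGrad U u G) (hU : IsOpen U)
    {H : Set (E d)} (hu0 : ∀ᵐ x, x ∈ H → u x = 0)
    (hharm : ∀ φ, IsTestFunction (U ∩ Hᶜ) φ → ∑ i, ∫ x, G x i * pd φ i x = 0)
    (hcone : HasConeProperty H) {θ : E d → ℝ} (hθ : IsTestFunction U θ) :
    energyVariation u G θ = 0 := by
  choose δ hδ e c hc hcone using hcone
  obtain ⟨s, hs⟩ := hθ.compact.elim_finite_subcover (fun x => Metric.ball x (δ x))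
    (fun x => Metric.isOpen_ball) (fun x _ => Set.mem_iUnion.2 ⟨x, Metric.mem_ball_self (hδ x)⟩)
  obtain ⟨f, hf⟩ := SmoothPartitionOfUnity.exists_isSubordinate (modelWithCornersSelf ℝ (E d))
    (isClosed_tsupport θ) (fun x : s => Metric.ball (x : E d) (δ x))
    (fun x => Metric.isOpen_ball) (fun x hx => by
      obtain ⟨i, hi, hi'⟩ := Set.mem_iUnion₂.1 (hs hx)
      exact Set.mem_iUnion.2 ⟨⟨i, hi⟩, hi'⟩)
  have hfs : ∀ j, ContDiff ℝ ∞ (f j) := fun j => (f j).contMDiff.contDiff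
  have hj : ∀ j : s, IsTestFunction (U ∩ Metric.ball (j : E d) (δ j)) fun x => θ x * f j x := by
    intro j
    have h1 := hθ.mul_smooth (hfs j)
    refine ⟨h1.smooth, h1.compact, fun x hx => ⟨h1.support_subset hx, hf j ?_⟩⟩
    exact tsupport_mul_subset_right (f := θ) (g := f j) hx
  have hsum : θ = fun x => ∑ j : s, θ x * f j x := by
    funext x
    rw [← Finset.mul_sum]
    by_cases hx : x ∈ tsupport θ
    · have := f.sum_eq_one hx
      rw [finsum_eq_sum_of_fintype] at this
      rw [this, mul_one]
    · rw [image_eq_zero_of_notMem_tsupport hx, zero_mul]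
  rw [hsum, h.energyVariation_sum Finset.univ fun j _ => (hj j).mono Set.inter_subset_left]
  exact Finset.sum_eq_zero fun j _ =>
    h.energyVariation_eq_zero_of_local hU hu0 hharm (hδ j) (hc j) (hcone j) (hj j)

/-- The chain rule `∂ᵢ(u²) = 2 u Gᵢ` in weak form. -/
lemma HasWeakGrad.integral_sq_mul_pd (h : HasWeakGrad U u G) (hU : IsOpen U) {ψ : E d → ℝ}
    (hψ : IsTestFunction U ψ) (i : Fin d) :
    ∫ x, u x ^ 2 * pd ψ i x = -2 * ∫ x, u x * G x i * ψ x := by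
  obtain ⟨r, hr, hrU⟩ := hψ.compact.exists_cthickening_subset_open hU hψ.support_subset
  obtain ⟨f, hf1, hf0, -⟩ := exists_contMDiffMap_one_nhds_of_subset_interior (n := ⊤)
    (modelWithCornersSelf ℝ (E d)) (isClosed_tsupport ψ)
    (t := Metric.cthickening r (tsupport ψ))
    ((Metric.self_subset_thickening hr _).trans
      (Metric.isOpen_thickening.subset_interior_iff.2 (Metric.thickening_subset_cthickening _ _)))
  have hfU : IsTestFunction U f := by
    have hcomp : IsCompact (Metric.cthickening r (tsupport ψ)) :=
      hψ.compact.isCompact.cthickening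
    exact ⟨f.contMDiff.contDiff, HasCompactSupport.intro hcomp hf0,
      (closure_minimal (fun x hx => by
        by_contra h'
        exact hx (hf0 x h')) hcomp.isClosed).trans hrU⟩
  have hf1' : ∀ x ∈ tsupport ψ, f =ᶠ[nhds x] fun _ => 1 := fun x hx =>
    Filter.eventually_of_mem (mem_nhdsSet_iff_forall.1 hf1 x hx) fun y hy => hy
  obtain ⟨K, hK, hKs, hK1⟩ := exists_kernel (0 : E d) one_pos
  have hKc : HasCompactSupport K := HasCompactSupport.intro (isCompact_closedBall 0 1) hKs
  have hw : MemLp (fun x => u x * f x) 2 volume := hfU.memLp_mul h.memLp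
  have hW : MemLp (fun x => G x i * f x + u x * pd f i x) 2 volume :=
    (hfU.memLp_mul (h.memLp_coord i)).add ((hfU.pd i).memLp_mul h.memLp)
  have l1 := tendsto_integral_mul_mollify (hψ.memLp_mul h.memLp) hW hK.continuous hKc hK1
  have l2 := tendsto_integral_mul_mollify ((hψ.pd i).memLp_mul h.memLp) hw hK.continuous hKc hK1
  have l3 := tendsto_integral_mul_mollify (hψ.memLp_mul (h.memLp_coord i)) hw hK.continuous hKc hK1
  have l4 := (l1.add l2).add l3
  have hzero := tendsto_nhds_unique l4 (tendsto_const_nhds (x := (0 : ℝ)) |>.congr' (by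
    filter_upwards [self_mem_nhdsWithin] with t ht
    have hv : ContDiff ℝ ∞ (mollify K t fun x => u x * f x) :=
      contDiff_mollify hK hKc (hfU.integrable_mul_of_memLp h.memLp).locallyIntegrable ht
    have h1 := h.integral_eq _ (hψ.mul_smooth hv) i
    rw [pd_mul hψ.smooth.diff_infty hv.diff_infty] at h1
    simp only [mul_add] at h1
    rw [integral_add ((hψ.mul_smooth (contDiff_pd hv i)).integrable_mul_of_memLp h.memLp)
      (((hψ.pd i).smooth_mul hv).integrable_mul_of_memLp h.memLp)] at h1
    have e1 : ∀ x, u x * (ψ x * pd (mollify K t fun x => u x * f x) i x)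
        = u x * ψ x * mollify K t (fun x => G x i * f x + u x * pd f i x) x := fun x => by
      rw [h.pd_mollify hfU hK hKc ht]; ring
    have e2 : ∀ x, u x * ((mollify K t fun x => u x * f x) x * pd ψ i x)
        = u x * pd ψ i x * mollify K t (fun x => u x * f x) x := fun x => by ring
    have e3 : ∀ x, G x i * (ψ x * (mollify K t fun x => u x * f x) x)
        = G x i * ψ x * mollify K t (fun x => u x * f x) x := fun x => by ring
    simp only [e1, e2, e3] at h1
    linarith))
  have e1 : ∀ x, u x * ψ x * (G x i * f x + u x * pd f i x) = u x * G x i * ψ x := by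
    intro x
    by_cases hx : x ∈ tsupport ψ
    · have h0 : pd f i x = 0 := by rw [pd_congr (hf1' x hx)]; simp [pd]
      rw [(hf1' x hx).self_of_nhds, h0]; ring
    · rw [image_eq_zero_of_notMem_tsupport hx]; ring
  have e2 : ∀ x, u x * pd ψ i x * (u x * f x) = u x ^ 2 * pd ψ i x := by
    intro x
    by_cases hx : x ∈ tsupport ψ
    · rw [(hf1' x hx).self_of_nhds]; ring
    · rw [pd_eq_zero_of_notMem hx]; ring
  have e3 : ∀ x, G x i * ψ x * (u x * f x) = u x * G x i * ψ x := by
    intro x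
    by_cases hx : x ∈ tsupport ψ
    · rw [(hf1' x hx).self_of_nhds]; ring
    · rw [image_eq_zero_of_notMem_tsupport hx]; ring
  simp only [e1, e2, e3] at hzero
  linarith

/-- The energy identity `∫ |∇u|² θ = ½ ∫ u² Δθ`, that is `Δ(u²) = 2|∇u|²`, holds across the
holes on which `u` vanishes. -/
lemma HasWeakGrad.integral_sq_mul_lap (h : HasWeakGrad U u G) (hU : IsOpen U)
    {H : Set (E d)} (hu0 : ∀ᵐ x, x ∈ H → u x = 0)
    (hharm : ∀ φ, IsTestFunction (U ∩ Hᶜ) φ → ∑ i, ∫ x, G x i * pd φ i x = 0)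
    (hcone : HasConeProperty H) {θ : E d → ℝ} (hθ : IsTestFunction U θ) :
    ∫ x, u x ^ 2 * lap θ x = 2 * ∫ x, ‖G x‖ ^ 2 * θ x := by
  have h0 := h.energyVariation_eq_zero hU hu0 hharm hcone hθ
  have i1 : ∀ i, Integrable fun x => G x i ^ 2 * θ x := fun i =>
    hθ.integrable_mul (h.memLp_coord i).integrable_sq
  have i2 : ∀ i, Integrable fun x => u x * G x i * pd θ i x := fun i =>
    (hθ.pd i).integrable_mul (h.memLp.integrable_mul (h.memLp_coord i))
  have i3 : ∀ i, Integrable fun x => u x ^ 2 * pd (pd θ i) i x := fun i =>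
    ((hθ.pd i).pd i).integrable_mul h.memLp.integrable_sq
  have e1 : ∀ i, ∫ x, G x i * (G x i * θ x + u x * pd θ i x)
      = (∫ x, G x i ^ 2 * θ x) - (1 / 2) * ∫ x, u x ^ 2 * pd (pd θ i) i x := by
    intro i
    rw [h.integral_sq_mul_pd hU (hθ.pd i) i]
    have : ∀ x, G x i * (G x i * θ x + u x * pd θ i x)
        = G x i ^ 2 * θ x + u x * G x i * pd θ i x := fun x => by ring
    simp only [this]
    rw [integral_add (i1 i) (i2 i)]
    ring
  simp only [energyVariation, e1, Finset.sum_sub_distrib, ← Finset.mul_sum] at h0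
  rw [← integral_finsetSum _ fun i _ => i1 i, ← integral_finsetSum _ fun i _ => i3 i] at h0
  have e2 : ∀ x, ‖G x‖ ^ 2 * θ x = ∑ i, G x i ^ 2 * θ x := fun x => by
    rw [EuclideanSpace.real_norm_sq_eq, Finset.sum_mul]
  have e3 : ∀ x, u x ^ 2 * lap θ x = ∑ i, u x ^ 2 * pd (pd θ i) i x := fun x => by
    rw [lap, Finset.mul_sum]
  simp only [e2, e3]
  linarith

/-- Weak harmonicity, with both derivatives moved to the test function. -/
lemma HasWeakGrad.integral_mul_lap_eq_zero (h : HasWeakGrad U u G) {H : Set (E d)}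
    (hharm : ∀ φ, IsTestFunction (U ∩ Hᶜ) φ → ∑ i, ∫ x, G x i * pd φ i x = 0)
    {φ : E d → ℝ} (hφ : IsTestFunction (U ∩ Hᶜ) φ) : ∫ x, u x * lap φ x = 0 := by
  have hφU : IsTestFunction U φ := hφ.mono Set.inter_subset_left
  simp only [lap, Finset.mul_sum]
  rw [integral_finsetSum _ fun i _ => ((hφU.pd i).pd i).integrable_mul_of_memLp h.memLp]
  simp only [h.integral_eq _ (hφU.pd _), Finset.sum_neg_distrib, hharm φ hφ, neg_zero]

end

section

variable {d : ℕ}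

/-! ### A monotone family of radial mollifiers -/

/-- The primitive `t ↦ ∫ₜᵇ h`. -/
noncomputable def tailIntegral (h : ℝ → ℝ) (b t : ℝ) : ℝ := ∫ s in t..b, h s

lemma hasDerivAt_tailIntegral {h : ℝ → ℝ} (hh : Continuous h) (b t : ℝ) :
    HasDerivAt (tailIntegral h b) (-h t) t :=
  intervalIntegral.integral_hasDerivAt_left (hh.intervalIntegrable _ _)
    hh.stronglyMeasurable.stronglyMeasurableAtFilter hh.continuousAt

lemma deriv_tailIntegral {h : ℝ → ℝ} (hh : Continuous h) (b : ℝ) :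
    deriv (tailIntegral h b) = fun t => -h t :=
  funext fun t => (hasDerivAt_tailIntegral hh b t).deriv

lemma contDiff_tailIntegral {h : ℝ → ℝ} (hh : ContDiff ℝ ∞ h) (b : ℝ) :
    ContDiff ℝ ∞ (tailIntegral h b) := by
  rw [contDiff_infty_iff_deriv, deriv_tailIntegral hh.continuous]
  exact ⟨fun t => (hasDerivAt_tailIntegral hh.continuous b t).differentiableAt, hh.neg⟩

lemma tailIntegral_eq_zero {h : ℝ → ℝ} {b t : ℝ} (hb : ∀ s, b ≤ s → h s = 0) (ht : b ≤ t) :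
    tailIntegral h b t = 0 := by
  rw [tailIntegral, intervalIntegral.integral_symm, neg_eq_zero]
  refine intervalIntegral.integral_zero_ae (Filter.Eventually.of_forall fun s hs => hb s ?_)
  rw [Set.uIoc_of_le ht] at hs
  exact hs.1.le

lemma tailIntegral_nonneg {h : ℝ → ℝ} {b : ℝ} (h0 : ∀ s, 0 ≤ h s) (hb : ∀ s, b ≤ s → h s = 0)
    (t : ℝ) : 0 ≤ tailIntegral h b t := by
  rcases le_total t b with htb | htb
  · exact intervalIntegral.integral_nonneg htb fun s _ => h0 s
  · exact (tailIntegral_eq_zero hb htb).ge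

/-- A smooth cutoff, equal to `1` on `t ≤ 1/2` and to `0` on `t ≥ 1`. -/
noncomputable def profile (t : ℝ) : ℝ := Real.smoothTransition (2 - 2 * t)

lemma contDiff_profile : ContDiff ℝ ∞ profile :=
  Real.smoothTransition.contDiff.comp (by fun_prop)

lemma profile_nonneg (t : ℝ) : 0 ≤ profile t := Real.smoothTransition.nonneg _

lemma profile_eq_zero {t : ℝ} (ht : 1 ≤ t) : profile t = 0 :=
  Real.smoothTransition.zero_of_nonpos (by linarith)

lemma profile_eq_one {t : ℝ} (ht : t ≤ 1 / 2) : profile t = 1 :=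
  Real.smoothTransition.one_of_one_le (by linarith)

/-- The radial function `β B(|x|²)` with `B' = -b/2`, where `b` is the `profile` and `β`
normalizes the integral of `b(|x|²)`. Its gradient is `-x β b(|x|²)`. -/
noncomputable def potentialBase (d : ℕ) (x : E d) : ℝ :=
  (∫ y : E d, profile (‖y‖ ^ 2))⁻¹ * (1 / 2 * tailIntegral profile 1 (‖x‖ ^ 2))

/-- The radial mollifier `β b(|x|²)`, of integral one. -/
noncomputable def rhoBase (d : ℕ) (x : E d) : ℝ :=
  (∫ y : E d, profile (‖y‖ ^ 2))⁻¹ * profile (‖x‖ ^ 2)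

/-- The mollifier `ρₛ = s⁻ᵈ ρ(·/s)`. -/
noncomputable def rho (s : ℝ) (x : E d) : ℝ := dilate (rhoBase d) s x

/-- The nonnegative potential `ζₛ` with `∇ζₛ = -(x/s) ρₛ`, so that `Δζₛ = ∂ₛρₛ`. -/
noncomputable def zeta (s : ℝ) (x : E d) : ℝ := s * dilate (potentialBase d) s x

lemma contDiff_rhoBase : ContDiff ℝ ∞ (rhoBase d) :=
  contDiff_const.mul (contDiff_radial contDiff_profile)

lemma contDiff_potentialBase : ContDiff ℝ ∞ (potentialBase d) :=
  contDiff_const.mul (contDiff_const.mul (contDiff_radial (contDiff_tailIntegral contDiff_profile 1)))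

lemma integral_profile_pos : 0 < ∫ y : E d, profile (‖y‖ ^ 2) := by
  refine (contDiff_radial contDiff_profile).continuous.integral_pos_of_hasCompactSupport_nonneg_nonzero
    (HasCompactSupport.intro (isCompact_closedBall (0 : E d) 1) fun x hx => ?_)
    (fun x => profile_nonneg _) (x := 0) ?_
  · apply profile_eq_zero
    rw [mem_closedBall_zero_iff, not_le] at hx
    nlinarith
  · rw [profile_eq_one (by simp)]; exact one_ne_zero

lemma rhoBase_nonneg (x : E d) : 0 ≤ rhoBase d x :=
  mul_nonneg (inv_nonneg.2 integral_profile_pos.le) (profile_nonneg _)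

lemma rhoBase_eq_zero {x : E d} (hx : 1 ≤ ‖x‖) : rhoBase d x = 0 := by
  rw [rhoBase, profile_eq_zero (by nlinarith), mul_zero]

lemma potentialBase_nonneg (x : E d) : 0 ≤ potentialBase d x :=
  mul_nonneg (inv_nonneg.2 integral_profile_pos.le) (mul_nonneg (by norm_num)
    (tailIntegral_nonneg profile_nonneg (fun _ => profile_eq_zero) _))

lemma potentialBase_eq_zero {x : E d} (hx : 1 ≤ ‖x‖) : potentialBase d x = 0 := by
  rw [potentialBase, tailIntegral_eq_zero (fun _ => profile_eq_zero) (by nlinarith)]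
  simp

lemma integral_rhoBase : ∫ x, rhoBase d x = 1 := by
  simp only [rhoBase]
  rw [integral_const_mul, inv_mul_cancel₀ integral_profile_pos.ne']

lemma one_le_norm_inv_smul {s : ℝ} (hs : 0 < s) {x : E d} (hx : s ≤ ‖x‖) : 1 ≤ ‖s⁻¹ • x‖ := by
  rw [norm_smul, norm_inv, Real.norm_of_nonneg hs.le, inv_mul_eq_div, le_div_iff₀ hs]
  linarith

lemma contDiff_rho (s : ℝ) : ContDiff ℝ ∞ (rho s : E d → ℝ) := contDiff_dilate contDiff_rhoBase s

lemma contDiff_zeta (s : ℝ) : ContDiff ℝ ∞ (zeta s : E d → ℝ) :=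
  contDiff_const.mul (contDiff_dilate contDiff_potentialBase s)

lemma rho_nonneg {s : ℝ} (hs : 0 < s) (x : E d) : 0 ≤ rho s x :=
  mul_nonneg (by positivity) (rhoBase_nonneg _)

lemma rho_eq_zero {s : ℝ} (hs : 0 < s) {x : E d} (hx : s ≤ ‖x‖) : rho s x = 0 := by
  rw [rho, dilate, rhoBase_eq_zero (one_le_norm_inv_smul hs hx), mul_zero]

lemma rho_neg (s : ℝ) (x : E d) : rho s (-x) = rho s x := by
  simp [rho, dilate, rhoBase]

lemma zeta_nonneg {s : ℝ} (hs : 0 < s) (x : E d) : 0 ≤ zeta s x :=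
  mul_nonneg hs.le (mul_nonneg (by positivity) (potentialBase_nonneg _))

lemma zeta_eq_zero {s : ℝ} (hs : 0 < s) {x : E d} (hx : s ≤ ‖x‖) : zeta s x = 0 := by
  rw [zeta, dilate, potentialBase_eq_zero (one_le_norm_inv_smul hs hx), mul_zero, mul_zero]

lemma isTestFunction_of_eq_zero {φ : E d → ℝ} (hφ : ContDiff ℝ ∞ φ) {x : E d} {s : ℝ}
    (h0 : ∀ y, s ≤ ‖y - x‖ → φ y = 0) {U : Set (E d)} (hU : Metric.closedBall x s ⊆ U) :
    IsTestFunction U φ := by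
  have h0' : ∀ y, y ∉ Metric.closedBall x s → φ y = 0 := fun y hy => by
    rw [mem_closedBall_iff_norm, not_le] at hy
    exact h0 y hy.le
  refine ⟨hφ, HasCompactSupport.intro (isCompact_closedBall x s) h0', ?_⟩
  refine (closure_minimal (fun y hy => ?_) Metric.isClosed_closedBall).trans hU
  by_contra h
  exact hy (h0' y h)

lemma isTestFunction_rho {s : ℝ} (hs : 0 < s) (x : E d) {U : Set (E d)}
    (hU : Metric.closedBall x s ⊆ U) : IsTestFunction U fun y => rho s (y - x) :=
  isTestFunction_of_eq_zero ((contDiff_rho s).comp (by fun_prop)) (fun _ h => rho_eq_zero hs h) hU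

lemma isTestFunction_zeta {s : ℝ} (hs : 0 < s) (x : E d) {U : Set (E d)}
    (hU : Metric.closedBall x s ⊆ U) : IsTestFunction U fun y => zeta s (y - x) :=
  isTestFunction_of_eq_zero ((contDiff_zeta s).comp (by fun_prop)) (fun _ h => zeta_eq_zero hs h) hU

lemma integral_rho {s : ℝ} (hs : 0 < s) (x : E d) : ∫ y, rho s (y - x) = 1 := by
  rw [integral_sub_right_eq_self (fun y => rho s y) x]
  have := integral_dilate_mul (rhoBase d) (fun _ => 1) hs
  simp only [one_mul, integral_rhoBase] at this
  exact this

lemma pd_potentialBase (i : Fin d) (x : E d) : pd (potentialBase d) i x = -(x i) * rhoBase d x := by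
  have h1 : ContDiff ℝ ∞ fun x : E d => tailIntegral profile 1 (‖x‖ ^ 2) :=
    contDiff_radial (contDiff_tailIntegral contDiff_profile 1)
  unfold potentialBase
  rw [pd_const_mul (contDiff_const.mul h1).diff_infty, pd_const_mul h1.diff_infty,
    pd_radial ((contDiff_tailIntegral contDiff_profile 1).differentiable (by simp)),
    deriv_tailIntegral contDiff_profile.continuous, rhoBase]
  ring

lemma dilate_eq_affine (K : E d → ℝ) (s : ℝ) :
    dilate K s = fun y => (s ^ d)⁻¹ * K (s⁻¹ • (y - 0)) := by
  funext y; simp [dilate]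

lemma pd_dilate {K : E d → ℝ} (hK : ContDiff ℝ ∞ K) (s : ℝ) (i : Fin d) (x : E d) :
    pd (dilate K s) i x = s⁻¹ * dilate (pd K i) s x := by
  have h1 : ContDiff ℝ ∞ fun y : E d => K (s⁻¹ • (y - 0)) := hK.comp (by fun_prop)
  rw [dilate_eq_affine K, pd_const_mul h1.diff_infty, pd_comp_affine, dilate_eq_affine]
  ring

lemma lap_dilate {K : E d → ℝ} (hK : ContDiff ℝ ∞ K) (s : ℝ) (x : E d) :
    lap (dilate K s) x = (s⁻¹) ^ 2 * dilate (lap K) s x := by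
  have h1 : ContDiff ℝ ∞ fun y : E d => K (s⁻¹ • (y - 0)) := hK.comp (by fun_prop)
  rw [dilate_eq_affine K, lap_const_mul h1, lap_comp_affine hK, dilate_eq_affine]
  ring

lemma pd_zeta {s : ℝ} (hs : 0 < s) (i : Fin d) (x : E d) :
    pd (zeta s) i x = -(s⁻¹ * x i) * rho s x := by
  have h0 : (zeta s : E d → ℝ) = fun x => s * dilate (potentialBase d) s x := rfl
  rw [h0, pd_const_mul (contDiff_dilate contDiff_potentialBase s).diff_infty]
  simp only [pd_dilate contDiff_potentialBase, rho, dilate, pd_potentialBase]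
  simp
  field_simp

lemma lap_potentialBase (x : E d) :
    lap (potentialBase d) x = -(d * rhoBase d x) - ∑ i, x i * pd (rhoBase d) i x := by
  have key : ∀ i, pd (pd (potentialBase d) i) i x = -rhoBase d x - x i * pd (rhoBase d) i x := by
    intro i
    have h0 : pd (potentialBase d) i = fun x => -(x i) * rhoBase d x := funext (pd_potentialBase i)
    have h1 : HasFDerivAt (fun y : E d => -(y i)) (-(EuclideanSpace.proj (𝕜 := ℝ) i : E d →L[ℝ] ℝ))
        x := (EuclideanSpace.proj (𝕜 := ℝ) i : E d →L[ℝ] ℝ).hasFDerivAt.neg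
    have h2 : pd (fun y : E d => -(y i)) i x = -1 := by simp [pd, h1.fderiv]
    rw [h0, pd_mul (by fun_prop) contDiff_rhoBase.diff_infty]
    simp only [h2]
    ring
  simp only [lap, key, Finset.sum_sub_distrib]
  simp

/-- The mollifiers satisfy `∂ₛρₛ = Δζₛ`. -/
lemma hasDerivAt_rho {s : ℝ} (hs : 0 < s) (x : E d) :
    HasDerivAt (fun s => rho s x) (lap (zeta s) x) s := by
  have h0 : (zeta s : E d → ℝ) = fun x => s * dilate (potentialBase d) s x := rfl
  rw [h0, lap_const_mul (contDiff_dilate contDiff_potentialBase s)]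
  simp only [lap_dilate contDiff_potentialBase]
  have h1 : HasDerivAt (fun s : ℝ => s⁻¹ • x) ((-(s ^ 2)⁻¹) • x) s := by
    simpa using (hasDerivAt_inv hs.ne').smul_const x
  have h2 : HasDerivAt (fun s : ℝ => rhoBase d (s⁻¹ • x))
      (fderiv ℝ (rhoBase d) (s⁻¹ • x) ((-(s ^ 2)⁻¹) • x)) s :=
    HasFDerivAt.comp_hasDerivAt (l := rhoBase d) (f := fun s : ℝ => s⁻¹ • x) s
      (contDiff_rhoBase.diff_infty (s⁻¹ • x)).hasFDerivAt h1
  have h3 : HasDerivAt (fun s : ℝ => (s ^ d)⁻¹) (-(d * s ^ (d - 1)) / (s ^ d) ^ 2) s :=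
    (hasDerivAt_pow d s).inv (by positivity)
  have h4 : HasDerivAt (fun s => rho s x) _ s := h3.mul h2
  convert h4 using 1
  simp only [dilate, lap_potentialBase]
  rw [map_smul, fderiv_eq_sum_pd]
  have h5 : -(d * s ^ (d - 1)) / (s ^ d) ^ 2 = -(d * (s ^ d)⁻¹ * s⁻¹) := by
    rcases Nat.eq_zero_or_pos d with hd | hd
    · simp [hd]
    · obtain ⟨n, rfl⟩ := Nat.exists_eq_succ_of_ne_zero hd.ne'
      simp only [Nat.succ_eq_add_one, Nat.add_sub_cancel]
      field_simp
      ring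
  rw [h5]
  simp only [smul_eq_mul, PiLp.smul_apply, mul_assoc, ← Finset.mul_sum]
  field_simp
  ring

lemma isTestFunction_potentialBase :
    IsTestFunction (Metric.closedBall (0 : E d) 1) (potentialBase d) :=
  isTestFunction_of_eq_zero (x := 0) (s := 1) contDiff_potentialBase
    (fun y hy => potentialBase_eq_zero (by simpa using hy)) le_rfl

/-- The derivatives of `ζₛ` up to order three scale like `s⁻ᵈ`, `s⁻ᵈ⁻¹`, `s⁻ᵈ⁻²`. -/
lemma exists_bound_zeta (d : ℕ) : ∃ C : ℝ, 1 ≤ C ∧ ∀ (s : ℝ), 0 < s → ∀ (x : E d) (i j : Fin d),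
    |pd (zeta s) i x| ≤ C * (s ^ d)⁻¹ ∧ |pd (pd (zeta s) i) j x| ≤ C * (s ^ d)⁻¹ * s⁻¹ ∧
    |lap (zeta s) x| ≤ C * (s ^ d)⁻¹ * s⁻¹ ∧
    |lap (pd (zeta s) i) x| ≤ C * (s ^ d)⁻¹ * (s⁻¹) ^ 2 := by
  have hZ := contDiff_potentialBase (d := d)
  have ht := isTestFunction_potentialBase (d := d)
  choose C1 hC1 using fun i => (ht.pd i).exists_bound
  choose C2 hC2 using fun i j => ((ht.pd i).pd j).exists_bound
  obtain ⟨C3, hC3⟩ := ht.lap.exists_bound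
  choose C4 hC4 using fun i => (ht.pd i).lap.exists_bound
  set C : ℝ := 1 + ∑ i, |C1 i| + ∑ i, ∑ j, |C2 i j| + |C3| + ∑ i, |C4 i| with hC
  have n1 : 0 ≤ ∑ i, |C1 i| := Finset.sum_nonneg fun _ _ => abs_nonneg _
  have n2 : 0 ≤ ∑ i, ∑ j, |C2 i j| :=
    Finset.sum_nonneg fun _ _ => Finset.sum_nonneg fun _ _ => abs_nonneg _
  have n4 : 0 ≤ ∑ i, |C4 i| := Finset.sum_nonneg fun _ _ => abs_nonneg _
  have b1 : ∀ i, C1 i ≤ C := fun i => by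
    have h1 := Finset.single_le_sum (fun i _ => abs_nonneg (C1 i)) (Finset.mem_univ i)
    have h2 := le_abs_self (C1 i)
    have h3 := abs_nonneg C3
    linarith
  have b2 : ∀ i j, C2 i j ≤ C := fun i j => by
    have h1 := Finset.single_le_sum (fun j _ => abs_nonneg (C2 i j)) (Finset.mem_univ j)
    have h1' := Finset.single_le_sum (f := fun i => ∑ j, |C2 i j|)
      (fun i _ => Finset.sum_nonneg fun _ _ => abs_nonneg _) (Finset.mem_univ i)
    have h2 := le_abs_self (C2 i j)
    have h3 := abs_nonneg C3
    linarith
  have b3 : C3 ≤ C := by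
    have h2 := le_abs_self C3
    linarith
  have b4 : ∀ i, C4 i ≤ C := fun i => by
    have h1 := Finset.single_le_sum (fun i _ => abs_nonneg (C4 i)) (Finset.mem_univ i)
    have h2 := le_abs_self (C4 i)
    have h3 := abs_nonneg C3
    linarith
  have hC0 : 1 ≤ C := by
    have h3 := abs_nonneg C3
    linarith
  refine ⟨C, hC0, fun s hs x i j => ?_⟩
  have h0 : (zeta s : E d → ℝ) = fun x => s * dilate (potentialBase d) s x := rfl
  have hd := fun K : E d → ℝ => fun hK : ContDiff ℝ ∞ K => contDiff_dilate hK s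
  have e1 : pd (zeta s) i = dilate (pd (potentialBase d) i) s := by
    funext x
    rw [h0, pd_const_mul (hd _ hZ).diff_infty]
    simp only [pd_dilate hZ, mul_inv_cancel_left₀ hs.ne']
  have e3 : lap (zeta s) x = s⁻¹ * dilate (lap (potentialBase d)) s x := by
    rw [h0, lap_const_mul (hd _ hZ)]
    simp only [lap_dilate hZ]
    field_simp
  have hb : ∀ {f : E d → ℝ} {B : ℝ}, (∀ x, ‖f x‖ ≤ B) → B ≤ C → ∀ {a : ℝ}, 0 ≤ a →
      |a * dilate f s x| ≤ C * (s ^ d)⁻¹ * a := by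
    intro f B hf hB a ha
    rw [dilate, abs_mul, abs_mul, abs_of_nonneg ha, abs_of_nonneg (by positivity : 0 ≤ (s ^ d)⁻¹)]
    have := (hf (s⁻¹ • x)).trans hB
    rw [Real.norm_eq_abs] at this
    calc a * ((s ^ d)⁻¹ * |f (s⁻¹ • x)|) ≤ a * ((s ^ d)⁻¹ * C) := by gcongr
      _ = C * (s ^ d)⁻¹ * a := by ring
  refine ⟨?_, ?_, ?_, ?_⟩
  · have := hb (hC1 i) (b1 i) zero_le_one
    simpa [e1] using this
  · rw [e1, pd_dilate (contDiff_pd hZ i)]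
    exact hb (hC2 i j) (b2 i j) (by positivity)
  · rw [e3]
    exact hb hC3 b3 (by positivity)
  · rw [e1, lap_dilate (contDiff_pd hZ i)]
    exact hb (hC4 i) (b4 i) (by positivity)

/-- The average `∫ g ρₛ(· - x)` of `g` around `x` at scale `s`. -/
noncomputable def avg (g : E d → ℝ) (s : ℝ) (x : E d) : ℝ := ∫ y, g y * rho s (y - x)

lemma rho_le {s : ℝ} (hs : 0 < s) (x : E d) :
    rho s x ≤ (∫ y : E d, profile (‖y‖ ^ 2))⁻¹ * (s ^ d)⁻¹ := by
  rw [rho, dilate, rhoBase, mul_comm]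
  gcongr
  have h1 : profile (‖s⁻¹ • x‖ ^ 2) ≤ 1 := Real.smoothTransition.le_one _
  have h2 : 0 ≤ (∫ y : E d, profile (‖y‖ ^ 2))⁻¹ := inv_nonneg.2 integral_profile_pos.le
  nlinarith

lemma IsTestFunction.integrable_mul_of_locallyIntegrable {U : Set (E d)} {φ g : E d → ℝ}
    (h : IsTestFunction U φ) (hg : LocallyIntegrable g) : Integrable fun x => g x * φ x := by
  simpa [mul_comm] using hg.integrable_smul_left_of_hasCompactSupport h.continuous h.compact

lemma integrable_mul_rho {g : E d → ℝ} (hg : LocallyIntegrable g) {s : ℝ} (hs : 0 < s) (x : E d) :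
    Integrable fun y => g y * rho s (y - x) :=
  (isTestFunction_rho hs x (Set.subset_univ _)).integrable_mul_of_locallyIntegrable hg

/-- The average at scale `s` is differentiable in `s`. -/
lemma hasDerivAt_avg {g : E d → ℝ} (hg : LocallyIntegrable g) {s : ℝ} (hs : 0 < s) (x : E d) :
    HasDerivAt (fun s => avg g s x) (∫ y, g y * lap (zeta s) (y - x)) s := by
  obtain ⟨C, hC1, hC⟩ := exists_bound_zeta d
  have hpos : ∀ r ∈ Metric.ball s (s / 2), s / 2 < r := fun r hr => by
    rw [Metric.mem_ball, Real.dist_eq, abs_lt] at hr; linarith [hr.1]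
  have hC' : ∀ r, 0 < r → ∀ z : E d, |lap (zeta r) z| ≤ C * (r ^ d)⁻¹ * r⁻¹ := by
    intro r hr z
    rcases Nat.eq_zero_or_pos d with hd | hd
    · subst hd
      simp only [lap, Finset.univ_eq_empty, Finset.sum_empty, abs_zero]
      positivity
    · exact (hC r hr z ⟨0, hd⟩ ⟨0, hd⟩).2.2.1
  have hlt : ∀ r ∈ Metric.ball s (s / 2), r < 2 * s := fun r hr => by
    rw [Metric.mem_ball, Real.dist_eq, abs_lt] at hr; linarith [hr.2]
  have hi : Integrable ((Metric.closedBall x (2 * s)).indicator g) :=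
    (hg.integrableOn_isCompact (isCompact_closedBall _ _)).integrable_indicator
      Metric.isClosed_closedBall.measurableSet
  refine (hasDerivAt_integral_of_dominated_loc_of_deriv_le (μ := volume)
    (F := fun s y => g y * rho s (y - x)) (F' := fun s y => g y * lap (zeta s) (y - x))
    (x₀ := s) (s := Metric.ball s (s / 2))
    (bound := fun y => |(Metric.closedBall x (2 * s)).indicator g y| * (C * ((s / 2) ^ d)⁻¹ * (s / 2)⁻¹)) (Metric.ball_mem_nhds s (by linarith))
    ?_ (integrable_mul_rho hg hs x) ?_ ?_ (hi.abs.mul_const _) ?_).2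
  · exact Filter.Eventually.of_forall fun r => hg.aestronglyMeasurable.mul
      (((contDiff_rho r).continuous.comp (continuous_sub_right x)).aestronglyMeasurable)
  · exact hg.aestronglyMeasurable.mul
      (((contDiff_lap (contDiff_zeta s)).continuous.comp
        (continuous_sub_right x)).aestronglyMeasurable)
  · refine Filter.Eventually.of_forall fun y r hr => ?_
    have hr' := hpos r hr
    have hr0 : 0 < r := by linarith
    have hr2 := hlt r hr
    rw [norm_mul, Real.norm_eq_abs, Real.norm_eq_abs]
    by_cases hy : y ∈ Metric.closedBall x (2 * s)
    swap
    · have : lap (zeta r) (y - x) = 0 := by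
        have h1 := (isTestFunction_zeta hr0 x le_rfl).lap.eq_zero (x := y) (fun h =>
          hy (Metric.closedBall_subset_closedBall hr2.le h))
        rwa [lap_comp_sub (contDiff_zeta r)] at h1
      rw [this, abs_zero, mul_zero]
      positivity
    rw [Set.indicator_of_mem hy]
    gcongr
    refine (hC' r hr0 (y - x)).trans ?_
    gcongr
  · refine Filter.Eventually.of_forall fun y r hr => ?_
    have hr' := hpos r hr
    exact (hasDerivAt_rho (by linarith) (y - x)).const_mul (g y)

/-- Lebesgue differentiation for the averages. -/
lemma ae_tendsto_avg {g : E d → ℝ} (hg : LocallyIntegrable g) :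
    ∀ᵐ x, Filter.Tendsto (fun s => avg g s x) (nhdsWithin 0 (Set.Ioi 0)) (nhds (g x)) := by
  filter_upwards [(Besicovitch.vitaliFamily (volume : Measure (E d))).ae_tendsto_average_norm_sub hg]
    with x hx
  have h1 := hx.comp (Besicovitch.tendsto_filterAt (volume : Measure (E d)) x)
  have h2 := tendsto_integral_smul_of_tendsto_average_norm_sub (μ := volume)
    (l := nhdsWithin (0 : ℝ) (Set.Ioi 0)) (a := fun s => Metric.closedBall x s) (f := g) (c := g x)
    (g := fun s y => rho s (y - x))
    ((∫ y : E d, profile (‖y‖ ^ 2))⁻¹ * volume.real (Metric.closedBall (0 : E d) 1)) h1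
    (Filter.Eventually.of_forall fun s => hg.integrableOn_isCompact (isCompact_closedBall _ _))
    (tendsto_const_nhds.congr' (by
      filter_upwards [self_mem_nhdsWithin] with s hs using (integral_rho hs x).symm))
    (by
      filter_upwards [self_mem_nhdsWithin] with s hs y hy
      by_contra h
      rw [mem_closedBall_iff_norm, not_le] at h
      exact hy (rho_eq_zero hs h.le))
    (by
      filter_upwards [self_mem_nhdsWithin] with s hs y
      have hs : 0 < s := hs
      rw [abs_of_nonneg (rho_nonneg hs _)]
      refine (rho_le hs _).trans (le_of_eq ?_)
      rw [Measure.addHaar_real_closedBall _ _ hs.le, Measure.addHaar_real_closedBall _ _ zero_le_one,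
        finrank_euclideanSpace, Fintype.card_fin]
      have : volume.real (Metric.ball (0 : E d) 1) ≠ 0 :=
        (ENNReal.toReal_pos (Metric.measure_ball_pos volume _ one_pos).ne'
          measure_ball_lt_top.ne).ne'
      field_simp
      simp)
  refine h2.congr fun s => ?_
  simp [avg, mul_comm]

end

section

variable {d : ℕ} {U : Set (E d)} {u : E d → ℝ} {G : E d → E d}

/-! ### Averages of solutions of the energy identity -/

/-- A pair `(u, ∇u)` for which `Δ(u²) = 2|∇u|²` holds weakly in `U`. -/
structure IsEnergySolution (U : Set (E d)) (u : E d → ℝ) (G : E d → E d) : Prop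
    extends HasWeakGrad U u G where
  integral_sq_mul_lap_eq : ∀ θ : E d → ℝ, IsTestFunction U θ →
    ∫ x, u x ^ 2 * lap θ x = 2 * ∫ x, ‖G x‖ ^ 2 * θ x

lemma locallyIntegrable_of_memLp {f : E d → ℝ} (hf : MemLp f 2 volume) : LocallyIntegrable f :=
  hf.locallyIntegrable (by norm_num)

lemma HasWeakGrad.integrable_norm_sq (h : HasWeakGrad U u G) : Integrable fun x => ‖G x‖ ^ 2 :=
  (memLp_two_iff_integrable_sq_norm h.memLp_grad.1).1 h.memLp_grad

/-- Jensen's inequality for the averages. -/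
lemma sq_avg_le {f : E d → ℝ} (hf : MemLp f 2 volume) {s : ℝ} (hs : 0 < s) (x : E d) :
    avg f s x ^ 2 ≤ avg (fun y => f y ^ 2) s x := by
  set m := avg f s x with hm
  have i0 : Integrable fun y => rho s (y - x) := by
    have := (isTestFunction_rho hs x (Set.subset_univ _)).memLp 1
    exact memLp_one_iff_integrable.1 this
  have i1 := integrable_mul_rho (locallyIntegrable_of_memLp hf) hs x
  have i2 := integrable_mul_rho hf.integrable_sq.locallyIntegrable hs x
  have h0 : 0 ≤ ∫ y, (f y - m) ^ 2 * rho s (y - x) :=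
    integral_nonneg fun y => mul_nonneg (sq_nonneg _) (rho_nonneg hs _)
  have e : ∫ y, (f y - m) ^ 2 * rho s (y - x)
      = avg (fun y => f y ^ 2) s x - 2 * m * m + m ^ 2 := by
    have e1 : ∀ y, (f y - m) ^ 2 * rho s (y - x)
        = f y ^ 2 * rho s (y - x) - 2 * m * (f y * rho s (y - x)) + m ^ 2 * rho s (y - x) :=
      fun y => by ring
    simp only [e1]
    rw [integral_add (by exact i2.sub (i1.const_mul (2 * m))) (i0.const_mul _), integral_sub i2 (i1.const_mul _),
      integral_const_mul, integral_const_mul, integral_rho hs]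
    simp only [avg, hm]
    ring
  nlinarith

/-- The kernel `ρₛ` is bounded by a multiple of `s⁻ᵈ` and supported in the ball of radius `s`. -/
lemma exists_avg_le (d : ℕ) : ∃ C : ℝ, 1 ≤ C ∧ ∀ (f : E d → ℝ), Integrable f → (∀ y, 0 ≤ f y) →
    ∀ (s : ℝ), 0 < s → ∀ x, avg f s x ≤ C * (s ^ d)⁻¹ * ∫ y in Metric.closedBall x s, f y := by
  refine ⟨max 1 (∫ y : E d, profile (‖y‖ ^ 2))⁻¹, le_max_left _ _, fun f hf hf0 s hs x => ?_⟩
  have e : avg f s x = ∫ y in Metric.closedBall x s, f y * rho s (y - x) := by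
    rw [avg, setIntegral_eq_integral_of_forall_compl_eq_zero]
    intro y hy
    rw [mem_closedBall_iff_norm, not_le] at hy
    rw [rho_eq_zero hs hy.le, mul_zero]
  rw [e, ← integral_const_mul]
  refine setIntegral_mono_on (integrable_mul_rho hf.locallyIntegrable hs x).integrableOn
    (hf.integrableOn.const_mul _) Metric.isClosed_closedBall.measurableSet fun y _ => ?_
  rw [mul_comm]
  refine mul_le_mul_of_nonneg_right ((rho_le hs _).trans ?_) (hf0 y)
  gcongr
  exact le_max_right _ _

/-- `u²` is subharmonic, so it is dominated by its averages. -/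
lemma IsEnergySolution.ae_sq_le_avg (h : IsEnergySolution U u G) :
    ∀ᵐ x, ∀ s, 0 < s → Metric.closedBall x s ⊆ U → u x ^ 2 ≤ avg (fun y => u y ^ 2) s x := by
  have hl : LocallyIntegrable fun y => u y ^ 2 := h.memLp.integrable_sq.locallyIntegrable
  filter_upwards [ae_tendsto_avg hl] with x hx s hs hsU
  have hmono : MonotoneOn (fun s => avg (fun y => u y ^ 2) s x) (Set.Ioc 0 s) := by
    refine monotoneOn_of_hasDerivWithinAt_nonneg (convex_Ioc 0 s)
      (fun t ht => (hasDerivAt_avg hl ht.1 x).continuousAt.continuousWithinAt)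
      (fun t ht => (hasDerivAt_avg hl (interior_subset ht).1 x).hasDerivWithinAt) fun t ht => ?_
    have ht' := interior_subset ht
    have htU : Metric.closedBall x t ⊆ U := (Metric.closedBall_subset_closedBall ht'.2).trans hsU
    have := h.integral_sq_mul_lap_eq _ (isTestFunction_zeta ht'.1 x htU)
    rw [lap_comp_sub (contDiff_zeta t)] at this
    rw [this]
    exact mul_nonneg zero_le_two
      (integral_nonneg fun y => mul_nonneg (sq_nonneg _) (zeta_nonneg ht'.1 _))
  refine le_of_tendsto hx ?_
  filter_upwards [Ioc_mem_nhdsGT hs] with t ht using hmono ht ⟨hs, le_rfl⟩ ht.2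

/-- The evolution of the averages of `∇u` in the scale. -/
lemma HasWeakGrad.hasDerivAt_avg_grad (h : HasWeakGrad U u G) {s : ℝ} (hs : 0 < s) {x : E d}
    (hU : Metric.closedBall x s ⊆ U) (i : Fin d) :
    HasDerivAt (fun s => avg (fun y => G y i) s x)
      (-∫ y, u y * lap (pd (fun y => zeta s (y - x)) i) y) s := by
  have h1 := hasDerivAt_avg (locallyIntegrable_of_memLp (h.memLp_coord i)) hs x
  convert h1 using 1
  have ht := isTestFunction_zeta hs x hU
  have h2 := h.integral_eq _ ht.lap i
  rw [pd_lap ht.smooth] at h2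
  rw [h2, neg_neg, lap_comp_sub (contDiff_zeta s)]

/-- The averages of `u` are smooth, and their gradients are the averages of `∇u`. -/
lemma HasWeakGrad.avg_contDiff (h : HasWeakGrad U u G) {s : ℝ} (hs : 0 < s) :
    ContDiff ℝ ∞ (avg u s) := by
  have e : avg u s = mollify (rhoBase d) s u := by
    funext x
    simp only [avg, mollify]
    refine integral_congr_ae (Filter.Eventually.of_forall fun y => ?_)
    simp only
    rw [← rho_neg, neg_sub]; rfl
  rw [e]
  exact contDiff_mollify contDiff_rhoBase (HasCompactSupport.intro (isCompact_closedBall (0 : E d) 1)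
    fun x hx => rhoBase_eq_zero (by rw [mem_closedBall_zero_iff, not_le] at hx; exact hx.le))
    (locallyIntegrable_of_memLp h.memLp) hs

lemma HasWeakGrad.pd_avg (h : HasWeakGrad U u G) {s : ℝ} (hs : 0 < s) {x : E d}
    (hU : Metric.closedBall x s ⊆ U) (i : Fin d) :
    pd (avg u s) i x = avg (fun y => G y i) s x := by
  have e : avg u s = mollify (rhoBase d) s u := by
    funext x
    simp only [avg, mollify]
    refine integral_congr_ae (Filter.Eventually.of_forall fun y => ?_)
    simp only
    rw [← rho_neg, neg_sub]; rfl
  rw [e, Perforated.pd_mollify contDiff_rhoBase (HasCompactSupport.intro (isCompact_closedBall (0 : E d) 1)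
    fun x hx => rhoBase_eq_zero (by rw [mem_closedBall_zero_iff, not_le] at hx; exact hx.le))
    (locallyIntegrable_of_memLp h.memLp) hs]
  have h1 := h.integral_eq _ (isTestFunction_rho hs x hU) i
  have h2 : pd (fun y => rho s (y - x)) i = fun y => - pd (dilate (rhoBase d) s) i (x - y) := by
    have h3 : (fun y => rho s (y - x)) = fun y => rho s ((-1 : ℝ) • (y - x)) := by
      funext y; rw [← rho_neg]; simp
    rw [h3, pd_comp_affine]
    funext y
    simp
    rfl
  rw [h2] at h1
  simp only [mul_neg, integral_neg, neg_inj] at h1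
  rw [h1]
  rfl

/-- The evolution of the averages of `u` in the scale is controlled by the averages of `|∇u|²`. -/
lemma HasWeakGrad.exists_deriv_avg (h : HasWeakGrad U u G) {s : ℝ} (hs : 0 < s) {x : E d}
    (hU : Metric.closedBall x s ⊆ U) :
    ∃ D, HasDerivAt (fun s => avg u s x) D s ∧ D ^ 2 ≤ avg (fun y => ‖G y‖ ^ 2) s x := by
  refine ⟨_, hasDerivAt_avg (locallyIntegrable_of_memLp h.memLp) hs x, ?_⟩
  have ht := isTestFunction_zeta hs x hU
  have e1 : ∫ y, u y * lap (zeta s) (y - x)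
      = ∑ i, ∫ y, s⁻¹ * (y - x) i * (G y i * rho s (y - x)) := by
    have e2 : ∀ y, u y * lap (zeta s) (y - x)
        = ∑ i, u y * pd (pd (fun y => zeta s (y - x)) i) i y := fun y => by
      rw [← Finset.mul_sum, ← lap, lap_comp_sub (contDiff_zeta s)]
    simp only [e2]
    rw [integral_finsetSum _ fun i _ => ((ht.pd i).pd i).integrable_mul_of_memLp h.memLp]
    refine Finset.sum_congr rfl fun i _ => ?_
    rw [h.integral_eq _ (ht.pd i) i, ← integral_neg]
    congr 1
    funext y
    rw [pd_comp_sub]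
    simp only [pd_zeta hs]
    ring
  have hGn : MemLp (fun y => ‖G y‖) 2 volume := h.memLp_grad.norm
  have hle : |∫ y, u y * lap (zeta s) (y - x)| ≤ avg (fun y => ‖G y‖) s x := by
    have hint : ∀ i, Integrable fun y => s⁻¹ * (y - x) i * (G y i * rho s (y - x)) := fun i => by
      have := ((isTestFunction_rho hs x (Set.subset_univ _)).smooth_mul
        (ψ := fun y : E d => s⁻¹ * (y - x) i) (by fun_prop)).integrable_mul_of_memLp (h.memLp_coord i)
      refine this.congr (Filter.Eventually.of_forall fun y => ?_)
      simp only; ring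
    rw [e1, ← integral_finsetSum _ fun i _ => hint i]
    refine abs_integral_le_integral_abs.trans (integral_mono_of_nonneg
      (Filter.Eventually.of_forall fun y => abs_nonneg _)
      (integrable_mul_rho (locallyIntegrable_of_memLp hGn) hs x)
      (Filter.Eventually.of_forall fun y => ?_))
    simp only
    have e3 : ∑ i, s⁻¹ * (y - x) i * (G y i * rho s (y - x))
        = s⁻¹ * rho s (y - x) * inner ℝ (y - x) (G y) := by
      rw [PiLp.inner_apply, Finset.mul_sum]
      refine Finset.sum_congr rfl fun i _ => ?_
      simp
      ring
    rcases le_or_gt s ‖y - x‖ with hy | hy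
    · rw [e3, rho_eq_zero hs hy]; simp
    · rw [e3, abs_mul, abs_of_nonneg (mul_nonneg (by positivity) (rho_nonneg hs _))]
      have h4 := abs_real_inner_le_norm (y - x) (G y)
      have h5 := rho_nonneg hs (y - x)
      calc s⁻¹ * rho s (y - x) * |inner ℝ (y - x) (G y)|
          ≤ s⁻¹ * rho s (y - x) * (s * ‖G y‖) := by
            gcongr
            exact h4.trans (by gcongr)
        _ = ‖G y‖ * rho s (y - x) := by field_simp
  have := sq_avg_le hGn hs x
  calc (∫ y, u y * lap (zeta s) (y - x)) ^ 2 = |∫ y, u y * lap (zeta s) (y - x)| ^ 2 :=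
        (sq_abs _).symm
    _ ≤ avg (fun y => ‖G y‖) s x ^ 2 := by gcongr
    _ ≤ _ := this

/-- The averages of `u` at two scales differ, in the square, by at most the energy averaged over the
scales in between. -/
lemma HasWeakGrad.sq_avg_sub_le (h : HasWeakGrad U u G) {δ : ℝ} (hδ : 0 < δ) (hδ1 : δ ≤ 1)
    {x : E d} (hU : Metric.closedBall x 1 ⊆ U) :
    (avg u 1 x - avg u δ x) ^ 2 ≤ ∫ s in δ..1, avg (fun y => ‖G y‖ ^ 2) s x := by
  set q : ℝ → ℝ := fun s => avg (fun y => ‖G y‖ ^ 2) s x with hq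
  have hl : LocallyIntegrable fun y => ‖G y‖ ^ 2 := h.integrable_norm_sq.locallyIntegrable
  have hqc : ContinuousOn q (Set.Icc δ 1) := fun s hs =>
    (hasDerivAt_avg hl (hδ.trans_le hs.1) x).continuousAt.continuousWithinAt
  have hq0 : ∀ s, 0 < s → 0 ≤ q s := fun s hs =>
    integral_nonneg fun y => mul_nonneg (sq_nonneg _) (rho_nonneg hs _)
  have hQ0 : 0 ≤ ∫ s in δ..1, q s :=
    intervalIntegral.integral_nonneg hδ1 fun s hs => hq0 s (hδ.trans_le hs.1)
  choose! D hD hDq using fun (s : ℝ) (hs : s ∈ Set.Icc δ 1) =>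
    h.exists_deriv_avg (hδ.trans_le hs.1) ((Metric.closedBall_subset_closedBall hs.2).trans hU)
  -- By the inequality `2 |D| ≤ l + D² / l`, valid for all `l > 0`.
  have key : ∀ l : ℝ, 0 < l →
      |avg u 1 x - avg u δ x| ≤ (l + l⁻¹ * ∫ s in δ..1, q s) / 2 := by
    intro l hl0
    have hB : ∀ s ∈ Set.Ico δ 1, HasDerivWithinAt
        (fun s => (l * (s - δ) + l⁻¹ * ∫ r in δ..s, q r) / 2) ((l + l⁻¹ * q s) / 2)
        (Set.Ici s) s := by
      intro s hs
      have h1 : HasDerivWithinAt (fun s => ∫ r in δ..s, q r) (q s) (Set.Ici s) s := by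
        have hci := hqc.intervalIntegrable_of_Icc (μ := volume) (u := q) hδ1
        have hqs : ContinuousAt q s := (hasDerivAt_avg hl (hδ.trans_le hs.1) x).continuousAt
        refine (intervalIntegral.integral_hasDerivAt_right
          ((hqc.mono (Set.Icc_subset_Icc_right hs.2.le)).intervalIntegrable_of_Icc hs.1) ?_
          hqs).hasDerivWithinAt
        refine ContinuousOn.stronglyMeasurableAtFilter (s := Set.Ioi 0) isOpen_Ioi
          (fun r hr => (hasDerivAt_avg hl hr x).continuousAt.continuousWithinAt) _
          (hδ.trans_le hs.1)
      have h2 : HasDerivWithinAt (fun s => l * (s - δ)) l (Set.Ici s) s := by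
        simpa using (((hasDerivAt_id s).sub_const δ).const_mul l).hasDerivWithinAt
      exact (h2.add (h1.const_mul _)).div_const 2
    have hBc : ContinuousOn (fun s => (l * (s - δ) + l⁻¹ * ∫ r in δ..s, q r) / 2)
        (Set.Icc δ 1) := by
      have : ContinuousOn (fun s => ∫ r in δ..s, q r) (Set.Icc δ 1) := by
        have := intervalIntegral.continuousOn_primitive_interval (μ := volume) (a := δ) (b := 1)
          (f := q) (by rw [Set.uIcc_of_le hδ1]; exact hqc.integrableOn_Icc)
        rwa [Set.uIcc_of_le hδ1] at this
      fun_prop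
    have := image_norm_le_of_norm_deriv_right_le_deriv_boundary'
      (f := fun s => avg u s x - avg u δ x) (f' := D) (a := δ) (b := 1)
      (fun s hs => ((hD s hs).continuousAt.continuousWithinAt).sub continuousWithinAt_const)
      (fun s hs => ((hD s ⟨hs.1, hs.2.le⟩).sub_const _).hasDerivWithinAt)
      (B := fun s => (l * (s - δ) + l⁻¹ * ∫ r in δ..s, q r) / 2)
      (B' := fun s => (l + l⁻¹ * q s) / 2) (by simp) hBc hB (by
        intro s hs
        have h1 := hDq s ⟨hs.1, hs.2.le⟩
        rw [Real.norm_eq_abs]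
        have h2 : D s ^ 2 ≤ q s := h1
        have h3 : 2 * |D s| ≤ l + l⁻¹ * D s ^ 2 := by
          have h4 : l⁻¹ * (|D s| - l) ^ 2 = l + l⁻¹ * D s ^ 2 - 2 * |D s| := by
            rw [sub_sq, sq_abs]; field_simp; ring
          have h5 : 0 ≤ l⁻¹ * (|D s| - l) ^ 2 := by positivity
          linarith
        have h6 : l⁻¹ * D s ^ 2 ≤ l⁻¹ * q s := by gcongr
        linarith) (Set.right_mem_Icc.2 hδ1)
    rw [Real.norm_eq_abs] at this
    refine this.trans ?_
    have : l * (1 - δ) ≤ l := by nlinarith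
    linarith
  rcases (abs_nonneg (avg u 1 x - avg u δ x)).eq_or_lt with h0 | h0
  · rw [← sq_abs, ← h0]; simpa using hQ0
  · have := key _ h0
    set m := |avg u 1 x - avg u δ x| with hm
    have h1 : m * m ≤ m * ((m + m⁻¹ * ∫ s in δ..1, q s) / 2) := by gcongr
    have h2 : m * ((m + m⁻¹ * ∫ s in δ..1, q s) / 2) = (m * m + ∫ s in δ..1, q s) / 2 := by
      field_simp
    rw [← sq_abs, ← hm, sq]
    linarith

lemma measurable_rho_uncurry : Measurable fun p : ℝ × E d => rho p.1 p.2 := by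
  unfold rho dilate
  have h1 : Continuous (rhoBase d) := contDiff_rhoBase.continuous
  exact ((measurable_fst.pow_const d).inv).mul
    (h1.measurable.comp (measurable_fst.inv.smul measurable_snd))

/-- Integrating averages at scales `s ≤ 1` over a ball costs a unit enlargement of the ball. -/
lemma lintegral_lintegral_avg_le {g : E d → ℝ} (hg : Integrable g) (hg0 : ∀ y, 0 ≤ g y) (r : ℝ) :
    ∫⁻ x in Metric.ball (0 : E d) r, ∫⁻ s in Set.Ioc (0 : ℝ) 1, ENNReal.ofReal (avg g s x)
      ≤ ENNReal.ofReal (∫ y in Metric.ball (0 : E d) (r + 1), g y) := by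
  have hgm : AEMeasurable (fun y => ENNReal.ofReal (g y)) volume := hg.1.aemeasurable.ennreal_ofReal
  set g' := hgm.mk with hg'
  have hgm' : Measurable g' := hgm.measurable_mk
  have hgg : ∀ᵐ y, ENNReal.ofReal (g y) = g' y := hgm.ae_eq_mk
  have hF : Measurable fun p : (E d × ℝ) × E d =>
      g' p.2 * ENNReal.ofReal (rho p.1.2 (p.2 - p.1.1)) := by
    refine (hgm'.comp measurable_snd).mul (Measurable.ennreal_ofReal ?_)
    exact measurable_rho_uncurry.comp ((measurable_snd.comp measurable_fst).prodMk
      (measurable_snd.sub (measurable_fst.comp measurable_fst)))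
  have e1 : ∀ x : E d, ∫⁻ s in Set.Ioc (0 : ℝ) 1, ENNReal.ofReal (avg g s x)
      = ∫⁻ s in Set.Ioc (0 : ℝ) 1, ∫⁻ y, g' y * ENNReal.ofReal (rho s (y - x)) := by
    intro x
    refine setLIntegral_congr_fun measurableSet_Ioc fun s hs => ?_
    simp only [avg]
    rw [ofReal_integral_eq_lintegral_ofReal (integrable_mul_rho hg.locallyIntegrable hs.1 x)
      (Filter.Eventually.of_forall fun y => mul_nonneg (hg0 y) (rho_nonneg hs.1 _))]
    refine lintegral_congr_ae ?_
    filter_upwards [hgg] with y hy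
    rw [ENNReal.ofReal_mul (hg0 y), hy]
  simp only [e1]
  rw [lintegral_lintegral_swap (f := fun x s => ∫⁻ y, g' y * ENNReal.ofReal (rho s (y - x)))
    hF.lintegral_prod_right'.aemeasurable]
  have e2 : ∀ s ∈ Set.Ioc (0 : ℝ) 1, ∫⁻ x in Metric.ball (0 : E d) r,
      ∫⁻ y, g' y * ENNReal.ofReal (rho s (y - x)) ≤ ∫⁻ y in Metric.ball (0 : E d) (r + 1), g' y := by
    intro s hs
    rw [lintegral_lintegral_swap (f := fun x y => g' y * ENNReal.ofReal (rho s (y - x)))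
      (hF.comp ((measurable_fst.prodMk measurable_const).prodMk measurable_snd :
        Measurable fun p : E d × E d => ((p.1, s), p.2))).aemeasurable,
      ← lintegral_indicator Metric.isOpen_ball.measurableSet]
    refine lintegral_mono fun y => ?_
    have hm : Measurable fun x => ENNReal.ofReal (rho s (y - x)) :=
      ((contDiff_rho s).continuous.comp (continuous_sub_left y)).measurable.ennreal_ofReal
    rw [lintegral_const_mul _ hm]
    by_cases hy : y ∈ Metric.ball (0 : E d) (r + 1)
    · rw [Set.indicator_of_mem hy]
      have h1 : ∫⁻ x in Metric.ball (0 : E d) r, ENNReal.ofReal (rho s (y - x)) ≤ 1 := by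
        refine (setLIntegral_le_lintegral _ _).trans ?_
        have hi : Integrable fun x => rho s (y - x) := by
          have h2 : Integrable (rho s : E d → ℝ) := by
            have := (isTestFunction_rho hs.1 (0 : E d) (Set.subset_univ _)).memLp 1
            simpa using memLp_one_iff_integrable.1 this
          exact h2.comp_sub_left y
        rw [← ofReal_integral_eq_lintegral_ofReal hi
          (Filter.Eventually.of_forall fun y => rho_nonneg hs.1 _)]
        rw [integral_sub_left_eq_self (fun x => rho s x) volume y]
        have := integral_rho (d := d) hs.1 0
        simp only [sub_zero] at this
        rw [this]; simp
      calc _ ≤ g' y * 1 := by gcongr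
        _ = g' y := mul_one _
    · rw [Set.indicator_of_notMem hy]
      have h1 : ∫⁻ x in Metric.ball (0 : E d) r, ENNReal.ofReal (rho s (y - x)) = 0 := by
        rw [setLIntegral_eq_zero_iff Metric.isOpen_ball.measurableSet hm]
        refine Filter.Eventually.of_forall fun x hx => ?_
        rw [rho_eq_zero hs.1, ENNReal.ofReal_zero]
        rw [mem_ball_zero_iff] at hx hy
        have := norm_sub_norm_le y x
        linarith [hs.2]
      rw [h1, mul_zero]
  refine (setLIntegral_mono' measurableSet_Ioc e2).trans ?_
  rw [setLIntegral_const, Real.volume_Ioc, sub_zero, ENNReal.ofReal_one, mul_one,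
    ofReal_integral_eq_lintegral_ofReal hg.integrableOn
      (Filter.Eventually.of_forall fun y => hg0 y)]
  exact (lintegral_congr_ae (ae_restrict_of_ae hgg)).ge

/-- A Poincaré inequality at unit scale: `u` is close in `L²` to its averages at scale one. -/
lemma HasWeakGrad.integral_sq_sub_avg_le (h : HasWeakGrad U u G) {r : ℝ}
    (hr : Metric.ball (0 : E d) (r + 1) ⊆ U) :
    ∫ x in Metric.ball (0 : E d) r, (u x - avg u 1 x) ^ 2
      ≤ ∫ y in Metric.ball (0 : E d) (r + 1), ‖G y‖ ^ 2 := by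
  have hpt : ∀ᵐ x, x ∈ Metric.ball (0 : E d) r → ENNReal.ofReal ((u x - avg u 1 x) ^ 2) ≤
      ∫⁻ s in Set.Ioc (0 : ℝ) 1, ENNReal.ofReal (avg (fun y => ‖G y‖ ^ 2) s x) := by
    filter_upwards [ae_tendsto_avg (locallyIntegrable_of_memLp h.memLp)] with x hx hxr
    have hxU : Metric.closedBall x 1 ⊆ U := by
      refine subset_trans (fun y hy => ?_) hr
      rw [mem_ball_zero_iff] at hxr ⊢
      rw [mem_closedBall_iff_norm] at hy
      have := norm_le_norm_add_norm_sub' y x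
      linarith
    have hlim : Filter.Tendsto (fun δ => ENNReal.ofReal ((avg u 1 x - avg u δ x) ^ 2))
        (nhdsWithin 0 (Set.Ioi 0)) (nhds (ENNReal.ofReal ((u x - avg u 1 x) ^ 2))) := by
      have e : (u x - avg u 1 x) ^ 2 = (avg u 1 x - u x) ^ 2 := by ring
      rw [e]
      exact (ENNReal.continuous_ofReal.tendsto _).comp ((tendsto_const_nhds.sub hx).pow 2)
    refine le_of_tendsto hlim ?_
    filter_upwards [Ioc_mem_nhdsGT one_pos] with δ hδ
    refine (ENNReal.ofReal_le_ofReal (h.sq_avg_sub_le hδ.1 hδ.2 hxU)).trans ?_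
    have hl : LocallyIntegrable fun y => ‖G y‖ ^ 2 := h.integrable_norm_sq.locallyIntegrable
    have hqc : ContinuousOn (fun s => avg (fun y => ‖G y‖ ^ 2) s x) (Set.Icc δ 1) := fun s hs =>
      (hasDerivAt_avg hl (hδ.1.trans_le hs.1) x).continuousAt.continuousWithinAt
    rw [intervalIntegral.integral_of_le hδ.2, ofReal_integral_eq_lintegral_ofReal
      (hqc.integrableOn_Icc.mono_set Set.Ioc_subset_Icc_self)
      ((ae_restrict_iff' measurableSet_Ioc).2 (Filter.Eventually.of_forall fun s hs =>
        integral_nonneg fun y => mul_nonneg (sq_nonneg _)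
          (rho_nonneg (hδ.1.trans hs.1) _)))]
    exact lintegral_mono_set (Set.Ioc_subset_Ioc_left hδ.1.le)
  have h1 : ∫⁻ x in Metric.ball (0 : E d) r, ENNReal.ofReal ((u x - avg u 1 x) ^ 2) ≤
      ENNReal.ofReal (∫ y in Metric.ball (0 : E d) (r + 1), ‖G y‖ ^ 2) :=
    (lintegral_mono_ae ((ae_restrict_iff' Metric.isOpen_ball.measurableSet).2 hpt)).trans
      (lintegral_lintegral_avg_le h.integrable_norm_sq (fun y => sq_nonneg _) r)
  have hm : AEStronglyMeasurable (fun x => (u x - avg u 1 x) ^ 2)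
      (volume.restrict (Metric.ball (0 : E d) r)) :=
    (((h.memLp.1.sub (h.avg_contDiff one_pos).continuous.aestronglyMeasurable).pow 2)).restrict
  rw [integral_eq_lintegral_of_nonneg_ae (Filter.Eventually.of_forall fun x => sq_nonneg _) hm]
  exact ENNReal.toReal_le_of_le_ofReal
    (setIntegral_nonneg Metric.isOpen_ball.measurableSet fun y _ => sq_nonneg _) h1

end

section

variable {d : ℕ} {U : Set (E d)} {u : E d → ℝ} {G : E d → E d}

/-! ### Scaled energies and the Caccioppoli inequality -/

/-- The energy of `G` on the ball `B(0, r)`, divided by `rᵈ`. -/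
noncomputable def scaledEnergy (G : E d → E d) (r : ℝ) : ℝ :=
  (r ^ d)⁻¹ * ∫ y in Metric.ball (0 : E d) r, ‖G y‖ ^ 2

lemma setIntegral_mono_of_subset {f : E d → ℝ} (hf : Integrable f) (hf0 : ∀ y, 0 ≤ f y) {S T : Set (E d)}
    (hST : S ⊆ T) : ∫ y in S, f y ≤ ∫ y in T, f y :=
  setIntegral_mono_set hf.integrableOn (Filter.Eventually.of_forall hf0) hST.eventuallyLE

lemma scaledEnergy_nonneg (G : E d → E d) {r : ℝ} (hr : 0 < r) : 0 ≤ scaledEnergy G r :=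
  mul_nonneg (by positivity) (integral_nonneg fun _ => sq_nonneg _)

lemma pow_mul_scaledEnergy (G : E d → E d) {r : ℝ} (hr : 0 < r) :
    r ^ d * scaledEnergy G r = ∫ y in Metric.ball (0 : E d) r, ‖G y‖ ^ 2 := by
  rw [scaledEnergy, mul_inv_cancel_left₀ (by positivity)]

/-- The scaled energies at comparable radii are comparable, in the trivial direction. -/
lemma scaledEnergy_le (hG : Integrable fun y => ‖G y‖ ^ 2) {r R K : ℝ} (hr : 0 < r) (hrR : r ≤ R)
    (hK : R ≤ K * r) : scaledEnergy G r ≤ K ^ d * scaledEnergy G R := by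
  have hR : 0 < R := hr.trans_le hrR
  have h1 : ∫ y in Metric.ball (0 : E d) r, ‖G y‖ ^ 2 ≤ ∫ y in Metric.ball (0 : E d) R, ‖G y‖ ^ 2 :=
    setIntegral_mono_of_subset hG (fun _ => sq_nonneg _) (Metric.ball_subset_ball hrR)
  rw [← pow_mul_scaledEnergy G hR] at h1
  have h2 : R ^ d ≤ K ^ d * r ^ d := by rw [← mul_pow]; gcongr
  rw [scaledEnergy, inv_mul_le_iff₀ (by positivity)]
  calc _ ≤ R ^ d * scaledEnergy G R := h1
    _ ≤ (K ^ d * r ^ d) * scaledEnergy G R := by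
        gcongr
        exact scaledEnergy_nonneg G hR
    _ = _ := by ring

/-- A contraction `a(r) ≤ a(4r)/2 + B` across scales bounds `a` by its values at the top scale. -/
lemma le_of_contraction {a : ℝ → ℝ} {r₀ L A B : ℝ} (hr₀ : 0 < r₀) (hA : 0 ≤ A) (hB : 0 ≤ B)
    (hstep : ∀ r, r₀ ≤ r → 4 * r ≤ L → a r ≤ 1 / 2 * a (4 * r) + B)
    (htop : ∀ r, r₀ ≤ r → r ≤ L → L < 4 * r → a r ≤ A) :
    ∀ r, r₀ ≤ r → r ≤ L → a r ≤ A + 2 * B := by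
  have key : ∀ n : ℕ, ∀ r, r₀ ≤ r → r ≤ L → L < 4 ^ n * r → a r ≤ A + 2 * B := by
    intro n
    induction n with
    | zero => intro r _ h1 h2; simp at h2; linarith
    | succ n ih =>
      intro r h0 h1 h2
      rcases lt_or_ge L (4 * r) with h3 | h3
      · linarith [htop r h0 h1 h3]
      · have := ih (4 * r) (by linarith) h3 (by rw [pow_succ] at h2; linarith)
        linarith [hstep r h0 h3]
  intro r h0 h1
  obtain ⟨n, hn⟩ := pow_unbounded_of_one_lt (L / r) (by norm_num : (1 : ℝ) < 4)
  exact key n r h0 h1 (by rwa [div_lt_iff₀ (hr₀.trans_le h0)] at hn)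

lemma integral_lap_eq_zero {φ : E d → ℝ} (hφ : IsTestFunction U φ) : ∫ x, lap φ x = 0 := by
  have key : ∀ ψ : E d → ℝ, IsTestFunction U ψ → ∀ i, ∫ x, pd ψ i x = 0 := by
    intro ψ hψ i
    have := integral_mul_fderiv_eq_neg_fderiv_mul_of_integrable (μ := (volume : Measure (E d)))
      (f := fun _ => (1 : ℝ)) (g := ψ) (v := EuclideanSpace.single i 1) (𝕜 := ℝ)
      (by simp) (by
        simp only [one_mul]
        exact memLp_one_iff_integrable.1 ((hψ.pd i).memLp 1))
      (by simpa using memLp_one_iff_integrable.1 (hψ.memLp 1)) (by simp)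
      (fun x _ => hψ.smooth.diff_infty x)
    simpa [pd] using this
  simp only [lap]
  rw [integral_finsetSum _ fun i _ => memLp_one_iff_integrable.1 (((hφ.pd i).pd i).memLp 1)]
  exact Finset.sum_eq_zero fun i _ => key _ (hφ.pd i) i

/-- The energy identity for `u - c`. The flux term `c ∫ u Δφ` appears because `u - c` does not
vanish on the holes. -/
lemma IsEnergySolution.integral_energy_sub (h : IsEnergySolution U u G) {φ : E d → ℝ}
    (hφ : IsTestFunction U φ) (c : ℝ) :
    ∫ x, ‖G x‖ ^ 2 * φ x = 1 / 2 * (∫ x, (u x - c) ^ 2 * lap φ x) + c * ∫ x, u x * lap φ x := by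
  have h0 := h.integral_sq_mul_lap_eq φ hφ
  have i1 : Integrable fun x => u x ^ 2 * lap φ x := hφ.lap.integrable_mul h.memLp.integrable_sq
  have i2 : Integrable fun x => u x * lap φ x := hφ.lap.integrable_mul_of_memLp h.memLp
  have i3 : Integrable fun x => lap φ x := memLp_one_iff_integrable.1 (hφ.lap.memLp 1)
  have e : ∀ x, (u x - c) ^ 2 * lap φ x
      = u x ^ 2 * lap φ x - 2 * c * (u x * lap φ x) + c ^ 2 * lap φ x := fun x => by ring
  simp only [e]
  rw [integral_add (by exact i1.sub (i2.const_mul (2 * c))) (i3.const_mul _),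
    integral_sub i1 (i2.const_mul _), integral_const_mul, integral_const_mul,
    integral_lap_eq_zero hφ, h0]
  ring

/-- A cutoff function, equal to `1` on `B(0, r)` and vanishing off `B(0, 2r)`. -/
noncomputable def cutoff (r : ℝ) (y : E d) : ℝ := profile (‖(2 * r)⁻¹ • (y - 0)‖ ^ 2)

lemma contDiff_cutoff (r : ℝ) : ContDiff ℝ ∞ (cutoff r : E d → ℝ) :=
  (contDiff_radial contDiff_profile).comp (by fun_prop)

lemma cutoff_nonneg (r : ℝ) (y : E d) : 0 ≤ cutoff r y := profile_nonneg _

lemma cutoff_le_one (r : ℝ) (y : E d) : cutoff r y ≤ 1 := Real.smoothTransition.le_one _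

lemma cutoff_eq_zero {r : ℝ} (hr : 0 < r) {y : E d} (hy : 2 * r ≤ ‖y‖) : cutoff r y = 0 := by
  have : 1 ≤ ‖(2 * r)⁻¹ • (y - 0)‖ := one_le_norm_inv_smul (by positivity) (by simpa using hy)
  exact profile_eq_zero (by nlinarith)

lemma cutoff_eq_one {r : ℝ} (hr : 0 < r) {y : E d} (hy : ‖y‖ ≤ r) : cutoff r y = 1 := by
  apply profile_eq_one
  rw [sub_zero, norm_smul, norm_inv, Real.norm_of_nonneg (by positivity)]
  have h1 : (2 * r)⁻¹ * ‖y‖ ≤ (2 * r)⁻¹ * r := by gcongr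
  have h2 : (2 * r)⁻¹ * r = 1 / 2 := by field_simp
  have h3 : 0 ≤ (2 * r)⁻¹ * ‖y‖ := by positivity
  nlinarith

lemma isTestFunction_cutoff {r : ℝ} (hr : 0 < r) (hU : Metric.closedBall (0 : E d) (2 * r) ⊆ U) :
    IsTestFunction U (cutoff r) :=
  isTestFunction_of_eq_zero (x := 0) (contDiff_cutoff r)
    (fun y hy => cutoff_eq_zero hr (by simpa using hy)) hU

lemma exists_bound_cutoff (d : ℕ) : ∃ C : ℝ, 1 ≤ C ∧ ∀ r : ℝ, 0 < r → ∀ y : E d,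
    (∀ i, |pd (cutoff r) i y| ≤ C * r⁻¹) ∧ |lap (cutoff r) y| ≤ C * (r⁻¹) ^ 2 := by
  set f : E d → ℝ := fun y => profile (‖y‖ ^ 2) with hf
  have hfc : ContDiff ℝ ∞ f := contDiff_radial contDiff_profile
  have ht : IsTestFunction Set.univ f :=
    isTestFunction_of_eq_zero (x := 0) (s := 1) hfc
      (fun y hy => profile_eq_zero (by rw [sub_zero] at hy; nlinarith)) (Set.subset_univ _)
  choose C1 hC1 using fun i => (ht.pd i).exists_bound
  obtain ⟨C2, hC2⟩ := ht.lap.exists_bound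
  have n1 : 0 ≤ ∑ i, |C1 i| := Finset.sum_nonneg fun _ _ => abs_nonneg _
  refine ⟨1 + ∑ i, |C1 i| + |C2|, by linarith [abs_nonneg C2], fun r hr y => ⟨fun i => ?_, ?_⟩⟩
  · have e : pd (cutoff r) i y = (2 * r)⁻¹ * pd f i ((2 * r)⁻¹ • (y - 0)) :=
      congrFun (pd_comp_affine f (2 * r)⁻¹ 0 i) y
    have h1 := hC1 i ((2 * r)⁻¹ • (y - 0))
    rw [Real.norm_eq_abs] at h1
    have h2 := Finset.single_le_sum (fun i _ => abs_nonneg (C1 i)) (Finset.mem_univ i)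
    have h3 : |pd f i ((2 * r)⁻¹ • (y - 0))| ≤ 1 + ∑ i, |C1 i| + |C2| := by
      linarith [le_abs_self (C1 i), abs_nonneg C2]
    rw [e, abs_mul, abs_of_pos (by positivity), mul_comm]
    gcongr
    linarith
  · have e : lap (cutoff r) y = (2 * r)⁻¹ ^ 2 * lap f ((2 * r)⁻¹ • (y - 0)) :=
      congrFun (lap_comp_affine hfc (2 * r)⁻¹ 0) y
    have h1 := hC2 ((2 * r)⁻¹ • (y - 0))
    rw [Real.norm_eq_abs] at h1
    have h3 : |lap f ((2 * r)⁻¹ • (y - 0))| ≤ 1 + ∑ i, |C1 i| + |C2| := by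
      linarith [le_abs_self C2]
    rw [e, abs_mul, abs_of_pos (by positivity), mul_comm]
    gcongr
    linarith

/-- The Caccioppoli inequality for `u - c`. -/
lemma IsEnergySolution.caccioppoli (h : IsEnergySolution U u G) {C r : ℝ} (hr : 0 < r)
    (hC : ∀ y : E d, |lap (cutoff r) y| ≤ C * (r⁻¹) ^ 2)
    (hU : Metric.closedBall (0 : E d) (2 * r) ⊆ U) (c : ℝ) :
    ∫ y in Metric.ball (0 : E d) r, ‖G y‖ ^ 2 ≤
      C * (r⁻¹) ^ 2 * (∫ y in Metric.ball (0 : E d) (3 * r), (u y - c) ^ 2)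
        + |c| * |∫ y, u y * lap (cutoff r) y| := by
  have ht := isTestFunction_cutoff hr hU
  have hG := h.integrable_norm_sq
  have h1 : ∫ y in Metric.ball (0 : E d) r, ‖G y‖ ^ 2 ≤ ∫ y, ‖G y‖ ^ 2 * cutoff r y := by
    rw [← integral_indicator Metric.isOpen_ball.measurableSet]
    refine integral_mono (hG.indicator Metric.isOpen_ball.measurableSet) (ht.integrable_mul hG)
      fun y => ?_
    by_cases hy : y ∈ Metric.ball (0 : E d) r
    · rw [Set.indicator_of_mem hy, cutoff_eq_one hr (by rw [mem_ball_zero_iff] at hy; exact hy.le),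
        mul_one]
    · rw [Set.indicator_of_notMem hy]
      exact mul_nonneg (sq_nonneg _) (cutoff_nonneg _ _)
  rw [h.integral_energy_sub ht c] at h1
  have h2 : c * ∫ x, u x * lap (cutoff r) x ≤ |c| * |∫ y, u y * lap (cutoff r) y| := by
    rw [← abs_mul]; exact le_abs_self _
  have hi : IntegrableOn (fun y => (u y - c) ^ 2) (Metric.ball (0 : E d) (3 * r)) := by
    have : IsFiniteMeasure (volume.restrict (Metric.ball (0 : E d) (3 * r))) :=
      ⟨by simpa using measure_ball_lt_top⟩
    have : MemLp (fun y => u y - c) 2 (volume.restrict (Metric.ball (0 : E d) (3 * r))) :=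
      (h.memLp.restrict _).sub (memLp_const c)
    exact this.integrable_sq
  have h3 : ∫ x, (u x - c) ^ 2 * lap (cutoff r) x
      ≤ ∫ y in Metric.ball (0 : E d) (3 * r), C * (r⁻¹) ^ 2 * (u y - c) ^ 2 := by
    rw [← setIntegral_eq_integral_of_forall_compl_eq_zero (s := Metric.ball (0 : E d) (3 * r))]
    · obtain ⟨B, hB⟩ := ht.lap.exists_bound
      refine setIntegral_mono (hi.mul_bdd (c := B) ht.lap.continuous.aestronglyMeasurable
        (Filter.Eventually.of_forall hB)) (hi.const_mul _) fun y => ?_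
      simp only
      rw [mul_comm]
      exact mul_le_mul_of_nonneg_right ((le_abs_self _).trans (hC y)) (sq_nonneg _)
    · intro y hy
      have : lap (cutoff r) y = 0 := (isTestFunction_cutoff hr le_rfl).lap.eq_zero (fun h' => hy
        (Metric.closedBall_subset_ball (by linarith) h'))
      rw [this, mul_zero]
  rw [integral_const_mul] at h3
  have h4 : 0 ≤ C * (r⁻¹) ^ 2 * ∫ y in Metric.ball (0 : E d) (3 * r), (u y - c) ^ 2 :=
    mul_nonneg ((abs_nonneg _).trans (hC 0)) (integral_nonneg fun _ => sq_nonneg _)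
  linarith

end

section

variable {d : ℕ} {u : E d → ℝ} {G : E d → E d}

/-! ### From the two capacity bounds to the large-scale estimate -/

/-- The Poincaré inequality with constant `C / κ` on balls of radius `r` in `B(0, R)`, up to a
fixed enlargement of the ball. -/
def PoincareBound (C κ R : ℝ) (u : E d → ℝ) (G : E d → E d) : Prop :=
  ∀ r, 0 < r → r + C ≤ R → ∫ y in Metric.ball (0 : E d) r, u y ^ 2
    ≤ C * κ⁻¹ * ∫ y in Metric.ball (0 : E d) (r + C), ‖G y‖ ^ 2

/-- At scales `s ≥ 1` the distribution `Δu` acts as a density bounded by `C κ sup |u|`. -/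
def FluxBound (C κ R : ℝ) (u : E d → ℝ) : Prop :=
  ∀ (x : E d) (s b M : ℝ) (φ : E d → ℝ), 1 ≤ s → Metric.closedBall x s ⊆ Metric.ball 0 R →
    ContDiff ℝ ∞ φ → (∀ y, s ≤ ‖y - x‖ → φ y = 0) → (∀ y, |φ y| ≤ b) →
    (∀ y i, |pd φ i y| ≤ b) → (∀ y, |lap φ y| ≤ b) → 0 ≤ M →
    (∀ᵐ y, y ∈ Metric.closedBall x s → |u y| ≤ M) →
    |∫ y, u y * lap φ y| ≤ C * b * s ^ d * κ * M

/-- Beyond the scale `κ^(-1/2)` the Caccioppoli and Poincaré inequalities make the scaled energy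
contract. -/
lemma scaledEnergy_contraction (d : ℕ) (C : ℝ) (hC : 1 ≤ C) : ∃ K : ℝ, 1 ≤ K ∧
    ∀ (κ R : ℝ) (u : E d → ℝ) (G : E d → E d), 0 < κ → κ ≤ 1 →
    IsEnergySolution (Metric.ball 0 R) u G → PoincareBound C κ R u G →
    ∀ r, 0 < r → K ^ 2 ≤ r ^ 2 * κ → r ≤ R → scaledEnergy G r ≤ 4 ^ d * scaledEnergy G R := by
  obtain ⟨C₁, hC₁, hcut⟩ := exists_bound_cutoff d
  refine ⟨C + 2 * (C₁ * C * 4 ^ d), by nlinarith [show (0 : ℝ) < C₁ * C * 4 ^ d by positivity],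
    fun κ R u G hκ hκ1 h hP r hr hrκ hrR => ?_⟩
  have hp : 1 ≤ C₁ * C * 4 ^ d := by
    have h1 : (1 : ℝ) ≤ 4 ^ d := one_le_pow₀ (by norm_num)
    have h2 : 1 ≤ C₁ * C := by nlinarith
    nlinarith
  set K := C + 2 * (C₁ * C * 4 ^ d) with hK
  have hR : 0 < R := hr.trans_le hrR
  have hstep : ∀ t, r ≤ t → 4 * t ≤ R →
      scaledEnergy G t ≤ 1 / 2 * scaledEnergy G (4 * t) + 0 := by
    intro t hrt htR
    have ht : 0 < t := hr.trans_le hrt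
    have h1 : K ^ 2 ≤ t ^ 2 * κ := hrκ.trans (by gcongr)
    have h2 : C ≤ t := by
      have h3 : K ^ 2 ≤ t ^ 2 := h1.trans (by nlinarith [sq_nonneg t])
      have h4 : K ≤ t := by
        exact (abs_le_of_sq_le_sq' h3 ht.le).2
      linarith
    have hU : Metric.closedBall (0 : E d) (2 * t) ⊆ Metric.ball 0 R :=
      Metric.closedBall_subset_ball (by linarith)
    have h5 := h.caccioppoli ht (fun y => (hcut t ht y).2) hU 0
    have h6 := hP (3 * t) (by linarith) (by linarith)
    have h7 : ∫ y in Metric.ball (0 : E d) (3 * t + C), ‖G y‖ ^ 2 ≤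
        ∫ y in Metric.ball (0 : E d) (4 * t), ‖G y‖ ^ 2 :=
      setIntegral_mono_of_subset h.integrable_norm_sq (fun _ => sq_nonneg _)
        (Metric.ball_subset_ball (by linarith))
    simp only [sub_zero, abs_zero, zero_mul, add_zero] at h5
    rw [← pow_mul_scaledEnergy G ht] at h5
    rw [← pow_mul_scaledEnergy G (by linarith : 0 < 4 * t)] at h7
    have ha := scaledEnergy_nonneg G (by linarith : 0 < 4 * t)
    have h8 : t ^ d * scaledEnergy G t ≤
        C₁ * (t⁻¹) ^ 2 * (C * κ⁻¹ * ((4 * t) ^ d * scaledEnergy G (4 * t))) := by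
      refine h5.trans ?_
      gcongr
      refine h6.trans ?_
      gcongr
    have h9 : C₁ * (t⁻¹) ^ 2 * (C * κ⁻¹ * ((4 * t) ^ d * scaledEnergy G (4 * t)))
        = t ^ d * ((C₁ * C * 4 ^ d) / (t ^ 2 * κ) * scaledEnergy G (4 * t)) := by
      rw [mul_pow]; field_simp
    rw [h9] at h8
    have h10 := le_of_mul_le_mul_left h8 (by positivity)
    have h11 : (C₁ * C * 4 ^ d) / (t ^ 2 * κ) ≤ 1 / 2 := by
      rw [div_le_iff₀ (by positivity)]
      have : 2 * (C₁ * C * 4 ^ d) ≤ K ^ 2 := by nlinarith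
      linarith
    calc scaledEnergy G t ≤ _ := h10
      _ ≤ 1 / 2 * scaledEnergy G (4 * t) := by gcongr
      _ = _ := by ring
  have := le_of_contraction (A := 4 ^ d * scaledEnergy G R) (L := R) hr
    (mul_nonneg (by positivity) (scaledEnergy_nonneg G hR)) le_rfl hstep
    (fun t hrt htR hlt => scaledEnergy_le h.integrable_norm_sq (hr.trans_le hrt) htR hlt.le)
    r le_rfl hrR
  simpa using this

/-- A sup bound for `u`, from subharmonicity of `u²` and the Poincaré inequality. -/
lemma exists_sup_bound (d : ℕ) (C : ℝ) (hC : 1 ≤ C) : ∃ A : ℝ, 0 ≤ A ∧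
    ∀ (κ R S : ℝ) (K : ℝ) (u : E d → ℝ) (G : E d → E d), 0 < κ → 1 ≤ S → 5 + C ≤ K → K * S ≤ R →
    IsEnergySolution (Metric.ball 0 R) u G → PoincareBound C κ R u G →
    ∀ᵐ y, y ∈ Metric.ball (0 : E d) (4 * S) →
      u y ^ 2 ≤ A * K ^ d * κ⁻¹ * scaledEnergy G (K * S) := by
  obtain ⟨C₂, hC₂, havg⟩ := exists_avg_le d
  refine ⟨C₂ * C, by positivity, fun κ R S K u G hκ hS hK hKR h hP => ?_⟩
  filter_upwards [h.ae_sq_le_avg] with y hy hy4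
  have hKS : 5 * S + C ≤ K * S := by nlinarith
  have hS0 : 0 < S := by linarith
  have hK0 : 0 < K := by linarith
  have hyS : Metric.closedBall y S ⊆ Metric.ball (0 : E d) (5 * S) := fun z hz => by
    rw [mem_ball_zero_iff] at hy4 ⊢
    rw [mem_closedBall_iff_norm] at hz
    have := norm_le_norm_add_norm_sub' z y
    linarith
  have h1 := hy S hS0 (hyS.trans (Metric.ball_subset_ball (by linarith)))
  have h2 := havg (fun y => u y ^ 2) h.memLp.integrable_sq (fun _ => sq_nonneg _) S hS0 y
  have h3 : ∫ z in Metric.closedBall y S, u z ^ 2 ≤ ∫ z in Metric.ball (0 : E d) (5 * S), u z ^ 2 :=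
    setIntegral_mono_of_subset h.memLp.integrable_sq (fun _ => sq_nonneg _) hyS
  have h4 := hP (5 * S) (by linarith) (hKS.trans hKR)
  have h5 : ∫ z in Metric.ball (0 : E d) (5 * S + C), ‖G z‖ ^ 2 ≤
      ∫ z in Metric.ball (0 : E d) (K * S), ‖G z‖ ^ 2 :=
    setIntegral_mono_of_subset h.integrable_norm_sq (fun _ => sq_nonneg _) (Metric.ball_subset_ball hKS)
  rw [← pow_mul_scaledEnergy G (by positivity : 0 < K * S)] at h5
  calc u y ^ 2 ≤ _ := h1.trans h2
    _ ≤ C₂ * (S ^ d)⁻¹ * (C * κ⁻¹ * ((K * S) ^ d * scaledEnergy G (K * S))) := by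
      gcongr
      refine h3.trans (h4.trans ?_)
      gcongr
    _ = _ := by rw [mul_pow]; field_simp

/-- The averages of `∇u` at unit scale are bounded by the energy at the scale `S ≤ κ^(-1/2)`:
the effective equation `Δu ≈ κ u` changes the averages between these scales by at most
`S κ sup |u|`. -/
lemma exists_avg_grad_bound (d : ℕ) (C : ℝ) (hC : 1 ≤ C) : ∃ A : ℝ, 0 ≤ A ∧
    ∀ (κ R S K M : ℝ) (u : E d → ℝ) (G : E d → E d), 0 < κ → 1 ≤ S → 5 ≤ K →
    K * S ≤ R → 0 ≤ M → IsEnergySolution (Metric.ball 0 R) u G → FluxBound C κ R u →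
    (∀ᵐ y, y ∈ Metric.ball (0 : E d) (4 * S) → |u y| ≤ M) →
    ∀ (i : Fin d), ∀ x ∈ Metric.closedBall (0 : E d) (2 * S), |avg (fun y => G y i) 1 x| ≤
      Real.sqrt (A * K ^ d * scaledEnergy G (K * S)) + A * κ * M * S := by
  obtain ⟨C₂, hC₂, havg⟩ := exists_avg_le d
  obtain ⟨C₃, hC₃, hz⟩ := exists_bound_zeta d
  refine ⟨max C₂ (C * C₃), le_trans (by linarith) (le_max_left _ _),
    fun κ R S K M u G hκ hS hK hKR hM h hF hMu i x hx => ?_⟩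
  set A := max C₂ (C * C₃) with hA
  have hS0 : 0 < S := by linarith
  have hball : ∀ s, s ≤ S → Metric.closedBall x s ⊆ Metric.ball (0 : E d) (4 * S) := fun s hs z hz => by
    rw [mem_ball_zero_iff]
    rw [mem_closedBall_zero_iff] at hx
    rw [mem_closedBall_iff_norm] at hz
    have := norm_le_norm_add_norm_sub' z x
    linarith
  have h4R : 4 * S ≤ R := by nlinarith
  have hballR : ∀ s, s ≤ S → Metric.closedBall x s ⊆ Metric.ball (0 : E d) R := fun s hs =>
    (hball s hs).trans (Metric.ball_subset_ball h4R)
  have hSK : 4 * S ≤ K * S := by nlinarith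
  -- the average at scale `S`
  have h1 : |avg (fun y => G y i) S x| ≤ Real.sqrt (A * K ^ d * scaledEnergy G (K * S)) := by
    apply Real.abs_le_sqrt
    have hGi := h.memLp_coord i
    have h2 := sq_avg_le hGi hS0 x
    have h3 := havg (fun y => G y i ^ 2) hGi.integrable_sq (fun _ => sq_nonneg _) S hS0 x
    have h4 : ∫ y in Metric.closedBall x S, G y i ^ 2 ≤
        ∫ y in Metric.ball (0 : E d) (K * S), ‖G y‖ ^ 2 := by
      refine (setIntegral_mono_of_subset hGi.integrable_sq (fun _ => sq_nonneg _)
        ((hball S le_rfl).trans (Metric.ball_subset_ball hSK))).trans ?_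
      refine setIntegral_mono hGi.integrable_sq.integrableOn
        h.integrable_norm_sq.integrableOn fun y => ?_
      rw [← sq_abs]
      have := PiLp.norm_apply_le (G y) i
      rw [Real.norm_eq_abs] at this
      simp only
      gcongr
    rw [← pow_mul_scaledEnergy G (by positivity)] at h4
    calc _ ≤ _ := h2.trans h3
      _ ≤ C₂ * (S ^ d)⁻¹ * ((K * S) ^ d * scaledEnergy G (K * S)) := by gcongr
      _ = C₂ * K ^ d * scaledEnergy G (K * S) := by rw [mul_pow]; field_simp
      _ ≤ _ := by
        have := scaledEnergy_nonneg G (by positivity : 0 < K * S)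
        gcongr
        exact le_max_left _ _
  -- the change of the average between the scales `1` and `S`
  have h5 : ∀ s ∈ Set.Icc 1 S, |∫ y, u y * lap (pd (fun y => zeta s (y - x)) i) y|
      ≤ A * κ * M := by
    intro s hs
    have hs0 : 0 < s := by linarith [hs.1]
    have hs1 : s⁻¹ ≤ 1 := inv_le_one_of_one_le₀ hs.1
    have hC₃0 : 0 ≤ C₃ * (s ^ d)⁻¹ := by positivity
    have e1 : pd (fun y => zeta s (y - x)) i = fun y => pd (zeta s) i (y - x) :=
      pd_comp_sub (zeta s) x i
    have hc := contDiff_pd (contDiff_zeta (d := d) s) i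
    have := hF x s (C₃ * (s ^ d)⁻¹) M (pd (fun y => zeta s (y - x)) i) hs.1 (hballR s hs.2)
      (contDiff_pd ((contDiff_zeta s).comp (by fun_prop)) i) (by
        intro y hy
        rw [e1]
        simp only [pd_zeta hs0, rho_eq_zero hs0 hy, mul_zero]) (by
        intro y
        rw [e1]
        exact (hz s hs0 (y - x) i i).1) (by
        intro y j
        rw [e1, pd_comp_sub]
        refine (hz s hs0 (y - x) i j).2.1.trans ?_
        exact mul_le_of_le_one_right hC₃0 hs1) (by
        intro y
        rw [e1, lap_comp_sub hc]
        refine (hz s hs0 (y - x) i i).2.2.2.trans ?_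
        exact mul_le_of_le_one_right hC₃0 (pow_le_one₀ (by positivity) hs1)) hM (by
        filter_upwards [hMu] with y hy hys using hy (hball s hs.2 hys))
    refine this.trans ?_
    have e2 : C * (C₃ * (s ^ d)⁻¹) * s ^ d * κ * M = C * C₃ * κ * M := by field_simp
    rw [e2]
    gcongr
    exact le_max_right _ _
  have h6 : |avg (fun y => G y i) S x - avg (fun y => G y i) 1 x| ≤ A * κ * M * (S - 1) := by
    have := Convex.norm_image_sub_le_of_norm_hasDerivWithin_le (𝕜 := ℝ)
      (f := fun s => avg (fun y => G y i) s x) (s := Set.Icc 1 S) (C := A * κ * M)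
      (fun s hs => (h.hasDerivAt_avg_grad (by linarith [hs.1]) (hballR s hs.2) i).hasDerivWithinAt)
      (fun s hs => by rw [norm_neg]; exact h5 s hs) (convex_Icc 1 S)
      (Set.left_mem_Icc.2 hS) (Set.right_mem_Icc.2 hS)
    rwa [Real.norm_eq_abs, Real.norm_of_nonneg (by linarith)] at this
  have hA0 : 0 ≤ A := le_trans (by linarith) (le_max_left C₂ _)
  have h7 : 0 ≤ A * κ * M := by positivity
  have h8 := abs_sub_abs_le_abs_sub (avg (fun y => G y i) 1 x) (avg (fun y => G y i) S x)
  rw [abs_sub_comm] at h8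
  nlinarith

end

section

variable {d : ℕ} {u : E d → ℝ} {G : E d → E d}

/-- A function with bounded partial derivatives on a ball is Lipschitz there. -/
lemma abs_sub_le_of_pd_le {f : E d → ℝ} (hf : Differentiable ℝ f) {r g : ℝ}
    (hg : 0 ≤ g) (hpd : ∀ i, ∀ x ∈ Metric.closedBall (0 : E d) r, |pd f i x| ≤ g) {x : E d}
    (hx : x ∈ Metric.closedBall (0 : E d) r) : |f x - f 0| ≤ d * g * ‖x‖ := by
  have h0 : (0 : E d) ∈ Metric.closedBall (0 : E d) r := by
    rw [mem_closedBall_zero_iff] at hx ⊢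
    simpa using (norm_nonneg x).trans hx
  have := (convex_closedBall (0 : E d) r).norm_image_sub_le_of_norm_fderiv_le (𝕜 := ℝ) (C := d * g)
    (fun y _ => hf y) (fun y hy => by
      refine ContinuousLinearMap.opNorm_le_bound _ (by positivity) fun v => ?_
      rw [fderiv_eq_sum_pd]
      refine (norm_sum_le _ _).trans ?_
      calc ∑ i, ‖v i * pd f i y‖ ≤ ∑ _i : Fin d, ‖v‖ * g := by
            refine Finset.sum_le_sum fun i _ => ?_
            rw [norm_mul]
            gcongr
            · exact PiLp.norm_apply_le v i
            · exact hpd i y hy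
        _ = d * g * ‖v‖ := by simp; ring) h0 hx
  simpa using this

set_option maxHeartbeats 800000 in
/-- Below the scale `κ^(-1/2)`, the scaled energy is controlled by its value at that scale. -/
lemma scaledEnergy_le_of_small_scale (d : ℕ) (C K : ℝ) (hC : 1 ≤ C) (hK : 5 + C ≤ K) :
    ∃ A : ℝ, 1 ≤ A ∧ ∀ (κ R S : ℝ) (u : E d → ℝ) (G : E d → E d), 0 < κ → 1 ≤ S → S ^ 2 * κ ≤ 1 →
    K * S ≤ R → IsEnergySolution (Metric.ball 0 R) u G → PoincareBound C κ R u G →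
    FluxBound C κ R u → ∀ r, 1 ≤ r → r ≤ K * S →
    scaledEnergy G r ≤ A * scaledEnergy G (K * S) := by
  obtain ⟨C₁, hC₁, hcut⟩ := exists_bound_cutoff d
  obtain ⟨A₁, hA₁, hsup⟩ := exists_sup_bound d C hC
  obtain ⟨A₂, hA₂, hgrad⟩ := exists_avg_grad_bound d C hC
  have hK0 : 0 < K := by linarith
  -- `Γ` bounds the squared Lipschitz constant of the averages, `B` the source in the contraction.
  set Γ : ℝ := 2 * A₂ * K ^ d + 2 * A₂ ^ 2 * (A₁ * K ^ d) with hΓ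
  have hΓ0 : 0 ≤ Γ := by positivity
  set V : ℝ := volume.real (Metric.ball (0 : E d) 1) with hV
  have hV0 : 0 ≤ V := measureReal_nonneg
  clear_value V
  set B : ℝ := 18 * C₁ * d ^ 2 * Γ * V * 3 ^ d + C * C₁ * 2 ^ d * (A₁ * K ^ d) with hB
  have hB0 : 0 ≤ B := by positivity
  clear_value Γ B
  set r₁ : ℝ := 4 * C₁ * 4 ^ d with hr₁
  have h4d : (1 : ℝ) ≤ 4 ^ d := one_le_pow₀ (by norm_num)
  have hr₁1 : 1 ≤ r₁ := by nlinarith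
  clear_value r₁
  set A₃ : ℝ := (2 * K) ^ d + 2 * B with hA₃
  have hA₃1 : 1 ≤ A₃ := by
    have : (1 : ℝ) ≤ (2 * K) ^ d := one_le_pow₀ (by linarith)
    linarith
  refine ⟨(K * r₁) ^ d * A₃, ?_, fun κ R S u G hκ hS hSκ hKR h hP hF r hr hrK => ?_⟩
  · have : (1 : ℝ) ≤ (K * r₁) ^ d := one_le_pow₀ (by nlinarith)
    nlinarith
  set N := scaledEnergy G (K * S) with hN
  have hS0 : 0 < S := by linarith
  have hN0 : 0 ≤ N := scaledEnergy_nonneg G (by positivity)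
  have h5K : 5 * S ≤ K * S := by gcongr; linarith
  set M := Real.sqrt (A₁ * K ^ d * κ⁻¹ * N) with hM
  have hM0 : 0 ≤ M := Real.sqrt_nonneg _
  have hM2 : M ^ 2 = A₁ * K ^ d * κ⁻¹ * N := Real.sq_sqrt (by positivity)
  have hMu : ∀ᵐ y, y ∈ Metric.ball (0 : E d) (4 * S) → |u y| ≤ M := by
    filter_upwards [hsup κ R S K u G hκ hS hK hKR h hP] with y hy hy4 using Real.abs_le_sqrt (hy hy4)
  have hg := hgrad κ R S K M u G hκ hS (by linarith) hKR hM0 h hF hMu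
  set g := Real.sqrt (A₂ * K ^ d * N) + A₂ * κ * M * S with hgdef
  have hg0 : 0 ≤ g := by positivity
  clear_value g M N
  have hg2 : g ^ 2 ≤ Γ * N := by
    have h1 : g ^ 2 ≤ 2 * Real.sqrt (A₂ * K ^ d * N) ^ 2 + 2 * (A₂ * κ * M * S) ^ 2 := by
      rw [hgdef]
      linarith [sq_nonneg (Real.sqrt (A₂ * K ^ d * N) - A₂ * κ * M * S),
        sub_sq (Real.sqrt (A₂ * K ^ d * N)) (A₂ * κ * M * S),
        add_sq (Real.sqrt (A₂ * K ^ d * N)) (A₂ * κ * M * S)]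
    rw [Real.sq_sqrt (by positivity)] at h1
    have h2 : (A₂ * κ * M * S) ^ 2 = A₂ ^ 2 * (A₁ * K ^ d) * N * (S ^ 2 * κ) := by
      calc (A₂ * κ * M * S) ^ 2 = A₂ ^ 2 * κ ^ 2 * S ^ 2 * M ^ 2 := by ring
        _ = _ := by rw [hM2]; field_simp
    have h3 : A₂ ^ 2 * (A₁ * K ^ d) * N * (S ^ 2 * κ) ≤ A₂ ^ 2 * (A₁ * K ^ d) * N :=
      mul_le_of_le_one_right (by positivity) hSκ
    rw [hΓ]
    linarith
  have hUS : ∀ x ∈ Metric.closedBall (0 : E d) (2 * S),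
      Metric.closedBall x 1 ⊆ Metric.ball (0 : E d) R := fun x hx z hz => by
    rw [mem_ball_zero_iff]
    rw [mem_closedBall_zero_iff] at hx
    rw [mem_closedBall_iff_norm] at hz
    have := norm_le_norm_add_norm_sub' z x
    linarith
  have hlip : ∀ x ∈ Metric.closedBall (0 : E d) (2 * S),
      |avg u 1 x - avg u 1 0| ≤ d * g * ‖x‖ := fun x hx =>
    abs_sub_le_of_pd_le (h.avg_contDiff one_pos).diff_infty hg0
      (fun i y hy => by rw [h.pd_avg one_pos (hUS y hy) i]; exact hg i y hy) hx
  set c := avg u 1 0 with hc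
  have hcM : |c| ≤ M := by
    apply abs_le_of_sq_le_sq _ hM0
    refine (sq_avg_le h.memLp one_pos 0).trans ?_
    have hi : Integrable fun y : E d => rho 1 (y - 0) :=
      memLp_one_iff_integrable.1 ((isTestFunction_rho one_pos (0 : E d) (Set.subset_univ _)).memLp 1)
    calc avg (fun y => u y ^ 2) 1 0 ≤ ∫ y : E d, M ^ 2 * rho 1 (y - 0) := by
          refine integral_mono_ae
            (integrable_mul_rho h.memLp.integrable_sq.locallyIntegrable one_pos 0) (hi.const_mul _) ?_
          filter_upwards [hMu] with y hy
          rcases lt_or_ge ‖y - 0‖ 1 with hy1 | hy1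
          · have h1 := hy (by rw [mem_ball_zero_iff]; rw [sub_zero] at hy1; linarith)
            have h2 : u y ^ 2 ≤ M ^ 2 := by rw [← sq_abs]; gcongr
            exact mul_le_mul_of_nonneg_right h2 (rho_nonneg one_pos _)
          · rw [rho_eq_zero one_pos hy1]; simp
      _ = M ^ 2 := by rw [integral_const_mul, integral_rho one_pos, mul_one]
  clear_value c
  -- One step of the Campanato-type iteration.
  have hstep : ∀ t, r₁ ≤ t → 4 * t ≤ 2 * S →
      scaledEnergy G t ≤ 1 / 2 * scaledEnergy G (4 * t) + B * N := by
    intro t ht htS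
    have ht1 : 1 ≤ t := hr₁1.trans ht
    have ht0 : 0 < t := by linarith
    have hUt : Metric.closedBall (0 : E d) (2 * t) ⊆ Metric.ball 0 R :=
      Metric.closedBall_subset_ball (by linarith)
    have h1 := h.caccioppoli ht0 (fun y => (hcut t ht0 y).2) hUt c
    have hti : t⁻¹ ≤ 1 := inv_le_one_of_one_le₀ ht1
    have h2 := hF 0 (2 * t) C₁ M (cutoff t) (by linarith) hUt (contDiff_cutoff t)
      (fun y hy => cutoff_eq_zero ht0 (by simpa using hy))
      (fun y => by rw [abs_of_nonneg (cutoff_nonneg t y)]; exact (cutoff_le_one t y).trans hC₁)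
      (fun y i => ((hcut t ht0 y).1 i).trans (mul_le_of_le_one_right (by linarith) hti))
      (fun y => (hcut t ht0 y).2.trans
        (mul_le_of_le_one_right (by linarith) (pow_le_one₀ (by positivity) hti))) hM0 (by
        filter_upwards [hMu] with y hy hyt
        exact hy (Metric.closedBall_subset_ball (by linarith) hyt))
    -- The flux term costs `κ M²`, which the sup bound turns into the energy at the top scale.
    have h3 : |c| * |∫ y, u y * lap (cutoff t) y| ≤ C * C₁ * 2 ^ d * (A₁ * K ^ d) * N * t ^ d := by
      calc |c| * |∫ y, u y * lap (cutoff t) y| ≤ M * (C * C₁ * (2 * t) ^ d * κ * M) := by gcongr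
        _ = C * C₁ * 2 ^ d * t ^ d * κ * M ^ 2 := by rw [mul_pow]; ring
        _ = _ := by rw [hM2]; field_simp
    have hfin : IsFiniteMeasure (volume.restrict (Metric.ball (0 : E d) (3 * t))) :=
      ⟨by rw [Measure.restrict_apply_univ]; exact measure_ball_lt_top⟩
    have hv : ContDiff ℝ ∞ (avg u 1) := h.avg_contDiff one_pos
    have hv1 : MemLp (avg u 1) 2 (volume.restrict (Metric.ball (0 : E d) (3 * t))) := by
      refine MemLp.of_bound hv.continuous.aestronglyMeasurable (|c| + d * g * (3 * t)) ?_
      refine (ae_restrict_iff' Metric.isOpen_ball.measurableSet).2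
        (Filter.Eventually.of_forall fun y hy => ?_)
      rw [mem_ball_zero_iff] at hy
      have h4 := hlip y (by rw [mem_closedBall_zero_iff]; linarith)
      have h5 : (d : ℝ) * g * ‖y‖ ≤ d * g * (3 * t) := by gcongr
      rw [Real.norm_eq_abs]
      have h6 := abs_sub_abs_le_abs_sub (avg u 1 y) c
      linarith
    have hu1 : MemLp (fun y => u y - avg u 1 y) 2 (volume.restrict (Metric.ball (0 : E d) (3 * t))) :=
      (h.memLp.restrict _).sub hv1
    have h4 : ∫ y in Metric.ball (0 : E d) (3 * t), (u y - c) ^ 2 ≤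
        2 * (∫ y in Metric.ball (0 : E d) (4 * t), ‖G y‖ ^ 2)
          + 18 * d ^ 2 * Γ * V * 3 ^ d * N * t ^ 2 * t ^ d := by
      have h5 : ∫ y in Metric.ball (0 : E d) (3 * t), (u y - c) ^ 2 ≤
          ∫ y in Metric.ball (0 : E d) (3 * t),
            (2 * (u y - avg u 1 y) ^ 2 + 2 * (d * g * (3 * t)) ^ 2) := by
        refine setIntegral_mono_on (((h.memLp.restrict _).sub (memLp_const c)).integrable_sq)
          ((hu1.integrable_sq.const_mul 2).add (integrable_const _))
          Metric.isOpen_ball.measurableSet fun y hy => ?_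
        rw [mem_ball_zero_iff] at hy
        have h6 := hlip y (by rw [mem_closedBall_zero_iff]; linarith)
        have h7 : |avg u 1 y - c| ≤ d * g * (3 * t) := h6.trans (by gcongr)
        have h8 : (avg u 1 y - c) ^ 2 ≤ (d * g * (3 * t)) ^ 2 := by rw [← sq_abs]; gcongr
        have h9 : u y - c = (u y - avg u 1 y) + (avg u 1 y - c) := by ring
        have h10 := add_sq_le (a := u y - avg u 1 y) (b := avg u 1 y - c)
        rw [h9]
        linarith
      rw [integral_add (hu1.integrable_sq.const_mul 2) (integrable_const _), integral_const_mul,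
        setIntegral_const, smul_eq_mul] at h5
      have h6 := h.integral_sq_sub_avg_le (r := 3 * t) (Metric.ball_subset_ball (by linarith))
      have h7 : ∫ y in Metric.ball (0 : E d) (3 * t + 1), ‖G y‖ ^ 2 ≤
          ∫ y in Metric.ball (0 : E d) (4 * t), ‖G y‖ ^ 2 :=
        setIntegral_mono_of_subset h.integrable_norm_sq (fun _ => sq_nonneg _)
          (Metric.ball_subset_ball (by linarith))
      have h8 : volume.real (Metric.ball (0 : E d) (3 * t)) = (3 * t) ^ d * V := by
        rw [hV, measureReal_def, Measure.addHaar_ball_of_pos _ _ (by positivity : (0 : ℝ) < 3 * t),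
          finrank_euclideanSpace, Fintype.card_fin, ENNReal.toReal_mul,
          ENNReal.toReal_ofReal (by positivity), measureReal_def]
      rw [h8] at h5
      have h9 : (3 * t) ^ d * V * (2 * (d * g * (3 * t)) ^ 2)
          = 18 * d ^ 2 * V * 3 ^ d * t ^ 2 * t ^ d * g ^ 2 := by rw [mul_pow 3 t d]; ring
      have h10 : 18 * d ^ 2 * V * 3 ^ d * t ^ 2 * t ^ d * g ^ 2
          ≤ 18 * d ^ 2 * V * 3 ^ d * t ^ 2 * t ^ d * (Γ * N) := by gcongr
      rw [h9] at h5
      calc _ ≤ _ := h5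
        _ ≤ 2 * (∫ y in Metric.ball (0 : E d) (4 * t), ‖G y‖ ^ 2)
          + 18 * d ^ 2 * V * 3 ^ d * t ^ 2 * t ^ d * (Γ * N) := by linarith
        _ = _ := by ring
    rw [← pow_mul_scaledEnergy G (by linarith : 0 < 4 * t)] at h4
    rw [← pow_mul_scaledEnergy G ht0] at h1
    have ha := scaledEnergy_nonneg G (by linarith : 0 < 4 * t)
    have h11 : t ^ d * scaledEnergy G t ≤
        t ^ d * (2 * C₁ * 4 ^ d * (t⁻¹) ^ 2 * scaledEnergy G (4 * t) + B * N) := by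
      calc t ^ d * scaledEnergy G t ≤ _ := h1
        _ ≤ C₁ * (t⁻¹) ^ 2 * (2 * ((4 * t) ^ d * scaledEnergy G (4 * t))
          + 18 * d ^ 2 * Γ * V * 3 ^ d * N * t ^ 2 * t ^ d)
          + C * C₁ * 2 ^ d * (A₁ * K ^ d) * N * t ^ d := by gcongr
        _ = _ := by rw [hB, mul_pow 4 t d]; field_simp; ring
    have h12 := le_of_mul_le_mul_left h11 (by positivity)
    have h13 : 2 * C₁ * 4 ^ d * (t⁻¹) ^ 2 ≤ 1 / 2 := by
      rw [inv_pow, ← div_eq_mul_inv, div_le_iff₀ (by positivity)]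
      have h14 : t * 1 ≤ t * t := by gcongr
      rw [hr₁] at ht
      linarith [pow_two t]
    calc _ ≤ _ := h12
      _ ≤ _ := by gcongr
  subst hN
  have hmain : ∀ t, r₁ ≤ t → t ≤ 2 * S → scaledEnergy G t ≤ A₃ * scaledEnergy G (K * S) := by
    intro t ht htS
    have := le_of_contraction (a := scaledEnergy G) (A := (2 * K) ^ d * scaledEnergy G (K * S)) (B := B * scaledEnergy G (K * S))
      (L := 2 * S) (r₀ := r₁) (by linarith) (by positivity) (by positivity) hstep
      (fun t ht htS hlt => scaledEnergy_le h.integrable_norm_sq (by linarith) (by linarith)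
        (by
          have : K * S ≤ K * (2 * t) := by gcongr; linarith
          linarith)) t ht htS
    calc _ ≤ _ := this
      _ = _ := by rw [hA₃]; ring
  have hr0 : 0 < r := by linarith
  have hbig : (1 : ℝ) ≤ (K * r₁) ^ d := one_le_pow₀ (one_le_mul_of_one_le_of_one_le (by linarith) hr₁1)
  rcases le_total r₁ (2 * S) with hrS | hrS
  · rcases le_total r r₁ with h1 | h1
    · have h2 := scaledEnergy_le (K := r₁) h.integrable_norm_sq hr0 h1 (le_mul_of_one_le_right (by linarith) hr)
      have h3 := hmain r₁ le_rfl hrS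
      calc _ ≤ _ := h2
        _ ≤ (K * r₁) ^ d * (A₃ * scaledEnergy G (K * S)) := by
          have h4 := scaledEnergy_nonneg G (by linarith : 0 < r₁)
          have h5 : r₁ ≤ K * r₁ := le_mul_of_one_le_left (by linarith) (by linarith)
          gcongr
        _ = _ := by ring
    · rcases le_total r (2 * S) with h2 | h2
      · calc _ ≤ _ := hmain r h1 h2
          _ ≤ (K * r₁) ^ d * (A₃ * scaledEnergy G (K * S)) := le_mul_of_one_le_left (by positivity) hbig
          _ = _ := by ring
      · have h3 := scaledEnergy_le (K := K * r₁) h.integrable_norm_sq hr0 hrK (by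
          have : K * S ≤ K * r := by gcongr; linarith
          have : K * r * 1 ≤ K * r * r₁ := by gcongr
          linarith)
        calc _ ≤ _ := h3
          _ ≤ (K * r₁) ^ d * (A₃ * scaledEnergy G (K * S)) := by
            gcongr
            exact le_mul_of_one_le_left hN0 hA₃1
          _ = _ := by ring
  · have h3 := scaledEnergy_le (K := K * r₁) h.integrable_norm_sq hr0 hrK (by
      have h4 : K * S ≤ K * r₁ := by gcongr; linarith
      have : K * r₁ * 1 ≤ K * r₁ * r := by gcongr
      linarith)
    calc _ ≤ _ := h3
      _ ≤ (K * r₁) ^ d * (A₃ * scaledEnergy G (K * S)) := by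
        gcongr
        exact le_mul_of_one_le_left hN0 hA₃1
      _ = _ := by ring

/-- The large-scale estimate on balls, for solutions of the energy identity satisfying the two
capacity bounds with the same parameter `κ`. -/
theorem scaledEnergy_le_of_bounds (d : ℕ) (C : ℝ) (hC : 1 ≤ C) :
    ∃ A : ℝ, 1 ≤ A ∧ ∀ (κ R : ℝ) (u : E d → ℝ) (G : E d → E d), 0 < κ → κ ≤ 1 →
    IsEnergySolution (Metric.ball 0 R) u G → PoincareBound C κ R u G → FluxBound C κ R u →
    ∀ r, 1 ≤ r → r ≤ R → scaledEnergy G r ≤ A * scaledEnergy G R := by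
  obtain ⟨K₁, hK₁, hlarge⟩ := scaledEnergy_contraction d C hC
  set K := 5 + C + K₁ with hK
  obtain ⟨A₁, hA₁, hsmall⟩ := scaledEnergy_le_of_small_scale d C K hC (by linarith)
  have h4d : (1 : ℝ) ≤ 4 ^ d := one_le_pow₀ (by norm_num)
  have hKd : (1 : ℝ) ≤ K ^ d := one_le_pow₀ (by linarith)
  refine ⟨K ^ d * (A₁ * 4 ^ d), by nlinarith [mul_le_mul hA₁ h4d zero_le_one (by linarith)],
    fun κ R u G hκ hκ1 h hP hF r hr hrR => ?_⟩
  have hr0 : 0 < r := by linarith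
  have hR0 : 0 < R := by linarith
  have hN0 := scaledEnergy_nonneg G hR0
  have hA4 : 1 ≤ A₁ * 4 ^ d := by nlinarith
  rcases lt_or_ge R K with hRK | hRK
  · calc _ ≤ _ := scaledEnergy_le (K := K) h.integrable_norm_sq hr0 hrR (by nlinarith)
      _ ≤ K ^ d * (A₁ * 4 ^ d * scaledEnergy G R) := by
        gcongr
        exact le_mul_of_one_le_left hN0 hA4
      _ = _ := by ring
  · have hK0 : 0 < K := by linarith
    set σ := Real.sqrt κ⁻¹ with hσ
    have hσ2 : σ ^ 2 = κ⁻¹ := Real.sq_sqrt (by positivity)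
    have hσ1 : 1 ≤ σ := Real.one_le_sqrt.2 ((one_le_inv₀ hκ).2 hκ1)
    set S := min σ (R / K) with hS
    have hS1 : 1 ≤ S := le_min hσ1 ((one_le_div hK0).2 hRK)
    have hSκ : S ^ 2 * κ ≤ 1 := by
      have : S ^ 2 ≤ κ⁻¹ := by rw [← hσ2]; gcongr; exact min_le_left _ _
      calc S ^ 2 * κ ≤ κ⁻¹ * κ := by gcongr
        _ = 1 := inv_mul_cancel₀ hκ.ne'
    have hKS : K * S ≤ R := by
      have := min_le_right σ (R / K)
      rwa [← hS, le_div_iff₀ hK0, mul_comm] at this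
    have hsm := hsmall κ R S u G hκ hS1 hSκ hKS h hP hF
    -- Above the scale `K S` either nothing is left, or `S = κ^(-1/2)`.
    have hla : ∀ t, K * S ≤ t → t ≤ R → scaledEnergy G t ≤ 4 ^ d * scaledEnergy G R := by
      intro t ht htR
      rcases min_choice σ (R / K) with h1 | h1
      · refine hlarge κ R u G hκ hκ1 h hP t (by nlinarith) ?_ htR
        have h2 : K₁ * σ ≤ t := by
          rw [← hS] at h1
          rw [h1] at ht
          nlinarith
        calc K₁ ^ 2 = (K₁ * σ) ^ 2 * κ := by
              rw [mul_pow, hσ2, mul_assoc, inv_mul_cancel₀ hκ.ne', mul_one]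
          _ ≤ t ^ 2 * κ := by gcongr
      · rw [← hS] at h1
        rw [h1, mul_div_cancel₀ _ hK0.ne'] at ht
        rw [le_antisymm htR ht]
        exact le_mul_of_one_le_left hN0 h4d
    have hfin : scaledEnergy G r ≤ A₁ * (4 ^ d * scaledEnergy G R) := by
      rcases le_total r (K * S) with h1 | h1
      · exact (hsm r hr h1).trans (by gcongr; exact hla _ le_rfl hKS)
      · exact (hla r h1 hrR).trans (le_mul_of_one_le_left (by positivity) hA₁)
    calc _ ≤ _ := hfin
      _ ≤ K ^ d * (A₁ * (4 ^ d * scaledEnergy G R)) := le_mul_of_one_le_left (by positivity) hKd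
      _ = _ := by ring

end

section

variable {d : ℕ}

/-! ### Radial potentials -/

/-- `s ↦ m(s) s^(-d/2)`. -/
noncomputable def radialWeight (d : ℕ) (m : ℝ → ℝ) (s : ℝ) : ℝ := m s * s ^ (-(d : ℝ) / 2)

/-- The radial function `x ↦ ∫_{|x|²}^b m(s) s^(-d/2) ds`. For `m = 1` it is, up to constants, the
fundamental solution of the Laplacian. -/
noncomputable def radialPotential (d : ℕ) (m : ℝ → ℝ) (b : ℝ) (x : E d) : ℝ :=
  tailIntegral (radialWeight d m) b (‖x‖ ^ 2)

section Radial

variable {m : ℝ → ℝ} {α b : ℝ}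

lemma contDiff_radialWeight (hm : ContDiff ℝ ∞ m) (hα : 0 < α) (h0 : ∀ s ≤ α, m s = 0) :
    ContDiff ℝ ∞ (radialWeight d m) := by
  rw [contDiff_iff_contDiffAt]
  intro s
  rcases lt_or_ge 0 s with hs | hs
  · exact hm.contDiffAt.mul (contDiffAt_id.rpow_const_of_ne hs.ne')
  · refine contDiffAt_const (c := (0 : ℝ)) |>.congr_of_eventuallyEq ?_
    filter_upwards [Iio_mem_nhds (hs.trans_lt hα)] with t ht
    rw [radialWeight, h0 t (le_of_lt ht), zero_mul]

lemma contDiff_radialPotential (hm : ContDiff ℝ ∞ m) (hα : 0 < α) (h0 : ∀ s ≤ α, m s = 0) :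
    ContDiff ℝ ∞ (radialPotential d m b) :=
  contDiff_radial (contDiff_tailIntegral (contDiff_radialWeight hm hα h0) b)

lemma pd_radialPotential (hm : ContDiff ℝ ∞ m) (hα : 0 < α) (h0 : ∀ s ≤ α, m s = 0)
    (i : Fin d) (x : E d) :
    pd (radialPotential d m b) i x = -(2 * x i * radialWeight d m (‖x‖ ^ 2)) := by
  have h := contDiff_radialWeight (d := d) hm hα h0
  have h1 := congrFun (pd_radial (d := d) ((contDiff_tailIntegral h b).differentiable (by simp)) i) x
  rw [deriv_tailIntegral h.continuous] at h1
  rw [← mul_neg]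
  exact h1

lemma lap_radialPotential (hm : ContDiff ℝ ∞ m) (hα : 0 < α) (h0 : ∀ s ≤ α, m s = 0) (x : E d) :
    lap (radialPotential d m b) x = -(4 * (‖x‖ ^ 2) ^ (1 - (d : ℝ) / 2) * deriv m (‖x‖ ^ 2)) := by
  have h := contDiff_radialWeight (d := d) hm hα h0
  have h1 := congrFun (lap_radial (d := d) (contDiff_tailIntegral h b)) x
  have h2 : deriv (fun t => -radialWeight d m t) (‖x‖ ^ 2)
      = -deriv (radialWeight d m) (‖x‖ ^ 2) := deriv.fun_neg
  rw [deriv_tailIntegral h.continuous, h2] at h1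
  change lap (radialPotential d m b) x = _ at h1
  rw [h1]
  beta_reduce
  set t := ‖x‖ ^ 2
  rcases le_or_gt α t with ht | ht
  · have ht0 : 0 < t := hα.trans_le ht
    have h3 := (((hm.differentiable (by simp)) t).hasDerivAt).mul
      (Real.hasDerivAt_rpow_const (p := -(d : ℝ) / 2) (Or.inl ht0.ne'))
    have h4 : deriv (radialWeight d m) t = _ := h3.deriv
    have e1 : t ^ (-(d : ℝ) / 2) = t ^ (-(d : ℝ) / 2 - 1) * t := by
      rw [← Real.rpow_add_one ht0.ne']; congr 1; ring
    have e2 : t ^ (1 - (d : ℝ) / 2) = t ^ (-(d : ℝ) / 2 - 1) * t * t := by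
      rw [← Real.rpow_add_one ht0.ne', ← Real.rpow_add_one ht0.ne']; congr 1; ring
    rw [h4, radialWeight, e1, e2]
    ring
  · have h3 : m =ᶠ[nhds t] fun _ => 0 := by
      filter_upwards [Iio_mem_nhds ht] with s hs using h0 s (le_of_lt hs)
    have h4 : radialWeight d m =ᶠ[nhds t] fun _ => 0 := by
      filter_upwards [h3] with s hs
      rw [radialWeight, hs, zero_mul]
    rw [h3.deriv_eq, h4.deriv_eq, h4.eq_of_nhds]
    simp

lemma radialWeight_nonneg (hα : 0 < α) (h0 : ∀ s ≤ α, m s = 0) (hm0 : ∀ s, 0 ≤ m s) (s : ℝ) :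
    0 ≤ radialWeight d m s := by
  rcases le_or_gt s α with hs | hs
  · rw [radialWeight, h0 s hs, zero_mul]
  · exact mul_nonneg (hm0 s) (Real.rpow_nonneg (hα.trans hs).le _)

lemma radialPotential_nonneg (hα : 0 < α) (h0 : ∀ s ≤ α, m s = 0) (hm0 : ∀ s, 0 ≤ m s)
    (hb : ∀ s, b ≤ s → m s = 0) (x : E d) : 0 ≤ radialPotential d m b x :=
  tailIntegral_nonneg (radialWeight_nonneg hα h0 hm0)
    (fun s hs => by rw [radialWeight, hb s hs, zero_mul]) _

lemma radialPotential_eq_zero (hb : ∀ s, b ≤ s → m s = 0) {x : E d} (hx : b ≤ ‖x‖ ^ 2) :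
    radialPotential d m b x = 0 :=
  tailIntegral_eq_zero (fun s hs => by rw [radialWeight, hb s hs, zero_mul]) hx

lemma intervalIntegrable_rpow_of_pos {p a b : ℝ} (ha : 0 < a) (hb : 0 < b) :
    IntervalIntegrable (fun s : ℝ => s ^ p) volume a b :=
  intervalIntegral.intervalIntegrable_rpow (Or.inr fun h => by
    rcases Set.mem_uIcc.1 h with h | h <;> linarith [h.1, h.2])

/-- Near the origin the radial potential is constant. -/
lemma radialPotential_eq_of_le (hm : ContDiff ℝ ∞ m) (hα : 0 < α) (h0 : ∀ s ≤ α, m s = 0)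
    {x : E d} (hx : ‖x‖ ^ 2 ≤ α) :
    radialPotential d m b x = ∫ s in α..b, radialWeight d m s := by
  have hc := (contDiff_radialWeight (d := d) hm hα h0).continuous
  rw [radialPotential, tailIntegral, ← intervalIntegral.integral_add_adjacent_intervals
    (hc.intervalIntegrable _ _) (hc.intervalIntegrable α b), add_eq_right]
  refine intervalIntegral.integral_zero_ae (Filter.Eventually.of_forall fun s hs => ?_)
  rw [Set.uIoc_of_le hx] at hs
  rw [radialWeight, h0 s hs.2, zero_mul]

lemma radialPotential_le (hm : ContDiff ℝ ∞ m) (hα : 0 < α) (hαb : α ≤ b) (h0 : ∀ s ≤ α, m s = 0)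
    (hb : ∀ s, b ≤ s → m s = 0) (hm0 : ∀ s, 0 ≤ m s) (x : E d) :
    radialPotential d m b x ≤ ∫ s in α..b, radialWeight d m s := by
  rcases le_total (‖x‖ ^ 2) α with hx | hx
  · exact (radialPotential_eq_of_le hm hα h0 hx).le
  have hc := (contDiff_radialWeight (d := d) hm hα h0).continuous
  rcases le_total (‖x‖ ^ 2) b with hxb | hxb
  · rw [radialPotential, tailIntegral]
    exact intervalIntegral.integral_mono_interval hx hxb le_rfl
      (Filter.Eventually.of_forall (radialWeight_nonneg hα h0 hm0)) (hc.intervalIntegrable _ _)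
  · rw [radialPotential_eq_zero hb hxb]
    exact intervalIntegral.integral_nonneg hαb fun s _ => radialWeight_nonneg hα h0 hm0 s

end Radial

/-! ### Smooth steps -/

/-- A smooth increasing step from `0` on `(-∞, α]` to `1` on `[2α, ∞)`. -/
noncomputable def step (α s : ℝ) : ℝ := Real.smoothTransition ((s - α) / α)

lemma contDiff_step (α : ℝ) : ContDiff ℝ ∞ (step α) :=
  Real.smoothTransition.contDiff.comp (by fun_prop)

lemma step_nonneg (α s : ℝ) : 0 ≤ step α s := Real.smoothTransition.nonneg _

lemma step_le_one (α s : ℝ) : step α s ≤ 1 := Real.smoothTransition.le_one _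

lemma step_eq_zero {α s : ℝ} (hα : 0 < α) (hs : s ≤ α) : step α s = 0 :=
  Real.smoothTransition.zero_of_nonpos (div_nonpos_of_nonpos_of_nonneg (by linarith) hα.le)

lemma step_eq_one {α s : ℝ} (hα : 0 < α) (hs : 2 * α ≤ s) : step α s = 1 :=
  Real.smoothTransition.one_of_one_le (by rw [le_div_iff₀ hα]; linarith)

lemma deriv_step_eq_zero_of_lt {α s : ℝ} (hα : 0 < α) (hs : s < α) : deriv (step α) s = 0 := by
  have : step α =ᶠ[nhds s] fun _ => 0 := by
    filter_upwards [Iio_mem_nhds hs] with t ht using step_eq_zero hα (le_of_lt ht)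
  rw [this.deriv_eq, deriv_const]

lemma deriv_step_eq_zero_of_gt {α s : ℝ} (hα : 0 < α) (hs : 2 * α < s) : deriv (step α) s = 0 := by
  have : step α =ᶠ[nhds s] fun _ => 1 := by
    filter_upwards [Ioi_mem_nhds hs] with t ht using step_eq_one hα (le_of_lt ht)
  rw [this.deriv_eq, deriv_const]

lemma exists_bound_deriv_step :
    ∃ C : ℝ, 1 ≤ C ∧ ∀ α s : ℝ, 0 < α → |deriv (step α) s| ≤ C * α⁻¹ := by
  have h1 : ContDiff ℝ 1 Real.smoothTransition := Real.smoothTransition.contDiff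
  have hc : Continuous (deriv Real.smoothTransition) := h1.continuous_deriv le_rfl
  obtain ⟨C, hC⟩ := (isCompact_Icc (a := (0 : ℝ)) (b := 1)).exists_bound_of_continuousOn hc.continuousOn
  refine ⟨max C 1, le_max_right _ _, fun α s hα => ?_⟩
  have h2 : deriv (step α) s = deriv Real.smoothTransition ((s - α) / α) * α⁻¹ := by
    have h3 : HasDerivAt (fun s : ℝ => (s - α) / α) (1 / α) s :=
      ((hasDerivAt_id s).sub_const α).div_const α
    have h4 := ((h1.differentiable one_ne_zero ((s - α) / α)).hasDerivAt.comp s h3).deriv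
    rw [one_div] at h4
    exact h4
  rw [h2, abs_mul, abs_of_pos (inv_pos.2 hα)]
  gcongr
  by_cases ht : (s - α) / α ∈ Set.Icc (0 : ℝ) 1
  · exact (hC _ ht).trans (le_max_left _ _)
  · have h5 : deriv Real.smoothTransition ((s - α) / α) = 0 := by
      rw [Set.mem_Icc, not_and_or, not_le, not_le] at ht
      rcases ht with ht | ht
      · have : Real.smoothTransition =ᶠ[nhds ((s - α) / α)] fun _ => 0 := by
          filter_upwards [Iio_mem_nhds ht] with t ht
            using Real.smoothTransition.zero_of_nonpos (le_of_lt ht)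
        rw [this.deriv_eq, deriv_const]
      · have : Real.smoothTransition =ᶠ[nhds ((s - α) / α)] fun _ => 1 := by
          filter_upwards [Ioi_mem_nhds ht] with t ht
            using Real.smoothTransition.one_of_one_le (le_of_lt ht)
        rw [this.deriv_eq, deriv_const]
    rw [h5, abs_zero]
    positivity

/-! ### The resistance of an annulus -/

/-- The integral `∫_a^b s^(-d/2) ds`, comparable to the reciprocal of the capacity of a ball of
radius `√a` in a ball of radius `√b`. -/
noncomputable def resistance (d : ℕ) (a b : ℝ) : ℝ := ∫ s in a..b, s ^ (-(d : ℝ) / 2)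

lemma resistance_le {a b : ℝ} (ha : 0 < a) (hab : a ≤ b) :
    resistance d a b ≤ (b - a) * a ^ (-(d : ℝ) / 2) := by
  have h : resistance d a b ≤ ∫ _s in a..b, a ^ (-(d : ℝ) / 2) :=
    intervalIntegral.integral_mono_on hab (intervalIntegrable_rpow_of_pos ha (ha.trans_le hab))
      intervalIntegrable_const fun s hs => Real.rpow_le_rpow_of_nonpos ha hs.1 (by
        have : (0 : ℝ) ≤ d := d.cast_nonneg
        linarith)
  rwa [intervalIntegral.integral_const, smul_eq_mul] at h

lemma le_resistance {a b : ℝ} (ha : 0 < a) (hab : a ≤ b) :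
    (b - a) * b ^ (-(d : ℝ) / 2) ≤ resistance d a b := by
  have h : ∫ _s in a..b, b ^ (-(d : ℝ) / 2) ≤ resistance d a b :=
    intervalIntegral.integral_mono_on hab intervalIntegrable_const
      (intervalIntegrable_rpow_of_pos ha (ha.trans_le hab)) fun s hs =>
      Real.rpow_le_rpow_of_nonpos (ha.trans_le hs.1) hs.2 (by
        have : (0 : ℝ) ≤ d := d.cast_nonneg
        linarith)
  rwa [intervalIntegral.integral_const, smul_eq_mul] at h

lemma resistance_nonneg {a b : ℝ} (ha : 0 < a) (hab : a ≤ b) : 0 ≤ resistance d a b :=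
  intervalIntegral.integral_nonneg hab fun _ hs => Real.rpow_nonneg (ha.le.trans hs.1) _

lemma resistance_add {a b c : ℝ} (ha : 0 < a) (hb : 0 < b) (hc : 0 < c) :
    resistance d a b + resistance d b c = resistance d a c :=
  intervalIntegral.integral_add_adjacent_intervals (intervalIntegrable_rpow_of_pos ha hb)
    (intervalIntegrable_rpow_of_pos hb hc)

/-- In dimension at least two, `resistance d β (1/64)` is bounded below. -/
lemma half_le_resistance (hd : 2 ≤ d) {β : ℝ} (hβ : 0 < β) (hβ1 : β ≤ 1 / 128) :
    1 / 2 ≤ resistance d β (1 / 64) := by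
  have h1 := le_resistance (d := d) (a := 1 / 128) (b := 1 / 64) (by norm_num) (by norm_num)
  have h2 := resistance_nonneg (d := d) hβ hβ1
  have h3 := resistance_add (d := d) hβ (by norm_num : (0 : ℝ) < 1 / 128) (by norm_num : (0 : ℝ) < 1 / 64)
  have h4 : (1 / 64 : ℝ) ^ (-1 : ℝ) ≤ (1 / 64) ^ (-(d : ℝ) / 2) :=
    Real.rpow_le_rpow_of_exponent_ge (by norm_num) (by norm_num) (by
      have : (2 : ℝ) ≤ d := mod_cast hd
      linarith)
  rw [Real.rpow_neg_one] at h4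
  norm_num at h4 h1
  linarith

/-- Changing both endpoints by bounded factors changes the resistance by a bounded factor. -/
lemma exists_resistance_le (hd : 2 ≤ d) {θ b : ℝ} (hθ : 0 < θ) (hθ1 : θ ≤ 1) (hb : 1 ≤ b) :
    ∃ C : ℝ, 1 ≤ C ∧ ∀ β, 0 < β → β ≤ 1 / 128 →
      resistance d (θ * β) b ≤ C * resistance d β (1 / 64) := by
  set A := θ ^ (-(d : ℝ) / 2) * 2 ^ ((d : ℝ) / 2) with hA
  set B := b * (1 / 64) ^ (-(d : ℝ) / 2) with hB
  have hA0 : 0 ≤ A := by positivity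
  have hB0 : 0 ≤ B := by positivity
  refine ⟨A + 1 + 2 * B, by linarith, fun β hβ hβ1 => ?_⟩
  have hθβ : 0 < θ * β := by positivity
  have h64 : (0 : ℝ) < 1 / 64 := by norm_num
  have hb0 : 0 < b := by linarith
  have h1 : resistance d (θ * β) β ≤ A * resistance d β (1 / 64) := by
    calc resistance d (θ * β) β ≤ (β - θ * β) * (θ * β) ^ (-(d : ℝ) / 2) :=
          resistance_le hθβ (by nlinarith)
      _ ≤ β * (θ * β) ^ (-(d : ℝ) / 2) := by gcongr; linarith
      _ = A * ((2 * β - β) * (2 * β) ^ (-(d : ℝ) / 2)) := by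
        rw [Real.mul_rpow hθ.le hβ.le, Real.mul_rpow zero_le_two hβ.le, hA]
        have : (2 : ℝ) ^ ((d : ℝ) / 2) * 2 ^ (-(d : ℝ) / 2) = 1 := by
          rw [← Real.rpow_add two_pos]
          ring_nf
          simp
        linear_combination -(β * θ ^ (-(d : ℝ) / 2) * β ^ (-(d : ℝ) / 2)) * this
      _ ≤ A * resistance d β (2 * β) := by
        gcongr
        exact le_resistance hβ (by linarith)
      _ ≤ A * resistance d β (1 / 64) := by
        gcongr
        rw [← resistance_add hβ (by positivity : 0 < 2 * β) h64]
        linarith [resistance_nonneg (d := d) (by positivity : 0 < 2 * β)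
          (by linarith : 2 * β ≤ 1 / 64)]
  have h2 : resistance d (1 / 64) b ≤ 2 * B * resistance d β (1 / 64) := by
    have h3 := half_le_resistance hd hβ hβ1
    calc resistance d (1 / 64) b ≤ (b - 1 / 64) * (1 / 64) ^ (-(d : ℝ) / 2) :=
          resistance_le h64 (by linarith)
      _ ≤ B := by rw [hB]; gcongr; linarith
      _ = 2 * B * (1 / 2) := by ring
      _ ≤ _ := by gcongr
  rw [← resistance_add hθβ hβ hb0, ← resistance_add hβ h64 hb0]
  linarith

end

section

variable {d : ℕ}

/-! ### Potentials and cutoffs adapted to small balls -/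

/-- A radial potential which is subharmonic away from a small ball of radius `√(2α)`, strictly so
on the annulus `1 ≤ |x| ≤ 2d + 1`, which contains a lattice
translate of every point. -/
lemma exists_subharmonic_potential (hd : 2 ≤ d) : ∃ C : ℝ, 1 ≤ C ∧ ∀ α, 0 < α → α ≤ 1 / 8 →
    ∃ φ : E d → ℝ, ContDiff ℝ ∞ φ ∧ (∀ x, 0 ≤ φ x) ∧
      (∀ x, φ x ≤ C * resistance d α ((2 * d + 2) ^ 2)) ∧
      (∀ x, 2 * d + 2 ≤ ‖x‖ → φ x = 0) ∧ (∀ x, 2 * α < ‖x‖ ^ 2 → 0 ≤ lap φ x) ∧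
      (∀ x, 1 ≤ ‖x‖ → ‖x‖ ≤ 2 * d + 1 → C⁻¹ ≤ lap φ x) := by
  set b : ℝ := (2 * d + 2) ^ 2 with hb
  set a : ℝ := (2 * d + 1) ^ 2 with ha
  have hd0 : (2 : ℝ) ≤ d := mod_cast hd
  have hab : a + 1 ≤ b := by rw [ha, hb]; nlinarith
  have ha1 : 1 ≤ a := by rw [ha]; nlinarith
  have hb1 : 1 ≤ b := by linarith
  -- The Laplacian of the radial potential of `m` has the sign of `-deriv m`. Take `-deriv m = w ≥ 0`
  -- beyond `2α`, with `w = 1` on `[1, a]`; the step at `α` removes the singularity.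
  set w : ℝ → ℝ := fun s => step (1 / 2) s * Real.smoothTransition (b - s) with hw
  have hws : ContDiff ℝ ∞ w :=
    (contDiff_step _).mul (Real.smoothTransition.contDiff.comp (by fun_prop))
  have hw0 : ∀ s, 0 ≤ w s := fun s => mul_nonneg (step_nonneg _ _) (Real.smoothTransition.nonneg _)
  have hw1 : ∀ s, w s ≤ 1 := fun s =>
    mul_le_one₀ (step_le_one _ _) (Real.smoothTransition.nonneg _) (Real.smoothTransition.le_one _)
  have hwb : ∀ s, b ≤ s → w s = 0 := fun s hs => by
    simp only [hw]
    rw [Real.smoothTransition.zero_of_nonpos (by linarith), mul_zero]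
  have hwa : ∀ s, 1 ≤ s → s ≤ a → w s = 1 := fun s h1 h2 => by
    simp only [hw]
    rw [Real.smoothTransition.one_of_one_le (by linarith), step_eq_one (by norm_num) (by linarith),
      mul_one]
  set m₂ := tailIntegral w b with hm₂
  have hm₂0 : ∀ s, 0 ≤ m₂ s := tailIntegral_nonneg hw0 hwb
  have hm₂b : ∀ s, b ≤ s → m₂ s = 0 := fun s hs => tailIntegral_eq_zero hwb hs
  have hm₂1 : ∀ s, 0 ≤ s → m₂ s ≤ b := fun s hs => by
    rcases le_total s b with hsb | hsb
    · calc m₂ s ≤ ∫ _t in s..b, (1 : ℝ) :=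
          intervalIntegral.integral_mono_on hsb (hws.continuous.intervalIntegrable _ _)
            intervalIntegrable_const fun t _ => hw1 t
        _ ≤ b := by simp [hs]
    · rw [hm₂b s hsb]; linarith
  have hap : 0 < a ^ (1 - (d : ℝ) / 2) := Real.rpow_pos_of_pos (by linarith) _
  refine ⟨b + (a ^ (1 - (d : ℝ) / 2))⁻¹, by linarith [inv_pos.2 hap], fun α hα hα1 => ?_⟩
  set m : ℝ → ℝ := fun s => step α s * m₂ s with hm
  have hms : ContDiff ℝ ∞ m := (contDiff_step _).mul (contDiff_tailIntegral hws b)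
  have hm0 : ∀ s, 0 ≤ m s := fun s => mul_nonneg (step_nonneg _ _) (hm₂0 s)
  have hmα : ∀ s ≤ α, m s = 0 := fun s hs => by simp only [hm]; rw [step_eq_zero hα hs, zero_mul]
  have hmb : ∀ s, b ≤ s → m s = 0 := fun s hs => by simp only [hm]; rw [hm₂b s hs, mul_zero]
  have hm1 : ∀ s, 0 ≤ s → m s ≤ b := fun s hs => by
    calc m s ≤ 1 * b := mul_le_mul (step_le_one _ _) (hm₂1 s hs) (hm₂0 s) zero_le_one
      _ = b := one_mul b
  have hαb : α ≤ b := by linarith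
  have hderiv : ∀ s, 2 * α < s → deriv m s = -w s := fun s hs => by
    have h1 : m =ᶠ[nhds s] m₂ := by
      filter_upwards [Ioi_mem_nhds hs] with t ht
      simp only [hm]
      rw [step_eq_one hα (le_of_lt ht), one_mul]
    rw [h1.deriv_eq, hm₂, deriv_tailIntegral hws.continuous]
  refine ⟨radialPotential d m b, contDiff_radialPotential hms hα hmα,
    radialPotential_nonneg hα hmα hm0 hmb, fun x => ?_, fun x hx => ?_, fun x hx => ?_,
    fun x hx hx2 => ?_⟩
  · refine (radialPotential_le hms hα hαb hmα hmb hm0 x).trans ?_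
    have h1 : ∫ s in α..b, radialWeight d m s ≤ ∫ s in α..b, b * s ^ (-(d : ℝ) / 2) :=
      intervalIntegral.integral_mono_on hαb
        ((contDiff_radialWeight hms hα hmα).continuous.intervalIntegrable _ _)
        ((intervalIntegrable_rpow_of_pos hα (by linarith)).const_mul b) fun s hs =>
        mul_le_mul_of_nonneg_right (hm1 s (hα.le.trans hs.1)) (Real.rpow_nonneg (hα.le.trans hs.1) _)
    rw [intervalIntegral.integral_const_mul] at h1
    refine h1.trans (mul_le_mul_of_nonneg_right ?_ (resistance_nonneg hα hαb))
    linarith [inv_pos.2 hap]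
  · refine radialPotential_eq_zero hmb ?_
    rw [hb]
    gcongr
  · rw [lap_radialPotential hms hα hmα, hderiv _ hx]
    have := hw0 (‖x‖ ^ 2)
    have : 0 ≤ (‖x‖ ^ 2) ^ (1 - (d : ℝ) / 2) := by positivity
    rw [mul_neg, neg_neg]
    positivity
  · have h1 : 1 ≤ ‖x‖ ^ 2 := one_le_pow₀ hx
    have h2 : ‖x‖ ^ 2 ≤ a := by rw [ha]; gcongr
    rw [lap_radialPotential hms hα hmα, hderiv _ (by linarith), hwa _ h1 h2]
    have h3 : a ^ (1 - (d : ℝ) / 2) ≤ (‖x‖ ^ 2) ^ (1 - (d : ℝ) / 2) :=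
      Real.rpow_le_rpow_of_nonpos (by linarith) h2 (by linarith)
    have h4 : (b + (a ^ (1 - (d : ℝ) / 2))⁻¹)⁻¹ ≤ a ^ (1 - (d : ℝ) / 2) :=
      inv_le_of_inv_le₀ hap (by linarith)
    linarith

lemma integrableOn_ball_norm_rpow (hd : 2 ≤ d) (r : ℝ) :
    IntegrableOn (fun x : E d => ‖x‖ ^ (-((d : ℝ) - 1))) (Metric.ball 0 r) := by
  refine integrableOn_ball_of_norm_le_rpow (C := 1) (α := (d : ℝ) - 1) ?_ ?_ ?_ ?_
  · rw [finrank_euclideanSpace, Fintype.card_fin]; omega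
  · rw [finrank_euclideanSpace, Fintype.card_fin]; linarith
  · refine Filter.Eventually.of_forall fun x => ?_
    rw [one_mul, Real.norm_of_nonneg (by positivity)]
  · exact (measurable_norm.pow_const _).aestronglyMeasurable

lemma volume_real_ball {r : ℝ} (hr : 0 < r) (x : E d) :
    volume.real (Metric.ball x r) = r ^ d * volume.real (Metric.ball (0 : E d) 1) := by
  rw [measureReal_def, Measure.addHaar_ball_of_pos _ _ hr, finrank_euclideanSpace,
    Fintype.card_fin, ENNReal.toReal_mul, ENNReal.toReal_ofReal (by positivity), measureReal_def]

/-- Integrals of functions dominated on a ball and vanishing outside it. -/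
lemma integral_le_setIntegral_of_le {f g : E d → ℝ} {s : Set (E d)} (hs : MeasurableSet s)
    (hf : Integrable f) (hg : IntegrableOn g s) (hfg : ∀ᵐ x, x ∈ s → f x ≤ g x)
    (h0 : ∀ x, x ∉ s → f x ≤ 0) : ∫ x, f x ≤ ∫ x in s, g x := by
  rw [← integral_indicator hs]
  refine integral_mono_ae hf (hg.integrable_indicator hs) ?_
  filter_upwards [hfg] with x hx
  by_cases hxs : x ∈ s
  · rw [Set.indicator_of_mem hxs]; exact hx hxs
  · rw [Set.indicator_of_notMem hxs]; exact h0 x hxs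

lemma norm_sq_rpow (x : E d) (p : ℝ) : (‖x‖ ^ 2) ^ p = ‖x‖ ^ (2 * p) := by
  rw [← Real.rpow_natCast, ← Real.rpow_mul (norm_nonneg x)]
  norm_num

/-- A bound uniform in the inner radius `√α`. The exponent `d - 1` in place of the sharp `d - 2` also
covers the logarithm in dimension two, and is still integrable at the origin. -/
lemma radialPotential_le_norm_rpow (hd : 2 ≤ d) {m : ℝ → ℝ} {α b : ℝ} (hm : ContDiff ℝ ∞ m)
    (hα : 0 < α) (h0 : ∀ s ≤ α, m s = 0) (hb : ∀ s, b ≤ s → m s = 0) (hm1 : ∀ s, m s ≤ 1)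
    (hb1 : b ≤ 1) {x : E d} (hx : x ≠ 0) :
    radialPotential d m b x ≤ 2 * ‖x‖ ^ (-((d : ℝ) - 1)) := by
  have hd0 : (2 : ℝ) ≤ d := mod_cast hd
  have hx0 : 0 < ‖x‖ := norm_pos_iff.2 hx
  have ht : 0 < ‖x‖ ^ 2 := by positivity
  rcases le_total b (‖x‖ ^ 2) with hxb | hxb
  · rw [radialPotential_eq_zero hb hxb]
    positivity
  · have hb0 : 0 < b := ht.trans_le hxb
    have e1 : ‖x‖ ^ (-((d : ℝ) - 1)) = (‖x‖ ^ 2) ^ (-((d : ℝ) - 1) / 2) := by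
      rw [norm_sq_rpow]; congr 1; ring
    have h1 : radialPotential d m b x ≤
        ∫ s in ‖x‖ ^ 2..b, (‖x‖ ^ 2) ^ (-((d : ℝ) - 1) / 2) * s ^ (-(1 / 2) : ℝ) := by
      refine intervalIntegral.integral_mono_on hxb
        ((contDiff_radialWeight hm hα h0).continuous.intervalIntegrable _ _)
        ((intervalIntegrable_rpow_of_pos ht hb0).const_mul _) fun s hs => ?_
      have hs0 : 0 < s := ht.trans_le hs.1
      calc radialWeight d m s ≤ 1 * s ^ (-(d : ℝ) / 2) :=
            mul_le_mul_of_nonneg_right (hm1 s) (by positivity)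
        _ = s ^ (-((d : ℝ) - 1) / 2) * s ^ (-(1 / 2) : ℝ) := by
            rw [one_mul, ← Real.rpow_add hs0]; congr 1; ring
        _ ≤ _ := mul_le_mul_of_nonneg_right
            (Real.rpow_le_rpow_of_nonpos ht hs.1 (by linarith)) (by positivity)
    rw [intervalIntegral.integral_const_mul, ← e1, integral_rpow (Or.inl (by norm_num))] at h1
    have h2 : b ^ (-(1 / 2) + 1 : ℝ) ≤ 1 := Real.rpow_le_one hb0.le hb1 (by norm_num)
    have h3 : 0 ≤ (‖x‖ ^ 2) ^ (-(1 / 2) + 1 : ℝ) := by positivity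
    have h4 : (b ^ (-(1 / 2) + 1 : ℝ) - (‖x‖ ^ 2) ^ (-(1 / 2) + 1 : ℝ)) / (-(1 / 2) + 1) ≤ 2 := by
      rw [div_le_iff₀ (by norm_num)]
      linarith
    calc _ ≤ _ := h1
      _ ≤ ‖x‖ ^ (-((d : ℝ) - 1)) * 2 := mul_le_mul_of_nonneg_left h4 (by positivity)
      _ = _ := mul_comm _ _

/-- A smooth cutoff on the line, equal to `1` on `[2α, 1/64]` and vanishing outside `[α, 1/32]`. -/
noncomputable def annulusCutoff (α s : ℝ) : ℝ := step α s * (1 - step (1 / 64) s)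

lemma contDiff_annulusCutoff (α : ℝ) : ContDiff ℝ ∞ (annulusCutoff α) :=
  (contDiff_step _).mul (contDiff_const.sub (contDiff_step _))

lemma annulusCutoff_nonneg (α s : ℝ) : 0 ≤ annulusCutoff α s :=
  mul_nonneg (step_nonneg _ _) (sub_nonneg.2 (step_le_one _ _))

lemma annulusCutoff_le_one (α s : ℝ) : annulusCutoff α s ≤ 1 :=
  mul_le_one₀ (step_le_one _ _) (sub_nonneg.2 (step_le_one _ _))
    (by linarith [step_nonneg (1 / 64) s])

lemma annulusCutoff_eq_zero_of_le {α s : ℝ} (hα : 0 < α) (hs : s ≤ α) : annulusCutoff α s = 0 := by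
  rw [annulusCutoff, step_eq_zero hα hs, zero_mul]

lemma annulusCutoff_eq_zero_of_ge {α s : ℝ} (hs : 1 / 32 ≤ s) : annulusCutoff α s = 0 := by
  rw [annulusCutoff, step_eq_one (α := 1 / 64) (by norm_num) (by linarith), sub_self, mul_zero]

lemma annulusCutoff_eq_one {α s : ℝ} (hα : 0 < α) (hs : 2 * α ≤ s) (hs1 : s ≤ 1 / 64) :
    annulusCutoff α s = 1 := by
  rw [annulusCutoff, step_eq_one hα hs, step_eq_zero (by norm_num) hs1, sub_zero, one_mul]

lemma abs_deriv_annulusCutoff_le {α : ℝ} (s : ℝ) :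
    |deriv (annulusCutoff α) s| ≤ |deriv (step α) s| + |deriv (step (1 / 64)) s| := by
  have h1 := (((contDiff_step α).differentiable (by simp)) s).hasDerivAt.mul
    ((((contDiff_step (1 / 64)).differentiable (by simp)) s).hasDerivAt.const_sub 1)
  have h2 : deriv (annulusCutoff α) s = _ := h1.deriv
  rw [h2]
  refine (abs_add_le _ _).trans (add_le_add ?_ ?_)
  · rw [abs_mul]
    refine mul_le_of_le_one_right (abs_nonneg _) ?_
    rw [abs_of_nonneg (sub_nonneg.2 (step_le_one _ _))]
    linarith [step_nonneg (1 / 64) s]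
  · rw [abs_mul, abs_neg, abs_of_nonneg (step_nonneg _ _)]
    exact mul_le_of_le_one_left (abs_nonneg _) (step_le_one _ _)

/-- The total mass of the Laplacian of the unnormalised capacitary potential is bounded
independently of the inner radius. -/
lemma exists_integral_abs_lap_le (hd : 2 ≤ d) : ∃ C : ℝ, 0 ≤ C ∧ ∀ α, 0 < α →
    ∫ x, |lap (radialPotential d (annulusCutoff α) (1 / 32)) x| ≤ C := by
  obtain ⟨C₁, hC₁, hstep⟩ := exists_bound_deriv_step
  have hd0 : (2 : ℝ) ≤ d := mod_cast hd
  set V := volume.real (Metric.ball (0 : E d) 1) with hV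
  have hV0 : 0 ≤ V := measureReal_nonneg
  set B : ℝ := 4 * (1 / 64) ^ (1 - (d : ℝ) / 2) * (C₁ * (1 / 64)⁻¹) with hB
  have hB0 : 0 ≤ B := by positivity
  refine ⟨4 * C₁ * 2 ^ d * V + B * V, by positivity, fun α hα => ?_⟩
  set A : ℝ := 4 * α ^ (1 - (d : ℝ) / 2) * (C₁ * α⁻¹) with hA
  have hA0 : 0 ≤ A := by positivity
  have hsα : 0 < 2 * Real.sqrt α := by positivity
  have h1 : ∀ x : E d, |lap (radialPotential d (annulusCutoff α) (1 / 32)) x| ≤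
      (Metric.ball (0 : E d) (2 * Real.sqrt α)).indicator (fun _ => A) x
        + (Metric.ball (0 : E d) 1).indicator (fun _ => B) x := by
    intro x
    rw [lap_radialPotential (contDiff_annulusCutoff α) hα
      (fun s hs => annulusCutoff_eq_zero_of_le hα hs), abs_neg, abs_mul, abs_of_nonneg (by positivity)]
    set t := ‖x‖ ^ 2 with ht
    have ht0 : 0 ≤ t := by positivity
    have hp : 0 ≤ 4 * t ^ (1 - (d : ℝ) / 2) := by positivity
    -- The derivative of a step at `β` is of size `1/β` and lives on `[β, 2β]`, so its contribution is of
    -- size `β^(-d/2)` on a ball of volume of order `β^(d/2)`.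
    have key : ∀ (β r D : ℝ), 0 < β → (t ≤ 2 * β → ‖x‖ < r) →
        D = 4 * β ^ (1 - (d : ℝ) / 2) * (C₁ * β⁻¹) →
        4 * t ^ (1 - (d : ℝ) / 2) * |deriv (step β) t| ≤
          (Metric.ball (0 : E d) r).indicator (fun _ => D) x := by
      intro β r D hβ hr hD
      have hD0 : 0 ≤ D := by rw [hD]; positivity
      rcases lt_or_ge t β with h2 | h2
      · rw [deriv_step_eq_zero_of_lt hβ h2, abs_zero, mul_zero]
        exact Set.indicator_nonneg (fun _ _ => hD0) _
      rcases lt_or_ge (2 * β) t with h3 | h3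
      · rw [deriv_step_eq_zero_of_gt hβ h3, abs_zero, mul_zero]
        exact Set.indicator_nonneg (fun _ _ => hD0) _
      rw [Set.indicator_of_mem (mem_ball_zero_iff.2 (hr h3)), hD]
      have h4 : t ^ (1 - (d : ℝ) / 2) ≤ β ^ (1 - (d : ℝ) / 2) :=
        Real.rpow_le_rpow_of_nonpos hβ h2 (by linarith)
      exact mul_le_mul (by linarith) (hstep β t hβ) (abs_nonneg _) (by positivity)
    have k1 := key α (2 * Real.sqrt α) A hα (fun h => by
      rw [← sq_lt_sq₀ (norm_nonneg _) hsα.le, mul_pow, Real.sq_sqrt hα.le]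
      linarith) hA
    have k2 := key (1 / 64) 1 B (by norm_num) (fun h => by
      rw [← sq_lt_sq₀ (norm_nonneg _) zero_le_one]
      linarith) hB
    calc _ ≤ 4 * t ^ (1 - (d : ℝ) / 2) * (|deriv (step α) t| + |deriv (step (1 / 64)) t|) := by
          gcongr
          exact abs_deriv_annulusCutoff_le t
      _ ≤ _ := by rw [mul_add]; exact add_le_add k1 k2
  have hi : ∀ r D : ℝ, Integrable ((Metric.ball (0 : E d) r).indicator fun _ => D) := fun r D =>
    (integrableOn_const measure_ball_lt_top.ne).integrable_indicator measurableSet_ball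
  have hI : ∀ r D : ℝ, 0 < r → ∫ x, (Metric.ball (0 : E d) r).indicator (fun _ => D) x
      = r ^ d * V * D := fun r D hr => by
    rw [integral_indicator measurableSet_ball, setIntegral_const, smul_eq_mul, volume_real_ball hr]
  calc _ ≤ ∫ x, ((Metric.ball (0 : E d) (2 * Real.sqrt α)).indicator (fun _ => A) x
        + (Metric.ball (0 : E d) 1).indicator (fun _ => B) x) :=
        integral_mono_of_nonneg (Filter.Eventually.of_forall fun _ => abs_nonneg _)
          ((hi _ _).add (hi _ _)) (Filter.Eventually.of_forall h1)
    _ = (2 * Real.sqrt α) ^ d * V * A + B * V := by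
        rw [integral_add (hi _ _) (hi _ _), hI _ _ hsα, hI _ _ one_pos]; ring
    _ = _ := by
        have e1 : Real.sqrt α ^ d * (α ^ (1 - (d : ℝ) / 2) * α⁻¹) = 1 := by
          rw [Real.sqrt_eq_rpow, ← Real.rpow_natCast, ← Real.rpow_mul hα.le, ← Real.rpow_neg_one,
            ← Real.rpow_add hα, ← Real.rpow_add hα]
          ring_nf
          simp
        rw [mul_pow, hA]
        linear_combination 4 * C₁ * 2 ^ d * V * e1

/-- A cutoff function equal to one near a ball of radius `√α` and vanishing outside `B(0, 1/4)`,
as small in `L¹`, together with its derivatives, as the capacity `κ` of the ball permits. It is the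
radial potential divided by its value `f₀` at the origin, and `κ = 1 / (2 f₀)`. -/
lemma exists_capacitary_cutoff (hd : 2 ≤ d) : ∃ C : ℝ, 1 ≤ C ∧ ∀ α, 0 < α → 2 * α ≤ 1 / 128 →
    ∃ (κ : ℝ) (χ : E d → ℝ), 0 < κ ∧ κ ≤ 1 ∧ resistance d (2 * α) (1 / 64) ≤ κ⁻¹ ∧
      ContDiff ℝ ∞ χ ∧ (∀ x, 0 ≤ χ x) ∧ (∀ x, ‖x‖ ^ 2 ≤ α → χ x = 1) ∧
      (∀ x, 1 / 4 ≤ ‖x‖ → χ x = 0) ∧ ∫ x, χ x ≤ C * κ ∧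
      (∀ i, ∫ x, |pd χ i x| ≤ C * κ) ∧ ∫ x, |lap χ x| ≤ C * κ := by
  obtain ⟨C₁, hC₁, hlap⟩ := exists_integral_abs_lap_le (d := d) hd
  have hd0 : (2 : ℝ) ≤ d := mod_cast hd
  set J := ∫ x in Metric.ball (0 : E d) 1, ‖x‖ ^ (-((d : ℝ) - 1)) with hJ
  have hJ0 : 0 ≤ J := integral_nonneg fun x => by positivity
  refine ⟨1 + 2 * C₁ + 4 * J, by linarith, fun α hα hα1 => ?_⟩
  set m := annulusCutoff α with hm
  have hms : ContDiff ℝ ∞ m := contDiff_annulusCutoff α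
  have hm0 : ∀ s ≤ α, m s = 0 := fun s hs => annulusCutoff_eq_zero_of_le hα hs
  have hmb : ∀ s, 1 / 32 ≤ s → m s = 0 := fun s hs => annulusCutoff_eq_zero_of_ge hs
  have hmnn : ∀ s, 0 ≤ m s := annulusCutoff_nonneg α
  have hw := (contDiff_radialWeight (d := d) hms hα hm0).continuous
  set f₀ := ∫ s in α..(1 / 32), radialWeight d m s with hf₀
  have hres : resistance d (2 * α) (1 / 64) ≤ f₀ := by
    have h1 : resistance d (2 * α) (1 / 64) = ∫ s in (2 * α)..(1 / 64), radialWeight d m s := by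
      refine intervalIntegral.integral_congr fun s hs => ?_
      rw [Set.uIcc_of_le (by linarith)] at hs
      simp only [radialWeight]
      rw [hm, annulusCutoff_eq_one hα hs.1 hs.2, one_mul]
    rw [h1]
    exact intervalIntegral.integral_mono_interval (by linarith) (by linarith) (by norm_num)
      (Filter.Eventually.of_forall (radialWeight_nonneg hα hm0 hmnn)) (hw.intervalIntegrable _ _)
  have hf₀1 : 1 / 2 ≤ f₀ := (half_le_resistance hd (by positivity) hα1).trans hres
  have hf₀0 : 0 < f₀ := by linarith
  set P : E d → ℝ := radialPotential d m (1 / 32) with hP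
  have hPs : ContDiff ℝ ∞ P := contDiff_radialPotential hms hα hm0
  have hP0 : ∀ x : E d, 1 / 4 ≤ ‖x‖ → P x = 0 := fun x hx =>
    radialPotential_eq_zero hmb (by nlinarith)
  have hPt : IsTestFunction Set.univ P := isTestFunction_of_eq_zero (x := 0) (s := 1 / 4) hPs
    (fun y hy => hP0 y (by simpa using hy)) (Set.subset_univ _)
  have hint : ∀ {f : E d → ℝ}, IsTestFunction Set.univ f → Integrable f := fun hf =>
    memLp_one_iff_integrable.1 (hf.memLp 1)
  have hloc : IntegrableOn (fun x : E d => 2 * ‖x‖ ^ (-((d : ℝ) - 1))) (Metric.ball 0 1) :=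
    (integrableOn_ball_norm_rpow hd 1).const_mul 2
  have hJ2 : ∫ x in Metric.ball (0 : E d) 1, 2 * ‖x‖ ^ (-((d : ℝ) - 1)) = 2 * J :=
    integral_const_mul _ _
  have : Nontrivial (E d) := by
    apply Module.nontrivial_of_finrank_pos (R := ℝ)
    rw [finrank_euclideanSpace, Fintype.card_fin]; omega
  have hPint : ∫ x, P x ≤ 2 * J := by
    rw [← hJ2]
    refine integral_le_setIntegral_of_le measurableSet_ball (hint hPt) hloc ?_ fun x hx => ?_
    · filter_upwards [compl_mem_ae_iff.2 (measure_singleton (0 : E d))] with x hx _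
      exact radialPotential_le_norm_rpow hd hms hα hm0 hmb (annulusCutoff_le_one α) (by norm_num) hx
    · rw [mem_ball_zero_iff, not_lt] at hx
      exact (hP0 x (by linarith)).le
  have hpdint : ∀ i, ∫ x, |pd P i x| ≤ 2 * J := by
    intro i
    rw [← hJ2]
    refine integral_le_setIntegral_of_le measurableSet_ball (hint (hPt.pd i)).abs hloc
      (Filter.Eventually.of_forall fun x _ => ?_) fun x hx => ?_
    · rw [hP, pd_radialPotential hms hα hm0, abs_neg, abs_mul, abs_mul, abs_two,
        abs_of_nonneg (radialWeight_nonneg hα hm0 hmnn _)]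
      rcases eq_or_ne x 0 with rfl | hx
      · simp
        positivity
      have hx0 : 0 < ‖x‖ := norm_pos_iff.2 hx
      have h1 : radialWeight d m (‖x‖ ^ 2) ≤ ‖x‖ ^ (-(d : ℝ)) := by
        rw [radialWeight, norm_sq_rpow, show 2 * (-(d : ℝ) / 2) = -d by ring]
        exact mul_le_of_le_one_left (by positivity) (annulusCutoff_le_one α _)
      calc 2 * |x i| * radialWeight d m (‖x‖ ^ 2) ≤ 2 * ‖x‖ * ‖x‖ ^ (-(d : ℝ)) := by
            gcongr
            · exact radialWeight_nonneg hα hm0 hmnn _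
            · exact PiLp.norm_apply_le x i
        _ = _ := by
            rw [show -((d : ℝ) - 1) = -d + 1 by ring, Real.rpow_add_one hx0.ne']
            ring
    · rw [mem_ball_zero_iff, not_lt] at hx
      rw [hP, pd_radialPotential hms hα hm0, radialWeight, hmb _ (by nlinarith)]
      simp
  have hκ : (2 * f₀)⁻¹ ≤ 1 := inv_le_one_of_one_le₀ (by linarith)
  have e2 : f₀⁻¹ = 2 * (2 * f₀)⁻¹ := by field_simp
  have hκ0 : 0 < (2 * f₀)⁻¹ := by positivity
  have hb1 : ∀ I : ℝ, I ≤ 2 * J → f₀⁻¹ * I ≤ (1 + 2 * C₁ + 4 * J) * (2 * f₀)⁻¹ := fun I hI => by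
    rw [e2]
    nlinarith
  have hfun : ∀ i, pd (fun x => f₀⁻¹ * P x) i = fun x => f₀⁻¹ * pd P i x := fun i =>
    pd_const_mul (hPs.diff_infty) _ i
  refine ⟨(2 * f₀)⁻¹, fun x => f₀⁻¹ * P x, hκ0, hκ, ?_, contDiff_const.mul hPs,
    fun x => mul_nonneg (by positivity) (radialPotential_nonneg hα hm0 hmnn hmb x), fun x hx => ?_,
    fun x hx => by beta_reduce; rw [hP0 x hx, mul_zero], ?_, fun i => ?_, ?_⟩
  · rw [inv_inv]; linarith
  · beta_reduce
    rw [hP, radialPotential_eq_of_le hms hα hm0 hx, inv_mul_cancel₀ hf₀0.ne']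
  · rw [integral_const_mul]
    exact hb1 _ hPint
  · rw [hfun]
    simp only [abs_mul, abs_of_pos (inv_pos.2 hf₀0)]
    rw [integral_const_mul]
    exact hb1 _ (hpdint i)
  · rw [lap_const_mul hPs]
    simp only [abs_mul, abs_of_pos (inv_pos.2 hf₀0)]
    rw [integral_const_mul, e2]
    have := hlap α hα
    have h3 : 0 ≤ J * (2 * f₀)⁻¹ := by positivity
    have h4 : (2 * f₀)⁻¹ * ∫ x, |lap P x| ≤ (2 * f₀)⁻¹ * C₁ := by gcongr
    linarith

end

section

variable {d : ℕ}

/-! ### Lattice points -/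

@[simp] lemma latticePt_apply (k : Fin d → ℤ) (i : Fin d) : latticePt k i = (k i : ℝ) := rfl

/-- The lattice points at distance at most `r` from `x`. -/
noncomputable def latticeBall (x : E d) (r : ℝ) : Finset (Fin d → ℤ) :=
  open scoped Classical in
  {k ∈ Fintype.piFinset fun i => Finset.Icc ⌈x i - r⌉ ⌊x i + r⌋ | ‖x - latticePt k‖ ≤ r}

lemma mem_latticeBall {x : E d} {r : ℝ} {k : Fin d → ℤ} :
    k ∈ latticeBall x r ↔ ‖x - latticePt k‖ ≤ r := by
  classical
  simp only [latticeBall, Finset.mem_filter, Fintype.mem_piFinset, Finset.mem_Icc,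
    and_iff_right_iff_imp]
  intro h i
  have h1 : |x i - k i| ≤ r := (PiLp.norm_apply_le (x - latticePt k) i).trans h
  rw [abs_le] at h1
  exact ⟨Int.ceil_le.2 (by linarith), Int.le_floor.2 (by linarith)⟩

lemma card_latticeBall_le (x : E d) {r : ℝ} (hr : 0 ≤ r) :
    ((latticeBall x r).card : ℝ) ≤ (2 * r + 1) ^ d := by
  classical
  have h1 : (latticeBall x r).card ≤ ∏ i, (Finset.Icc ⌈x i - r⌉ ⌊x i + r⌋).card := by
    rw [← Fintype.card_piFinset]
    exact Finset.card_filter_le _ _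
  calc ((latticeBall x r).card : ℝ) ≤ ∏ i, ((Finset.Icc ⌈x i - r⌉ ⌊x i + r⌋).card : ℝ) :=
        mod_cast h1
    _ ≤ ∏ _i : Fin d, (2 * r + 1) := by
        refine Finset.prod_le_prod (fun _ _ => by positivity) fun i _ => ?_
        rw [Int.card_Icc]
        rcases le_total (⌊x i + r⌋ + 1 - ⌈x i - r⌉) 0 with h | h
        · rw [Int.toNat_of_nonpos h]
          push_cast
          linarith
        · have h2 : (((⌊x i + r⌋ + 1 - ⌈x i - r⌉).toNat : ℤ) : ℝ)
              = ((⌊x i + r⌋ + 1 - ⌈x i - r⌉ : ℤ) : ℝ) := by rw [Int.toNat_of_nonneg h]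
          rw [Int.cast_natCast] at h2
          rw [h2]
          push_cast
          linarith [Int.floor_le (x i + r), Int.le_ceil (x i - r)]
    _ = _ := by simp

lemma one_le_norm_latticePt_sub {k j : Fin d → ℤ} (h : k ≠ j) :
    1 ≤ ‖latticePt k - latticePt j‖ := by
  obtain ⟨i, hi⟩ := Function.ne_iff.1 h
  have h1 : ‖(latticePt k - latticePt j) i‖ ≤ ‖latticePt k - latticePt j‖ := PiLp.norm_apply_le _ i
  refine le_trans ?_ h1
  have h2 : (1 : ℤ) ≤ |k i - j i| := Int.one_le_abs (sub_ne_zero.2 hi)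
  rw [PiLp.sub_apply, latticePt_apply, latticePt_apply, Real.norm_eq_abs]
  exact_mod_cast h2

lemma norm_le_of_abs_apply_le {x : E d} {a : ℝ} (ha : 0 ≤ a) (h : ∀ i, |x i| ≤ a) :
    ‖x‖ ≤ Real.sqrt d * a := by
  rw [EuclideanSpace.norm_eq]
  refine Real.sqrt_le_iff.2 ⟨by positivity, ?_⟩
  calc ∑ i, ‖x i‖ ^ 2 ≤ ∑ _i : Fin d, a ^ 2 := by
        gcongr with i
        exact h i
    _ = _ := by rw [mul_pow, Real.sq_sqrt d.cast_nonneg]; simp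

/-- Every point has a lattice point at a distance between `1` and `2d + 1`. -/
lemma exists_latticePt_annulus (hd : 2 ≤ d) (x : E d) :
    ∃ k : Fin d → ℤ, 1 ≤ ‖x - latticePt k‖ ∧ ‖x - latticePt k‖ ≤ 2 * d + 1 := by
  set k₀ : Fin d → ℤ := fun i => round (x i) with hk₀
  set e : E d := EuclideanSpace.single ⟨0, by omega⟩ ((d : ℝ) + 1) with he
  have h1 : ‖x - latticePt k₀‖ ≤ d := by
    have h2 := norm_le_of_abs_apply_le (x := x - latticePt k₀) (a := 1 / 2) (by norm_num)
      fun i => by simpa [hk₀] using abs_sub_round (x i)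
    have h3 : Real.sqrt d ≤ d := by
      have : (2 : ℝ) ≤ d := mod_cast hd
      exact Real.sqrt_le_iff.2 ⟨by linarith, by nlinarith⟩
    linarith [Real.sqrt_nonneg (d : ℝ)]
  have h2 : ‖e‖ = d + 1 := by
    rw [he, PiLp.norm_single, Real.norm_of_nonneg (by positivity)]
  refine ⟨k₀ + Pi.single ⟨0, by omega⟩ ((d : ℤ) + 1), ?_⟩
  have h3 : latticePt (k₀ + Pi.single ⟨0, by omega⟩ ((d : ℤ) + 1)) = latticePt k₀ + e := by
    ext i
    by_cases hi : i = ⟨0, by omega⟩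
    · subst hi; simp [he]
    · simp [he, hi]
  rw [h3]
  have h4 : x - (latticePt k₀ + e) = (x - latticePt k₀) - e := by abel
  rw [h4]
  have h5 := norm_sub_norm_le e (x - latticePt k₀)
  rw [norm_sub_rev e] at h5
  have h6 := norm_sub_le (x - latticePt k₀) e
  constructor <;> linarith

/-! ### The two capacity bounds -/

/-- A solution vanishing on balls of radius `δ` about the lattice points satisfies a Poincaré
inequality: the energy identity is tested with a sum of translated potentials. -/
lemma exists_poincare (hd : 2 ≤ d) : ∃ C : ℝ, 1 ≤ C ∧ ∀ (δ R : ℝ) (u : E d → ℝ) (G : E d → E d),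
    0 < δ → δ ≤ 1 / 2 → IsEnergySolution (Metric.ball 0 R) u G →
    (∀ k, ∀ᵐ y, ‖y - latticePt k‖ < δ → u y = 0) → ∀ r, 0 < r → r + C ≤ R →
    ∫ y in Metric.ball (0 : E d) r, u y ^ 2 ≤
      C * resistance d (δ ^ 2 / 4) ((2 * d + 2) ^ 2) *
        ∫ y in Metric.ball (0 : E d) (r + C), ‖G y‖ ^ 2 := by
  obtain ⟨C₁, hC₁, hpot⟩ := exists_subharmonic_potential (d := d) hd
  have hd0 : (2 : ℝ) ≤ d := mod_cast hd
  set R₀ : ℝ := 2 * d + 2 with hR₀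
  have hR₀0 : 0 < R₀ := by positivity
  set N : ℝ := (2 * R₀ + 1) ^ d with hN
  have hN0 : 0 ≤ N := by positivity
  refine ⟨1 + 2 * R₀ + C₁ * (2 * (N * C₁)), by
    have : 0 ≤ C₁ * (2 * (N * C₁)) := by positivity
    linarith, fun δ R u G hδ hδ1 h hu r hr hrR => ?_⟩
  obtain ⟨φ, hφ, hφ0, hφ1, hφR, hlap0, hlap1⟩ := hpot (δ ^ 2 / 4) (by positivity) (by nlinarith)
  set I := resistance d (δ ^ 2 / 4) (R₀ ^ 2) with hI
  have hI0 : 0 ≤ I := resistance_nonneg (by positivity) (by nlinarith)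
  set C : ℝ := 1 + 2 * R₀ + C₁ * (2 * (N * C₁)) with hC
  have hCC : 2 * R₀ < C := by
    have : 0 ≤ C₁ * (2 * (N * C₁)) := by positivity
    linarith
  set F := latticeBall (0 : E d) (r + R₀) with hF
  have hφk : ∀ k : Fin d → ℤ, ContDiff ℝ ∞ fun y : E d => φ (y - latticePt k) :=
    fun k => hφ.comp (by fun_prop)
  set θ : E d → ℝ := fun y => ∑ k ∈ F, φ (y - latticePt k) with hθ
  have hθs : ContDiff ℝ ∞ θ := ContDiff.sum fun k _ => hφk k
  have hθ0 : ∀ y, 0 ≤ θ y := fun y => Finset.sum_nonneg fun k _ => hφ0 _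
  have hθout : ∀ y, r + 2 * R₀ ≤ ‖y - 0‖ → θ y = 0 := fun y hy => by
    refine Finset.sum_eq_zero fun k hk => hφR _ ?_
    rw [hF, mem_latticeBall, zero_sub, norm_neg] at hk
    rw [sub_zero] at hy
    linarith [norm_sub_norm_le y (latticePt k)]
  have hθt : IsTestFunction (Metric.ball 0 R) θ := isTestFunction_of_eq_zero hθs hθout
    (Metric.closedBall_subset_ball (by linarith))
  have hθ1 : ∀ y, θ y ≤ N * (C₁ * I) := fun y => by
    calc θ y ≤ ∑ k ∈ latticeBall y R₀, φ (y - latticePt k) := by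
          classical
          simp only [hθ]
          rw [← Finset.sum_filter_ne_zero F]
          refine Finset.sum_le_sum_of_subset_of_nonneg (fun k hk => ?_) fun k _ _ => hφ0 _
          replace hk := (Finset.mem_filter.1 hk).2
          rw [mem_latticeBall]
          by_contra! hlt
          exact hk (hφR _ hlt.le)
      _ ≤ ∑ _k ∈ latticeBall y R₀, C₁ * I := Finset.sum_le_sum fun k _ => hφ1 _
      _ = (latticeBall y R₀).card * (C₁ * I) := by simp
      _ ≤ _ := by
          gcongr
          exact card_latticeBall_le y hR₀0.le
  have hlapθ : ∀ y, lap θ y = ∑ k ∈ F, lap φ (y - latticePt k) := fun y => by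
    rw [hθ, lap_sum F hφk]
    exact Finset.sum_congr rfl fun k _ => congrFun (lap_comp_sub hφ _) y
  have hid := h.integral_sq_mul_lap_eq θ hθt
  have hu2 : Integrable fun y => u y ^ 2 := h.memLp.integrable_sq
  have hlow : C₁⁻¹ * ∫ y in Metric.ball (0 : E d) r, u y ^ 2 ≤ ∫ y, u y ^ 2 * lap θ y := by
    rw [← integral_const_mul, ← integral_indicator measurableSet_ball]
    refine integral_mono_ae ((hu2.const_mul _).indicator measurableSet_ball)
      (hθt.lap.integrable_mul hu2) ?_
    filter_upwards [ae_all_iff.2 hu] with y hy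
    -- Where `lap φ` may be negative, `u` vanishes.
    have hterm : ∀ k, 0 ≤ u y ^ 2 * lap φ (y - latticePt k) := fun k => by
      rcases lt_or_ge ‖y - latticePt k‖ δ with h1 | h1
      · rw [hy k h1]; simp
      · refine mul_nonneg (sq_nonneg _) (hlap0 _ ?_)
        nlinarith
    rw [hlapθ, Finset.mul_sum]
    by_cases hyr : y ∈ Metric.ball (0 : E d) r
    · rw [Set.indicator_of_mem hyr]
      obtain ⟨k, hk1, hk2⟩ := exists_latticePt_annulus hd y
      have hkF : k ∈ F := by
        rw [hF, mem_latticeBall, zero_sub, norm_neg]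
        rw [mem_ball_zero_iff] at hyr
        linarith [norm_sub_norm_le (latticePt k) y, norm_sub_rev y (latticePt k)]
      refine le_trans ?_ (Finset.single_le_sum (fun k _ => hterm k) hkF)
      rw [mul_comm]
      exact mul_le_mul_of_nonneg_left (hlap1 _ hk1 hk2) (sq_nonneg _)
    · rw [Set.indicator_of_notMem hyr]
      exact Finset.sum_nonneg fun k _ => hterm k
  have hupp : ∫ y, ‖G y‖ ^ 2 * θ y ≤
      N * (C₁ * I) * ∫ y in Metric.ball (0 : E d) (r + C), ‖G y‖ ^ 2 := by
    rw [← integral_const_mul]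
    refine integral_le_setIntegral_of_le measurableSet_ball (hθt.integrable_mul h.integrable_norm_sq)
      (h.integrable_norm_sq.integrableOn.const_mul _)
      (Filter.Eventually.of_forall fun y _ => ?_) fun y hy => ?_
    · rw [mul_comm]
      exact mul_le_mul_of_nonneg_right (hθ1 y) (sq_nonneg _)
    · rw [mem_ball_zero_iff, not_lt] at hy
      rw [hθout y (by rw [sub_zero]; linarith), mul_zero]
  set X := ∫ y in Metric.ball (0 : E d) (r + C), ‖G y‖ ^ 2 with hX
  have hX0 : 0 ≤ X := integral_nonneg fun _ => sq_nonneg _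
  have hC₁0 : 0 < C₁ := by linarith
  have h1 : C₁⁻¹ * ∫ y in Metric.ball (0 : E d) r, u y ^ 2 ≤ 2 * (N * (C₁ * I) * X) := by linarith
  rw [inv_mul_le_iff₀ hC₁0] at h1
  calc _ ≤ _ := h1
    _ = (C₁ * (2 * (N * C₁))) * I * X := by ring
    _ ≤ C * I * X := by
        gcongr
        linarith

/-- The trivial flux bound, without any gain from the capacity. -/
lemma exists_fluxBound_one (d : ℕ) : ∃ C : ℝ, 1 ≤ C ∧ ∀ (R : ℝ) (u : E d → ℝ),
    FluxBound C 1 R u := by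
  set V := volume.real (Metric.ball (0 : E d) 2) with hV
  have hV0 : 0 ≤ V := measureReal_nonneg
  set V₁ := volume.real (Metric.ball (0 : E d) 1) with hV₁
  have hV₁0 : 0 ≤ V₁ := measureReal_nonneg
  refine ⟨1 + 2 ^ d * V₁, by linarith [show 0 ≤ 2 ^ d * V₁ by positivity], ?_⟩
  intro R u x s b M φ hs hx hφ h0 hb _ hlap hM hu
  have hs0 : 0 < s := by linarith
  have hb0 : 0 ≤ b := (abs_nonneg _).trans (hb 0)
  have hφt : IsTestFunction (Metric.closedBall x s) φ := isTestFunction_of_eq_zero hφ h0 le_rfl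
  have h1 : ∀ᵐ y, ‖u y * lap φ y‖ ≤ (Metric.ball x (2 * s)).indicator (fun _ => M * b) y := by
    filter_upwards [hu] with y hy
    by_cases hys : y ∈ Metric.closedBall x s
    · rw [Set.indicator_of_mem (Metric.closedBall_subset_ball (by linarith) hys), norm_mul]
      exact mul_le_mul (hy hys) (hlap y) (norm_nonneg _) hM
    · rw [hφt.lap.eq_zero hys, mul_zero, norm_zero]
      exact Set.indicator_nonneg (fun _ _ => by positivity) _
  have h2 := norm_integral_le_of_norm_le
    ((integrableOn_const measure_ball_lt_top.ne).integrable_indicator measurableSet_ball) h1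
  rw [integral_indicator measurableSet_ball, setIntegral_const, smul_eq_mul,
    volume_real_ball (by positivity : 0 < 2 * s), Real.norm_eq_abs] at h2
  calc _ ≤ _ := h2
    _ = (2 ^ d * V₁) * b * s ^ d * 1 * M := by rw [mul_pow]; ring
    _ ≤ _ := by
      gcongr
      linarith

/-- The flux bound from a cutoff function of small capacity: the test function is corrected by
cutting out the holes, which are contained in the balls of radius `√α` about the lattice points. -/
lemma fluxBound_of_cutoff {u : E d → ℝ} {G : E d → E d} {R α κ C : ℝ} {H : Set (E d)}
    (hα1 : α ≤ 1 / 16) (hC : 0 ≤ C) (hκ : 0 < κ) (h : HasWeakGrad (Metric.ball 0 R) u G)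
    (hharm : ∀ φ, IsTestFunction (Metric.ball 0 R ∩ Hᶜ) φ → ∑ i, ∫ x, G x i * pd φ i x = 0)
    (hH : ∀ y ∈ H, ∃ k, ‖y - latticePt k‖ ^ 2 < α) {χ : E d → ℝ} (hχ : ContDiff ℝ ∞ χ)
    (hχ0 : ∀ x, 0 ≤ χ x) (hχ1 : ∀ x, ‖x‖ ^ 2 ≤ α → χ x = 1) (hχout : ∀ x, 1 / 4 ≤ ‖x‖ → χ x = 0)
    (hint : ∫ x, χ x ≤ C * κ) (hpd : ∀ i, ∫ x, |pd χ i x| ≤ C * κ)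
    (hlap : ∫ x, |lap χ x| ≤ C * κ) : FluxBound (5 ^ d * ((2 + 2 * d) * C)) κ R u := by
  intro x s b M φ hs hx hφ h0 hb hpdb hlapb hM hu
  have hs0 : 0 < s := by linarith
  have hb0 : 0 ≤ b := (abs_nonneg _).trans (hb 0)
  have hφt : IsTestFunction (Metric.closedBall x s) φ := isTestFunction_of_eq_zero hφ h0 le_rfl
  have hχt : IsTestFunction Set.univ χ := isTestFunction_of_eq_zero (x := 0) (s := 1 / 4) hχ
    (fun y hy => hχout y (by simpa using hy)) (Set.subset_univ _)
  have hL1 : ∀ {f : E d → ℝ}, IsTestFunction Set.univ f → Integrable f := fun hf =>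
    memLp_one_iff_integrable.1 (hf.memLp 1)
  set F := latticeBall x (s + 1) with hF
  have hχk : ∀ k : Fin d → ℤ, ContDiff ℝ ∞ fun y : E d => χ (y - latticePt k) :=
    fun k => hχ.comp (by fun_prop)
  have hφχ : ∀ k : Fin d → ℤ, ContDiff ℝ ∞ fun y : E d => φ y * χ (y - latticePt k) :=
    fun k => hφ.mul (hχk k)
  set ψ : E d → ℝ := fun y => φ y + (-1) * ∑ k ∈ F, φ y * χ (y - latticePt k) with hψ
  have hsum : ContDiff ℝ ∞ fun y => ∑ k ∈ F, φ y * χ (y - latticePt k) :=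
    ContDiff.sum fun k _ => hφχ k
  have hψs : ContDiff ℝ ∞ ψ := hφ.add (contDiff_const.mul hsum)
  -- Near the holes exactly one summand is active, and it equals one.
  have hψ0 : ∀ y k, ‖y - latticePt k‖ ^ 2 < α → ψ y = 0 := by
    intro y k hk
    simp only [hψ]
    rcases lt_or_ge ‖y - x‖ s with hys | hys
    · have hk4 : ‖y - latticePt k‖ < 1 / 4 := by
        rw [← sq_lt_sq₀ (norm_nonneg _) (by norm_num)]
        linarith
      have hkF : k ∈ F := by
        rw [hF, mem_latticeBall]
        have := norm_sub_le_norm_sub_add_norm_sub x y (latticePt k)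
        rw [norm_sub_rev x y] at this
        linarith
      rw [Finset.sum_eq_single_of_mem k hkF fun j _ hj => ?_, hχ1 _ hk.le]
      · ring
      · have h1 := one_le_norm_latticePt_sub hj
        have h2 := norm_sub_le_norm_sub_add_norm_sub (latticePt j) y (latticePt k)
        rw [norm_sub_rev (latticePt j) y] at h2
        rw [hχout _ (by linarith), mul_zero]
    · simp [h0 y hys]
  have hψt : IsTestFunction (Metric.ball 0 R ∩ Hᶜ) ψ := by
    have h1 : IsTestFunction (Metric.ball 0 R) ψ := isTestFunction_of_eq_zero hψs
      (fun y hy => by simp [hψ, h0 y hy]) hx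
    refine ⟨h1.smooth, h1.compact, Set.subset_inter h1.support_subset fun y hy hyH => ?_⟩
    obtain ⟨k, hk⟩ := hH y hyH
    have hopen : IsOpen {z : E d | ‖z - latticePt k‖ ^ 2 < α} :=
      isOpen_lt (by fun_prop) continuous_const
    refine (notMem_tsupport_iff_eventuallyEq.2 ?_) hy
    filter_upwards [hopen.mem_nhds hk] with z hz using hψ0 z k hz
  -- Since `∫ u Δψ = 0`, only the correction terms near the holes remain.
  have hz := h.integral_mul_lap_eq_zero hharm hψt
  have hlapψ : lap ψ = fun y => lap φ y + (-1) * ∑ k ∈ F, lap (fun y => φ y * χ (y - latticePt k)) y := by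
    rw [hψ, lap_add hφ (contDiff_const.mul hsum), lap_const_mul hsum, lap_sum F hφχ]
  have hφχt : ∀ k : Fin d → ℤ,
      IsTestFunction (Metric.closedBall x s) fun y => φ y * χ (y - latticePt k) :=
    fun k => hφt.mul_smooth (hχk k)
  have hi0 : Integrable fun y => u y * lap φ y := hφt.lap.integrable_mul_of_memLp h.memLp
  have hik : ∀ k : Fin d → ℤ, Integrable fun y => u y * lap (fun y => φ y * χ (y - latticePt k)) y :=
    fun k => (hφχt k).lap.integrable_mul_of_memLp h.memLp
  have heq : ∫ y, u y * lap φ y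
      = ∑ k ∈ F, ∫ y, u y * lap (fun y => φ y * χ (y - latticePt k)) y := by
    rw [hlapψ] at hz
    have h1 : ∀ y, u y * (lap φ y + (-1) * ∑ k ∈ F, lap (fun y => φ y * χ (y - latticePt k)) y)
        = u y * lap φ y - ∑ k ∈ F, u y * lap (fun y => φ y * χ (y - latticePt k)) y := fun y => by
      rw [← Finset.mul_sum]; ring
    simp only [h1] at hz
    rw [integral_sub hi0 (integrable_finsetSum _ fun k _ => hik k),
      integral_finsetSum _ fun k _ => hik k] at hz
    linarith
  have hterm : ∀ k : Fin d → ℤ, |∫ y, u y * lap (fun y => φ y * χ (y - latticePt k)) y|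
      ≤ M * b * ((2 + 2 * d) * C * κ) := by
    intro k
    set g : E d → ℝ := fun z => χ z + 2 * ∑ i, |pd χ i z| + |lap χ z| with hg
    have hgs : Integrable fun z => ∑ i, |pd χ i z| :=
      integrable_finsetSum _ fun i _ => (hL1 (hχt.pd i)).abs
    have hgi : Integrable g := ((hL1 hχt).add (hgs.const_mul 2)).add (hL1 hχt.lap).abs
    have hgint : ∫ z, g z ≤ (2 + 2 * d) * C * κ := by
      rw [hg, integral_add (by exact (hL1 hχt).add (hgs.const_mul 2)) (hL1 hχt.lap).abs,
        integral_add (hL1 hχt) (hgs.const_mul 2), integral_const_mul,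
        integral_finsetSum _ fun i _ => (hL1 (hχt.pd i)).abs]
      have : ∑ i, ∫ z, |pd χ i z| ≤ ∑ _i : Fin d, C * κ := Finset.sum_le_sum fun i _ => hpd i
      rw [Finset.sum_const, Finset.card_univ, Fintype.card_fin, nsmul_eq_mul] at this
      linarith
    have hpt : ∀ᵐ y, ‖u y * lap (fun y => φ y * χ (y - latticePt k)) y‖
        ≤ M * b * g (y - latticePt k) := by
      filter_upwards [hu] with y hy
      have hg0 : 0 ≤ g (y - latticePt k) := by
        have := hχ0 (y - latticePt k)
        positivity
      by_cases hys : y ∈ Metric.closedBall x s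
      · rw [norm_mul, mul_assoc]
        refine mul_le_mul (hy hys) ?_ (norm_nonneg _) hM
        rw [lap_mul hφ (hχk k), Real.norm_eq_abs, lap_comp_sub hχ]
        simp only [pd_comp_sub]
        have h1 : |∑ i, pd φ i y * pd χ i (y - latticePt k)|
            ≤ b * ∑ i, |pd χ i (y - latticePt k)| := by
          rw [Finset.mul_sum]
          refine (Finset.abs_sum_le_sum_abs _ _).trans (Finset.sum_le_sum fun i _ => ?_)
          rw [abs_mul]
          exact mul_le_mul_of_nonneg_right (hpdb y i) (abs_nonneg _)
        have h2 : |φ y * lap χ (y - latticePt k)| ≤ b * |lap χ (y - latticePt k)| := by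
          rw [abs_mul]
          exact mul_le_mul_of_nonneg_right (hb y) (abs_nonneg _)
        have h3 : |χ (y - latticePt k) * lap φ y| ≤ b * χ (y - latticePt k) := by
          rw [abs_mul, abs_of_nonneg (hχ0 _), mul_comm]
          exact mul_le_mul_of_nonneg_right (hlapb y) (hχ0 _)
        have h4 : |2 * ∑ i, pd φ i y * pd χ i (y - latticePt k)|
            ≤ 2 * (b * ∑ i, |pd χ i (y - latticePt k)|) := by
          rw [abs_mul, abs_two]
          gcongr
        calc _ ≤ _ := abs_add_three _ _ _
          _ ≤ _ := add_le_add (add_le_add h2 h4) h3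
          _ = _ := by rw [hg]; ring
      · rw [(hφχt k).lap.eq_zero hys, mul_zero, norm_zero]
        positivity
    have h5 := norm_integral_le_of_norm_le ((hgi.comp_sub_right (latticePt k)).const_mul (M * b)) hpt
    rw [integral_const_mul, integral_sub_right_eq_self g] at h5
    exact h5.trans (by gcongr)
  rw [heq]
  -- The ball contains of order `sᵈ` holes.
  have hcard : ((F.card : ℝ)) ≤ 5 ^ d * s ^ d := by
    rw [← mul_pow]
    refine (card_latticeBall_le x (by linarith)).trans ?_
    gcongr
    linarith
  calc _ ≤ ∑ k ∈ F, |∫ y, u y * lap (fun y => φ y * χ (y - latticePt k)) y| :=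
        Finset.abs_sum_le_sum_abs _ _
    _ ≤ ∑ _k ∈ F, M * b * ((2 + 2 * d) * C * κ) := Finset.sum_le_sum fun k _ => hterm k
    _ = F.card * (M * b * ((2 + 2 * d) * C * κ)) := by simp
    _ ≤ 5 ^ d * s ^ d * (M * b * ((2 + 2 * d) * C * κ)) := by gcongr
    _ = _ := by ring

/-- Both capacity bounds hold, with a parameter `κ` comparable to the capacity of the holes, for
solutions in a periodic array of holes of size `η`. -/
theorem exists_capacity_bounds (hd : 2 ≤ d) {c : ℝ} (hc : 0 < c) (hc1 : c ≤ 1 / 2) :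
    ∃ C : ℝ, 1 ≤ C ∧ ∀ η, 0 < η → η ≤ 1 → ∃ κ : ℝ, 0 < κ ∧ κ ≤ 1 ∧
      ∀ (R : ℝ) (H : Set (E d)) (u : E d → ℝ) (G : E d → E d),
        IsEnergySolution (Metric.ball 0 R) u G →
        (∀ φ, IsTestFunction (Metric.ball 0 R ∩ Hᶜ) φ → ∑ i, ∫ x, G x i * pd φ i x = 0) →
        (∀ y ∈ H, ∃ k, ‖y - latticePt k‖ ^ 2 < d * η ^ 2) →
        (∀ k, ∀ᵐ y, ‖y - latticePt k‖ < c * η → u y = 0) →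
        PoincareBound C κ R u G ∧ FluxBound C κ R u := by
  have hd0 : (2 : ℝ) ≤ d := mod_cast hd
  obtain ⟨C₁, hC₁, hpoin⟩ := exists_poincare (d := d) hd
  obtain ⟨C₂, hC₂, htriv⟩ := exists_fluxBound_one d
  obtain ⟨C₃, hC₃, hcut⟩ := exists_capacitary_cutoff (d := d) hd
  set b : ℝ := (2 * d + 2) ^ 2 with hb
  have hb1 : 1 ≤ b := by rw [hb]; nlinarith
  set θ : ℝ := c ^ 2 / (8 * d) with hθ
  have hθ0 : 0 < θ := by positivity
  have hθ1 : θ ≤ 1 := by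
    rw [hθ, div_le_one (by positivity)]
    nlinarith
  obtain ⟨C₄, hC₄, hres⟩ := exists_resistance_le (d := d) hd hθ0 hθ1 hb1
  -- For `η` bounded below the resistance is bounded and there is nothing to gain.
  set D : ℝ := b * (c ^ 2 / (1024 * d)) ^ (-(d : ℝ) / 2) with hD
  have hD0 : 0 ≤ D := by positivity
  set B : ℝ := 5 ^ d * ((2 + 2 * d) * C₃) with hB
  have hB0 : 0 ≤ B := by positivity
  set C : ℝ := C₁ + C₂ + C₁ * C₄ + B + C₁ * D with hC
  have hp1 : 0 ≤ C₁ * C₄ := by positivity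
  have hp2 : 0 ≤ C₁ * D := by positivity
  have hmono : ∀ {C' κ R : ℝ} {u : E d → ℝ}, 0 < κ → C' ≤ C → FluxBound C' κ R u →
      FluxBound C κ R u := by
    intro C' κ R u hκ hCC hF x s β M φ hs hx hφ h0 hβ hpd hlap hM hu
    have hβ0 : 0 ≤ β := (abs_nonneg _).trans (hβ 0)
    refine (hF x s β M φ hs hx hφ h0 hβ hpd hlap hM hu).trans ?_
    gcongr
  have hpmono : ∀ {κ R δ : ℝ} {u : E d → ℝ} {G : E d → E d}, 0 < κ → 0 < δ → δ ≤ 1 / 2 →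
      C₁ * resistance d (δ ^ 2 / 4) b ≤ C * κ⁻¹ →
      IsEnergySolution (Metric.ball 0 R) u G → (∀ k, ∀ᵐ y, ‖y - latticePt k‖ < δ → u y = 0) →
      PoincareBound C κ R u G := by
    intro κ R δ u G hκ hδ hδ1 hle h hu r hr hrR
    have hCC : C₁ ≤ C := by linarith
    refine (hpoin δ R u G hδ hδ1 h hu r hr (by linarith)).trans ?_
    have h1 : ∫ y in Metric.ball (0 : E d) (r + C₁), ‖G y‖ ^ 2 ≤
        ∫ y in Metric.ball (0 : E d) (r + C), ‖G y‖ ^ 2 :=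
      setIntegral_mono_of_subset h.integrable_norm_sq (fun _ => sq_nonneg _)
        (Metric.ball_subset_ball (by linarith))
    exact mul_le_mul hle h1 (integral_nonneg fun _ => sq_nonneg _) (by positivity)
  refine ⟨C, by linarith, fun η hη hη1 => ?_⟩
  have hδ : 0 < c * η := by positivity
  have hδ1 : c * η ≤ 1 / 2 := by nlinarith
  -- The resistances of the inner and outer radii of a hole differ by a bounded factor.
  have he : (c * η) ^ 2 / 4 = θ * (2 * (d * η ^ 2)) := by
    rw [hθ]; field_simp; norm_num
  rcases le_total (2 * (d * η ^ 2)) (1 / 128) with hsmall | hlarge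
  · obtain ⟨κ, χ, hκ, hκ1, hκres, hχ, hχ0, hχ1, hχout, hint, hpd, hlap⟩ :=
      hcut (d * η ^ 2) (by positivity) hsmall
    refine ⟨κ, hκ, hκ1, fun R H u G h hharm hH hu => ⟨hpmono hκ hδ hδ1 ?_ h hu, ?_⟩⟩
    · rw [he]
      calc C₁ * resistance d (θ * (2 * (d * η ^ 2))) b ≤ C₁ * (C₄ * κ⁻¹) := by
            gcongr
            refine (hres _ (by positivity) hsmall).trans ?_
            gcongr
        _ = C₁ * C₄ * κ⁻¹ := by ring
        _ ≤ _ := by gcongr; linarith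
    · exact hmono hκ (by linarith) (fluxBound_of_cutoff (by linarith) (by linarith) hκ
        h.toHasWeakGrad hharm hH hχ hχ0 hχ1 hχout hint hpd hlap)
  · refine ⟨1, one_pos, le_rfl, fun R H u G h hharm hH hu => ⟨hpmono one_pos hδ hδ1 ?_ h hu,
      hmono one_pos (by linarith) (htriv R u)⟩⟩
    have h1 : c ^ 2 / (1024 * d) ≤ (c * η) ^ 2 / 4 := by
      rw [div_le_div_iff₀ (by positivity) (by norm_num)]
      have := mul_le_mul_of_nonneg_left hlarge (sq_nonneg c)
      nlinarith
    have h2 : (c * η) ^ 2 / 4 ≤ b := by nlinarith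
    have h3 : resistance d ((c * η) ^ 2 / 4) b ≤ D := by
      refine (resistance_le (by positivity) h2).trans ?_
      rw [hD]
      refine mul_le_mul ?_ (Real.rpow_le_rpow_of_nonpos (by positivity) h1 (by linarith))
        (by positivity) (by linarith)
      linarith [show 0 ≤ (c * η) ^ 2 / 4 by positivity]
    calc C₁ * resistance d ((c * η) ^ 2 / 4) b ≤ C₁ * D := by gcongr
      _ ≤ C * 1⁻¹ := by rw [inv_one, mul_one]; linarith

end

section

variable {d : ℕ}

/-! ### The cone property of the holes -/

/-- Short cones with vertex near a point of an open set stay in the set. -/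
lemma exists_ball_cone_subset {U : Set (E d)} (hU : IsOpen U) {x : E d} (hx : x ∈ U) (e : E d)
    (c : ℝ) : ∃ δ : ℝ, 0 < δ ∧ ∀ y ∈ Metric.ball x δ, ∀ t ∈ Set.Ioo 0 δ, ∀ z ∈ Metric.ball e c,
      y + t • z ∈ U := by
  obtain ⟨ρ, hρ, hρU⟩ := Metric.isOpen_iff.1 hU x hx
  have hK : 0 < 1 + ‖e‖ + |c| := by positivity
  refine ⟨ρ / (1 + ‖e‖ + |c|), by positivity, fun y hy t ht z hz => hρU ?_⟩
  rw [mem_ball_iff_norm] at hy hz ⊢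
  have hz' : ‖z‖ ≤ ‖e‖ + |c| := by linarith [norm_sub_norm_le z e, le_abs_self c]
  have h1 : y + t • z - x = (y - x) + t • z := by abel
  calc ‖y + t • z - x‖ ≤ ‖y - x‖ + ‖t • z‖ := by rw [h1]; exact norm_add_le _ _
    _ = ‖y - x‖ + t * ‖z‖ := by rw [norm_smul, Real.norm_of_nonneg ht.1.le]
    _ < ρ / (1 + ‖e‖ + |c|) + ρ / (1 + ‖e‖ + |c|) * (‖e‖ + |c|) := by
        refine add_lt_add_of_lt_of_le hy ?_
        exact mul_le_mul ht.2.le hz' (norm_nonneg _) (by positivity)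
    _ = ρ := by field_simp; ring

/-- The closure of an open Lipschitz domain has the exterior cone property: cones opening downwards
in the chart stay below the graph. -/
lemma HasLipschitzBoundary.hasConeProperty {D : Set (E d)} (hD : IsOpen D)
    (h : HasLipschitzBoundary D) : HasConeProperty (closure D) := by
  intro x
  by_cases hx : x ∈ closure D
  swap
  · obtain ⟨δ, hδ, hc⟩ := exists_ball_cone_subset isClosed_closure.isOpen_compl hx 0 1
    exact ⟨δ, hδ, 0, 1, one_pos, fun y hy _ => hc y hy⟩
  by_cases hxD : x ∈ D
  · obtain ⟨δ, hδ, hb⟩ := Metric.isOpen_iff.1 hD x hxD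
    exact ⟨δ, hδ, 0, 1, one_pos, fun y hy hyD => absurd (subset_closure (hb hy)) hyD⟩
  obtain ⟨ρ, hρ, e, he, ψ, K, hψ, hchart⟩ := h x ⟨hx, by rwa [hD.interior_eq]⟩
  -- The cone around `-e` of aperture `c` is steeper than the graph: `c - 1 + 2 K c = 0`.
  set c : ℝ := (2 * K + 1)⁻¹ with hc
  have hc0 : 0 < c := by positivity
  have hcK : c * (2 * K + 1) = 1 := inv_mul_cancel₀ (by positivity)
  obtain ⟨δ, hδ, hcone⟩ := exists_ball_cone_subset Metric.isOpen_ball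
    (Metric.mem_ball_self hρ : x ∈ Metric.ball x ρ) (-e) c
  refine ⟨min δ ρ, lt_min hδ hρ, -e, c, hc0, fun y hy hyD t ht => ?_⟩
  have hyδ := Metric.ball_subset_ball (min_le_left δ ρ) hy
  have hyρ := Metric.ball_subset_ball (min_le_right δ ρ) hy
  have htδ : t ∈ Set.Ioo 0 δ := ⟨ht.1, ht.2.trans_le (min_le_left _ _)⟩
  have hy1 : inner ℝ e y ≤ ψ (y - inner ℝ e y • e) := by
    have : y ∉ D := fun h => hyD (subset_closure h)
    rwa [hchart y hyρ, not_lt] at this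
  have hout : ∀ z ∈ Metric.ball (-e) c, y + t • z ∉ D := by
    intro z hz
    rw [hchart _ (hcone y hyδ t htδ z hz), not_lt]
    rw [mem_ball_iff_norm, sub_neg_eq_add] at hz
    have h1 : inner ℝ e (z + e) ≤ ‖z + e‖ := by
      simpa [he] using real_inner_le_norm e (z + e)
    have h1' : |inner ℝ e (z + e)| ≤ ‖z + e‖ := by
      simpa [he] using abs_real_inner_le_norm e (z + e)
    have h2 : inner ℝ e (z + e) = inner ℝ e z + 1 := by
      rw [inner_add_right, real_inner_self_eq_norm_sq, he]; norm_num
    have h3 : inner ℝ e (y + t • z) = inner ℝ e y + t * inner ℝ e z := by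
      rw [inner_add_right, real_inner_smul_right]
    have h4 : (y + t • z - inner ℝ e (y + t • z) • e) - (y - inner ℝ e y • e)
        = t • ((z + e) - inner ℝ e (z + e) • e) := by
      rw [h3, h2]
      module
    have h5 : ‖(z + e) - inner ℝ e (z + e) • e‖ ≤ 2 * c := by
      refine (norm_sub_le _ _).trans ?_
      rw [norm_smul, he, mul_one, Real.norm_eq_abs]
      linarith
    have h6 := hψ.dist_le_mul (y + t • z - inner ℝ e (y + t • z) • e) (y - inner ℝ e y • e)
    rw [dist_eq_norm, dist_eq_norm, h4, norm_smul, Real.norm_of_nonneg ht.1.le,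
      Real.norm_eq_abs] at h6
    have h7 : K * (t * ‖(z + e) - inner ℝ e (z + e) • e‖) ≤ K * (t * (2 * c)) := by
      have := ht.1.le
      gcongr
    have h8 := (abs_le.1 (h6.trans h7)).1
    have h9 : t * inner ℝ e z ≤ t * (c - 1) := mul_le_mul_of_nonneg_left (by linarith) ht.1.le
    have h10 : t * (c - 1) + K * (t * (2 * c)) = 0 := by linear_combination t * hcK
    rw [h3]
    rw [h3] at h8
    linarith
  -- The translated cone avoids `D` on an open set, hence avoids its closure too.
  have hdisj : Disjoint (Metric.ball (y - t • e) (t * c)) D := by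
    rw [Set.disjoint_left]
    intro w hw
    have h1 : y + t • (t⁻¹ • (w - y)) = w := by
      rw [smul_inv_smul₀ ht.1.ne']; abel
    rw [← h1]
    refine hout _ ?_
    rw [mem_ball_iff_norm] at hw ⊢
    have h2 : t⁻¹ • (w - y) - -e = t⁻¹ • (w - (y - t • e)) := by
      have h3 : w - (y - t • e) = (w - y) + t • e := by abel
      rw [h3, smul_add, inv_smul_smul₀ ht.1.ne', sub_neg_eq_add]
    rw [h2, norm_smul, norm_inv, Real.norm_of_nonneg ht.1.le, inv_mul_lt_iff₀ ht.1]
    exact hw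
  intro z hz
  refine Set.disjoint_left.1 (hdisj.closure_right Metric.isOpen_ball) ?_
  rw [mem_ball_iff_norm, sub_neg_eq_add] at hz
  rw [mem_ball_iff_norm]
  have h1 : y + t • z - (y - t • e) = t • (z + e) := by rw [smul_add]; abel
  rw [h1, norm_smul, Real.norm_of_nonneg ht.1.le]
  exact mul_lt_mul_of_pos_left hz ht.1

/-- The rescaled hole `k + η T`. -/
def hole (T : Set (E d)) (η : ℝ) (k : Fin d → ℤ) : Set (E d) :=
  (fun y => latticePt k + η • y) '' T

/-- The union of the rescaled holes `k + η T`. -/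
def holes (T : Set (E d)) (η : ℝ) : Set (E d) := ⋃ k, hole T η k

lemma mem_hole {T : Set (E d)} {η : ℝ} (hη : 0 < η) {k : Fin d → ℤ} {x : E d} :
    x ∈ hole T η k ↔ η⁻¹ • (x - latticePt k) ∈ T := by
  constructor
  · rintro ⟨y, hy, rfl⟩
    simpa [hη.ne'] using hy
  · intro h
    refine ⟨_, h, ?_⟩
    simp only []
    rw [smul_inv_smul₀ hη.ne']
    abel

lemma hasConeProperty_hole {T : Set (E d)} (hT : HasConeProperty T) {η : ℝ} (hη : 0 < η)
    (k : Fin d → ℤ) : HasConeProperty (hole T η k) := by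
  intro x
  obtain ⟨δ, hδ, e, c, hc, h⟩ := hT (η⁻¹ • (x - latticePt k))
  refine ⟨min δ (η * δ), by positivity, e, c, hc, fun y hy hyT t ht z hz => ?_⟩
  rw [mem_hole hη] at hyT ⊢
  have h1 : η⁻¹ • (y + t • z - latticePt k) = η⁻¹ • (y - latticePt k) + (η⁻¹ * t) • z := by
    rw [mul_smul, ← smul_add]; congr 1; abel
  rw [h1]
  refine h _ ?_ hyT _ ⟨mul_pos (inv_pos.2 hη) ht.1, ?_⟩ z hz
  · rw [mem_ball_iff_norm] at hy ⊢
    rw [← smul_sub, sub_sub_sub_cancel_right, norm_smul, norm_inv, Real.norm_of_nonneg hη.le,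
      inv_mul_lt_iff₀ hη]
    exact hy.trans_le (min_le_right _ _)
  · rw [inv_mul_lt_iff₀ hη]
    exact ht.2.trans_le (min_le_right _ _)

section ModelHole

variable {c₀ : ℝ} {T : Set (E d)}

lemma isClosed_unitCell : IsClosed (unitCell d) := by
  have : unitCell d = ⋂ i, {x : E d | x i ∈ Set.Icc (-(1 / 2) : ℝ) (1 / 2)} := by
    ext x; simp [unitCell]
  rw [this]
  exact isClosed_iInter fun i => isClosed_Icc.preimage (by fun_prop)

lemma IsModelHole.isClosed (h : IsModelHole d c₀ T) : IsClosed T := by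
  obtain ⟨D, -, -, -, rfl⟩ := h.exists_open
  exact isClosed_closure

lemma IsModelHole.hasConeProperty (h : IsModelHole d c₀ T) : HasConeProperty T := by
  obtain ⟨D, hD, -, hL, rfl⟩ := h.exists_open
  exact hL.hasConeProperty hD

lemma IsModelHole.subset_unitCell (h : IsModelHole d c₀ T) : T ⊆ unitCell d := by
  obtain ⟨D, -, hD, -, rfl⟩ := h.exists_open
  exact closure_minimal hD isClosed_unitCell

/-- The model hole lies in the open unit cell, since its boundary stays away from that of the
cell. -/
lemma IsModelHole.subset_interior (h : IsModelHole d c₀ T) (hc₀ : 0 < c₀) :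
    T ⊆ interior (unitCell d) := by
  intro x hx
  by_contra hxi
  have h1 : x ∈ frontier (unitCell d) := ⟨subset_closure (h.subset_unitCell hx), hxi⟩
  have h2 : x ∈ frontier T := ⟨subset_closure hx, fun h' => hxi (interior_mono h.subset_unitCell h')⟩
  have := h.le_dist x h2 x h1
  rw [dist_self] at this
  linarith

lemma abs_apply_lt_of_mem_interior {x : E d} (hx : x ∈ interior (unitCell d)) (i : Fin d) :
    |x i| < 1 / 2 := by
  obtain ⟨ρ, hρ, hb⟩ := Metric.isOpen_iff.1 isOpen_interior x hx
  have key : ∀ s : ℝ, |s| < ρ → |x i + s| ≤ 1 / 2 := fun s hs => by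
    have h1 : x + EuclideanSpace.single i s ∈ unitCell d := interior_subset (hb (by
      rw [mem_ball_iff_norm, add_sub_cancel_left, PiLp.norm_single]
      exact hs))
    have h2 := h1 i
    simp only [PiLp.add_apply, PiLp.single_apply, if_true] at h2
    exact abs_le.2 h2
  have h1 := key (ρ / 2) (by rw [abs_of_pos (by positivity)]; linarith)
  have h2 := key (-(ρ / 2)) (by rw [abs_neg, abs_of_pos (by positivity)]; linarith)
  rw [abs_le] at h1 h2
  rw [abs_lt]
  constructor <;> linarith [h1.1, h1.2, h2.1, h2.2]

lemma IsModelHole.abs_apply_lt (h : IsModelHole d c₀ T) (hc₀ : 0 < c₀) {x : E d} (hx : x ∈ T)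
    (i : Fin d) : |x i| < 1 / 2 :=
  abs_apply_lt_of_mem_interior (h.subset_interior hc₀ hx) i

lemma IsModelHole.norm_le (h : IsModelHole d c₀ T) {x : E d} (hx : x ∈ T) :
    ‖x‖ ≤ Real.sqrt d * (1 / 2) :=
  norm_le_of_abs_apply_le (by norm_num) fun i => abs_le.2 (h.subset_unitCell hx i)

lemma IsModelHole.norm_sub_le_of_mem_hole (h : IsModelHole d c₀ T) {η : ℝ} (hη : 0 < η)
    {k : Fin d → ℤ} {x : E d} (hx : x ∈ hole T η k) :
    ‖x - latticePt k‖ ≤ η * (Real.sqrt d * (1 / 2)) := by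
  rw [mem_hole hη] at hx
  have h1 := h.norm_le hx
  rwa [norm_smul, norm_inv, Real.norm_of_nonneg hη.le, inv_mul_le_iff₀ hη] at h1

lemma IsModelHole.eq_of_mem_hole (h : IsModelHole d c₀ T) (hc₀ : 0 < c₀) {η : ℝ} (hη : 0 < η)
    (hη1 : η ≤ 1) {k j : Fin d → ℤ} {x : E d} (hk : x ∈ hole T η k) (hj : x ∈ hole T η j) :
    k = j := by
  have key : ∀ (k : Fin d → ℤ), x ∈ hole T η k → ∀ i, |x i - k i| < 1 / 2 := fun k hk i => by
    rw [mem_hole hη] at hk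
    have h1 := h.abs_apply_lt hc₀ hk i
    simp only [PiLp.smul_apply, PiLp.sub_apply, latticePt_apply, smul_eq_mul] at h1
    rw [abs_mul, abs_of_pos (inv_pos.2 hη), inv_mul_lt_iff₀ hη] at h1
    linarith
  funext i
  have h1 := key k hk i
  have h2 := key j hj i
  rw [abs_lt] at h1 h2
  have h3 : |(k i : ℝ) - j i| < 1 := by
    rw [abs_lt]; constructor <;> linarith [h1.1, h1.2, h2.1, h2.2]
  have h4 : |k i - j i| < 1 := by exact_mod_cast h3
  have := Int.abs_lt_one_iff.1 h4
  omega

lemma IsModelHole.locallyFinite_hole (h : IsModelHole d c₀ T) {η : ℝ} (hη : 0 < η) :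
    LocallyFinite (hole T η) := by
  intro x
  refine ⟨Metric.ball x 1, Metric.ball_mem_nhds x one_pos,
    (latticeBall x (1 + η * (Real.sqrt d * (1 / 2)))).finite_toSet.subset ?_⟩
  rintro k ⟨y, hy, hyx⟩
  rw [Finset.mem_coe, mem_latticeBall]
  have h1 := h.norm_sub_le_of_mem_hole hη hy
  rw [mem_ball_iff_norm'] at hyx
  linarith [norm_sub_le_norm_sub_add_norm_sub x y (latticePt k)]

lemma IsModelHole.isClosed_hole (h : IsModelHole d c₀ T) {η : ℝ} (hη : 0 < η) (k : Fin d → ℤ) :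
    IsClosed (hole T η k) := by
  have h1 : hole T η k = (fun x : E d => η⁻¹ • (x - latticePt k)) ⁻¹' T :=
    Set.ext fun x => mem_hole hη
  rw [h1]
  exact h.isClosed.preimage (by fun_prop)

/-- The rescaled holes are disjoint, closed and locally finite, so near a point at most one of them
matters. -/
lemma IsModelHole.hasConeProperty_holes (h : IsModelHole d c₀ T) (hc₀ : 0 < c₀) {η : ℝ}
    (hη : 0 < η) (hη1 : η ≤ 1) : HasConeProperty (holes T η) := by
  intro x
  by_cases hx : x ∈ holes T η
  · obtain ⟨k, hk⟩ := Set.mem_iUnion.1 hx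
    obtain ⟨δ, hδ, e, c, hc, hcone⟩ := hasConeProperty_hole h.hasConeProperty hη k x
    have hcl : IsClosed (⋃ j : {j // j ≠ k}, hole T η j) :=
      ((h.locallyFinite_hole hη).comp_injective Subtype.val_injective).isClosed_iUnion
        fun j => h.isClosed_hole hη j
    obtain ⟨δ', hδ', hcone'⟩ := exists_ball_cone_subset hcl.isOpen_compl (x := x) (fun hx' => by
      obtain ⟨⟨j, hj⟩, hxj⟩ := Set.mem_iUnion.1 hx'
      exact hj (h.eq_of_mem_hole hc₀ hη hη1 hxj hk)) e c
    refine ⟨min δ δ', lt_min hδ hδ', e, c, hc, fun y hy hyH t ht z hz hmem => ?_⟩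
    obtain ⟨j, hj⟩ := Set.mem_iUnion.1 hmem
    by_cases hjk : j = k
    · subst hjk
      exact hcone y (Metric.ball_subset_ball (min_le_left _ _) hy)
        (fun hy' => hyH (Set.mem_iUnion.2 ⟨_, hy'⟩)) t ⟨ht.1, ht.2.trans_le (min_le_left _ _)⟩ z hz hj
    · exact hcone' y (Metric.ball_subset_ball (min_le_right _ _) hy) t
        ⟨ht.1, ht.2.trans_le (min_le_right _ _)⟩ z hz (Set.mem_iUnion.2 ⟨⟨j, hjk⟩, hj⟩)
  · have hcl : IsClosed (holes T η) :=
      (h.locallyFinite_hole hη).isClosed_iUnion fun k => h.isClosed_hole hη k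
    obtain ⟨δ, hδ, hc⟩ := exists_ball_cone_subset hcl.isOpen_compl hx 0 1
    exact ⟨δ, hδ, 0, 1, one_pos, fun y hy _ => hc y hy⟩

lemma IsModelHole.exists_norm_sq_lt (h : IsModelHole d c₀ T) (hd : 0 < d) {η : ℝ} (hη : 0 < η)
    {y : E d} (hy : y ∈ holes T η) : ∃ k, ‖y - latticePt k‖ ^ 2 < d * η ^ 2 := by
  obtain ⟨k, hk⟩ := Set.mem_iUnion.1 hy
  refine ⟨k, ?_⟩
  have h1 := h.norm_sub_le_of_mem_hole hη hk
  have hd' : (0 : ℝ) < d := mod_cast hd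
  calc ‖y - latticePt k‖ ^ 2 ≤ (η * (Real.sqrt d * (1 / 2))) ^ 2 := by gcongr
    _ = d * η ^ 2 / 4 := by rw [mul_pow, mul_pow, Real.sq_sqrt hd'.le]; ring
    _ < d * η ^ 2 := by linarith [show 0 < d * η ^ 2 by positivity]

lemma IsModelHole.mem_holes_of_norm_lt (h : IsModelHole d c₀ T) {η : ℝ} (hη : 0 < η) {y : E d}
    {k : Fin d → ℤ} (hy : ‖y - latticePt k‖ < c₀ * η) : y ∈ holes T η := by
  refine Set.mem_iUnion.2 ⟨k, (mem_hole hη).2 (h.ball_subset ?_)⟩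
  rw [mem_ball_zero_iff, norm_smul, norm_inv, Real.norm_of_nonneg hη.le, inv_mul_lt_iff₀ hη]
  linarith

end ModelHole

end

section

open scoped Pointwise

variable {d : ℕ}

/-! ### Extension by zero, rescaling, and the estimate on cubes -/

lemma isOpen_cube (R : ℝ) : IsOpen (cube d R) := by
  have : cube d R = ⋂ i, {x : E d | x i ∈ Set.Ioo (-(R / 2)) (R / 2)} := by
    ext x; simp [cube]
  rw [this]
  exact isOpen_iInter_of_finite fun i => isOpen_Ioo.preimage (by fun_prop)

lemma mem_cube {R : ℝ} {x : E d} : x ∈ cube d R ↔ ∀ i, |x i| < R / 2 :=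
  forall_congr' fun _ => abs_lt.symm

lemma ball_subset_cube (R : ℝ) : Metric.ball (0 : E d) (R / 2) ⊆ cube d R := fun x hx =>
  mem_cube.2 fun i => (PiLp.norm_apply_le x i).trans_lt (mem_ball_zero_iff.1 hx)

lemma cube_subset_ball (hd : 2 ≤ d) {r : ℝ} (hr : 0 < r) :
    cube d r ⊆ Metric.ball (0 : E d) (d * r) := fun x hx => by
  have h1 := norm_le_of_abs_apply_le (by positivity) fun i => (mem_cube.1 hx i).le
  have hd0 : (2 : ℝ) ≤ d := mod_cast hd
  have h2 : Real.sqrt d ≤ d := Real.sqrt_le_iff.2 ⟨by linarith, by nlinarith⟩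
  rw [mem_ball_zero_iff]
  calc ‖x‖ ≤ Real.sqrt d * (r / 2) := h1
    _ ≤ d * (r / 2) := by gcongr
    _ < d * r := by
      have : 0 < d * r := by positivity
      linarith

lemma cube_mono {r R : ℝ} (h : r ≤ R) : cube d r ⊆ cube d R := fun x hx =>
  mem_cube.2 fun i => (mem_cube.1 hx i).trans_le (by linarith)

lemma cube_eq_smul {r : ℝ} (hr : 0 < r) : cube d r = r • cube d 1 := by
  ext x
  rw [Set.mem_smul_set_iff_inv_smul_mem₀ hr.ne', mem_cube, mem_cube]
  refine forall_congr' fun i => ?_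
  rw [PiLp.smul_apply, smul_eq_mul, abs_mul, abs_of_pos (inv_pos.2 hr), inv_mul_lt_iff₀ hr]
  ring_nf

lemma volume_real_cube {r : ℝ} (hr : 0 < r) :
    volume.real (cube d r) = r ^ d * volume.real (cube d 1) := by
  rw [cube_eq_smul hr, measureReal_def, Measure.addHaar_smul, finrank_euclideanSpace,
    Fintype.card_fin, ENNReal.toReal_mul, ENNReal.toReal_ofReal (abs_nonneg _),
    abs_of_nonneg (by positivity), measureReal_def]

lemma l2Average_eq_sqrt {U : Set (E d)} {G : E d → E d} :
    l2Average U G = Real.sqrt ((volume.real U)⁻¹ * ∫ x in U, ‖G x‖ ^ 2) := by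
  rw [l2Average, setAverage_eq, smul_eq_mul]

/-- Extension by zero outside `U` turns a function in `W^{1,2}(U)` into square integrable functions
on the whole space. -/
lemma IsW12WithGrad.hasWeakGrad {U : Set (E d)} {u : E d → ℝ} {G : E d → E d}
    (h : IsW12WithGrad U u G) (hU : IsOpen U) : HasWeakGrad U (U.indicator u) (U.indicator G) where
  memLp := (memLp_indicator_iff_restrict hU.measurableSet).2 h.memLp
  memLp_grad := (memLp_indicator_iff_restrict hU.measurableSet).2 h.memLp_grad
  integral_eq φ hφ i := by
    have h1 : (fun x => U.indicator u x * pd φ i x) = U.indicator fun x => u x * pd φ i x :=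
      funext fun x => by
        by_cases hx : x ∈ U
        · simp only [Set.indicator_of_mem hx]
        · simp only [Set.indicator_of_notMem hx, zero_mul]
    have h2 : (fun x => U.indicator G x i * φ x) = U.indicator fun x => G x i * φ x :=
      funext fun x => by
        by_cases hx : x ∈ U
        · simp only [Set.indicator_of_mem hx]
        · simp only [Set.indicator_of_notMem hx, PiLp.zero_apply, zero_mul]
    rw [h1, h2, integral_indicator hU.measurableSet, integral_indicator hU.measurableSet]
    exact h.integral_eq φ hφ i

/-- Weak harmonicity in coordinates, for the extension of `G` by zero. -/
lemma sum_integral_indicator_eq_zero {U V : Set (E d)} {G : E d → E d} (hU : IsOpen U)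
    (hG : MemLp G 2 (volume.restrict U)) (h : IsWeaklyHarmonic (U ∩ V) G) {φ : E d → ℝ}
    (hφ : IsTestFunction (U ∩ V) φ) : ∑ i, ∫ x, U.indicator G x i * pd φ i x = 0 := by
  have hG' : MemLp (U.indicator G) 2 volume := (memLp_indicator_iff_restrict hU.measurableSet).2 hG
  rw [← integral_finsetSum _ fun i _ => (hφ.pd i).integrable_mul_of_memLp (memLp_coord hG' i),
    ← h φ hφ]
  symm
  have h1 : ∀ x, inner ℝ (G x) (gradient φ x) = ∑ i, G x i * pd φ i x := fun x => by
    rw [inner_gradient_right, fderiv_eq_sum_pd]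
    rfl
  simp only [h1]
  have h2 : ∀ x, x ∉ U ∩ V → ∑ i, G x i * pd φ i x = 0 := fun x hx =>
    Finset.sum_eq_zero fun i _ => by rw [(hφ.pd i).eq_zero hx, mul_zero]
  rw [setIntegral_eq_integral_of_forall_compl_eq_zero h2]
  refine integral_congr_ae (Filter.Eventually.of_forall fun x => ?_)
  by_cases hx : x ∈ U
  · simp only [Set.indicator_of_mem hx]
  · simp only [h2 x fun hx' => hx hx'.1, Set.indicator_of_notMem hx, PiLp.zero_apply, zero_mul,
      Finset.sum_const_zero]

section Rescale

variable {ε : ℝ}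

lemma memLp_comp_smul {F : Type*} [NormedAddCommGroup F] {f : E d → F} (hf : MemLp f 2 volume)
    (hε : 0 < ε) : MemLp (fun x => f (ε • x)) 2 volume := by
  have h1 : MemLp f 2 (Measure.map (fun x : E d => ε • x) volume) := by
    rw [Measure.map_addHaar_smul _ hε.ne']
    exact hf.smul_measure ENNReal.ofReal_ne_top
  exact h1.comp_of_map (by fun_prop)

lemma ae_comp_smul {p : E d → Prop} (h : ∀ᵐ x, p x) (hε : 0 < ε) : ∀ᵐ x : E d, p (ε • x) := by
  have h1 : ∀ᵐ x ∂(Measure.map (fun x : E d => ε • x) volume), p x := by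
    rw [Measure.map_addHaar_smul _ hε.ne']
    exact Measure.ae_smul_measure h _
  exact ae_of_ae_map (by fun_prop) h1

lemma IsTestFunction.comp_inv_smul {U : Set (E d)} {φ : E d → ℝ} (hε : 0 < ε)
    (h : IsTestFunction ((fun x : E d => ε • x) ⁻¹' U) φ) :
    IsTestFunction U fun y => φ (ε⁻¹ • y) where
  smooth := h.smooth.comp (by fun_prop)
  compact := h.compact.comp_smul (inv_ne_zero hε.ne')
  support_subset y hy := by
    have h1 := tsupport_comp_subset_preimage (f := fun y : E d => ε⁻¹ • y) φ (by fun_prop) hy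
    have h2 := h.support_subset h1
    rwa [Set.mem_preimage, smul_inv_smul₀ hε.ne'] at h2

lemma pd_comp_inv_smul (φ : E d → ℝ) (i : Fin d) (y : E d) :
    pd (fun y => φ (ε⁻¹ • y)) i y = ε⁻¹ * pd φ i (ε⁻¹ • y) := by
  simpa using congrFun (pd_comp_affine φ ε⁻¹ 0 i) y

lemma integral_mul_comp_smul (f g : E d → ℝ) (hε : 0 < ε) :
    ∫ x, f (ε • x) * g x = (ε ^ d)⁻¹ * ∫ y, f y * g (ε⁻¹ • y) := by
  have h1 := Measure.integral_comp_smul volume (fun y : E d => f y * g (ε⁻¹ • y)) ε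
  rw [finrank_euclideanSpace, Fintype.card_fin, abs_of_nonneg (by positivity), smul_eq_mul] at h1
  simpa only [inv_smul_smul₀ hε.ne'] using h1

lemma HasWeakGrad.comp_smul {U : Set (E d)} {u : E d → ℝ} {G : E d → E d} (h : HasWeakGrad U u G)
    (hε : 0 < ε) : HasWeakGrad ((fun x : E d => ε • x) ⁻¹' U) (fun x => u (ε • x))
      (fun x => ε • G (ε • x)) where
  memLp := memLp_comp_smul h.memLp hε
  memLp_grad := (memLp_comp_smul h.memLp_grad hε).const_smul ε
  integral_eq φ hφ i := by
    have h1 := h.integral_eq _ (hφ.comp_inv_smul hε) i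
    simp only [pd_comp_inv_smul] at h1
    have h2 : ∀ y, u y * (ε⁻¹ * pd φ i (ε⁻¹ • y)) = ε⁻¹ * (u y * pd φ i (ε⁻¹ • y)) :=
      fun y => by ring
    simp only [h2] at h1
    rw [integral_const_mul, inv_mul_eq_iff_eq_mul₀ hε.ne'] at h1
    rw [integral_mul_comp_smul u (pd φ i) hε, h1]
    have h3 : ∀ x, (ε • G (ε • x)) i * φ x = ε * (G (ε • x) i * φ x) := fun x => by
      rw [PiLp.smul_apply, smul_eq_mul]; ring
    simp only [h3]
    rw [integral_const_mul, integral_mul_comp_smul (fun y => G y i) φ hε]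
    ring

lemma sum_integral_comp_smul_eq_zero {U : Set (E d)} {G : E d → E d}
    (h : ∀ φ, IsTestFunction U φ → ∑ i, ∫ x, G x i * pd φ i x = 0) (hε : 0 < ε) {φ : E d → ℝ}
    (hφ : IsTestFunction ((fun x : E d => ε • x) ⁻¹' U) φ) :
    ∑ i, ∫ x, (ε • G (ε • x)) i * pd φ i x = 0 := by
  have h1 := h _ (hφ.comp_inv_smul hε)
  simp only [pd_comp_inv_smul] at h1
  have h3 : ∀ i, ∫ x, (ε • G (ε • x)) i * pd φ i x
      = ε ^ 2 * (ε ^ d)⁻¹ * ∫ y, G y i * (ε⁻¹ * pd φ i (ε⁻¹ • y)) := fun i => by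
    have e1 : ∀ x, (ε • G (ε • x)) i * pd φ i x = ε * (G (ε • x) i * pd φ i x) := fun x => by
      rw [PiLp.smul_apply, smul_eq_mul]; ring
    have e2 : ∀ y, G y i * (ε⁻¹ * pd φ i (ε⁻¹ • y)) = ε⁻¹ * (G y i * pd φ i (ε⁻¹ • y)) :=
      fun y => by ring
    simp only [e1, e2]
    rw [integral_const_mul, integral_const_mul, integral_mul_comp_smul (fun y => G y i) _ hε]
    field_simp
  simp only [h3]
  rw [← Finset.mul_sum, h1, mul_zero]

lemma setIntegral_norm_sq_comp_smul (G : E d → E d) (hε : 0 < ε) (ρ : ℝ) :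
    ∫ x in Metric.ball (0 : E d) ρ, ‖ε • G (ε • x)‖ ^ 2
      = ε ^ 2 * (ε ^ d)⁻¹ * ∫ y in Metric.ball (0 : E d) (ε * ρ), ‖G y‖ ^ 2 := by
  have h1 : ∀ x, ‖ε • G (ε • x)‖ ^ 2 = ε ^ 2 * ‖G (ε • x)‖ ^ 2 := fun x => by
    rw [norm_smul, Real.norm_of_nonneg hε.le, mul_pow]
  simp only [h1]
  rw [integral_const_mul, Measure.setIntegral_comp_smul_of_pos volume (fun y => ‖G y‖ ^ 2) _ hε,
    finrank_euclideanSpace, Fintype.card_fin, smul_eq_mul, smul_ball hε.ne', smul_zero,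
    Real.norm_of_nonneg hε.le]
  ring

lemma scaledEnergy_comp_smul (G : E d → E d) (hε : 0 < ε) (ρ : ℝ) :
    scaledEnergy (fun x => ε • G (ε • x)) ρ = ε ^ 2 * scaledEnergy G (ε * ρ) := by
  rw [scaledEnergy, scaledEnergy, setIntegral_norm_sq_comp_smul G hε, mul_pow, mul_inv]
  ring

lemma smul_mem_perforated_iff {T : Set (E d)} (hε : 0 < ε) (η : ℝ) (x : E d) :
    ε • x ∈ perforated T ε η ↔ x ∉ holes T η := by
  rw [perforated, Set.mem_compl_iff, not_iff_not]
  simp only [holes, hole, Set.mem_iUnion, Set.mem_image, smul_right_inj hε.ne']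

end Rescale

/-- The estimate on balls: after rescaling to the unit lattice, the energy identity and the
capacity bounds are available. -/
theorem exists_scaledEnergy_le (hd : 2 ≤ d) {c₀ : ℝ} (hc₀ : 0 < c₀) : ∃ A : ℝ, 1 ≤ A ∧
    ∀ T : Set (E d), IsModelHole d c₀ T → ∀ ε η : ℝ, 0 < ε → 0 < η → η ≤ 1 →
    ∀ (R : ℝ) (u : E d → ℝ) (G : E d → E d), IsW12WithGrad (cube d R) u G →
      IsWeaklyHarmonic (cube d R ∩ perforated T ε η) G →
      (∀ᵐ x ∂volume.restrict (cube d R \ perforated T ε η), u x = 0) →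
      ∀ r, ε ≤ r → r ≤ R / 2 → scaledEnergy ((cube d R).indicator G) r
        ≤ A * scaledEnergy ((cube d R).indicator G) (R / 2) := by
  set c : ℝ := min c₀ (1 / 2) with hc
  have hc0 : 0 < c := lt_min hc₀ (by norm_num)
  obtain ⟨C, hC, hcap⟩ := exists_capacity_bounds hd hc0 (min_le_right _ _)
  obtain ⟨A, hA, hmain⟩ := scaledEnergy_le_of_bounds d C hC
  refine ⟨A, hA, fun T hT ε η hε hη hη1 R u G h hharm hu r hr hrR => ?_⟩
  obtain ⟨κ, hκ, hκ1, hbounds⟩ := hcap η hη hη1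
  have hU := isOpen_cube (d := d) R
  have hw := h.hasWeakGrad hU
  set v := (cube d R).indicator u with hv
  set F := (cube d R).indicator G with hF
  have hsub : Metric.ball (0 : E d) (R / 2 / ε) ⊆ (fun x : E d => ε • x) ⁻¹' cube d R := by
    intro x hx
    refine ball_subset_cube R ?_
    rw [mem_ball_zero_iff] at hx ⊢
    rw [norm_smul, Real.norm_of_nonneg hε.le]
    rwa [lt_div_iff₀ hε, mul_comm] at hx
  have hw' := (hw.comp_smul hε).mono hsub
  have hharm' : ∀ φ, IsTestFunction (Metric.ball 0 (R / 2 / ε) ∩ (holes T η)ᶜ) φ →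
      ∑ i, ∫ x, (ε • F (ε • x)) i * pd φ i x = 0 := fun φ hφ =>
    sum_integral_comp_smul_eq_zero
      (fun φ hφ => sum_integral_indicator_eq_zero hU h.memLp_grad hharm hφ) hε
      (hφ.mono fun x hx => ⟨hsub hx.1, (smul_mem_perforated_iff hε η x).2 hx.2⟩)
  have hv0 : ∀ᵐ x, x ∈ holes T η → v (ε • x) = 0 := by
    have h1 : ∀ᵐ x, x ∉ perforated T ε η → v x = 0 := by
      filter_upwards [ae_imp_of_ae_restrict hu] with x hx hxp
      by_cases hxc : x ∈ cube d R
      · rw [hv, Set.indicator_of_mem hxc]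
        exact hx ⟨hxc, hxp⟩
      · rw [hv, Set.indicator_of_notMem hxc]
    filter_upwards [ae_comp_smul h1 hε] with x hx hxH
    exact hx fun hxp => (smul_mem_perforated_iff hε η x).1 hxp hxH
  have hsol : IsEnergySolution (Metric.ball 0 (R / 2 / ε)) (fun x => v (ε • x))
      (fun x => ε • F (ε • x)) :=
    ⟨hw', fun θ hθ => hw'.integral_sq_mul_lap Metric.isOpen_ball hv0 hharm'
      (hT.hasConeProperty_holes hc₀ hη hη1) hθ⟩
  obtain ⟨hP, hFl⟩ := hbounds _ _ _ _ hsol hharm'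
    (fun y hy => hT.exists_norm_sq_lt (by omega) hη hy) (fun k => by
      filter_upwards [hv0] with y hy hyk
      refine hy (hT.mem_holes_of_norm_lt hη (k := k) (hyk.trans_le ?_))
      gcongr
      exact min_le_left _ _)
  have h1 := hmain κ _ _ _ hκ hκ1 hsol hP hFl (r / ε) (by rwa [one_le_div hε]) (by gcongr)
  rw [scaledEnergy_comp_smul F hε, scaledEnergy_comp_smul F hε, mul_div_cancel₀ _ hε.ne',
    mul_div_cancel₀ _ hε.ne', mul_left_comm] at h1
  exact le_of_mul_le_mul_left h1 (by positivity)

end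

end Perforated

theorem theorem3p1 (d : ℕ) (hd : 2 ≤ d) (c₀ : ℝ) (hc₀ : 0 < c₀) :
    ∃ C : ℝ, 0 < C ∧
      ∀ T : Set (Perforated.E d), Perforated.IsModelHole d c₀ T →
      ∀ ε η : ℝ, 0 < ε → ε ≤ 1 → 0 < η → η ≤ 1 →
      ∀ R : ℝ, ε ≤ R →
      ∀ (u : Perforated.E d → ℝ) (G : Perforated.E d → Perforated.E d),
        Perforated.IsW12WithGrad (Perforated.cube d R) u G →
        Perforated.IsWeaklyHarmonic (Perforated.cube d R ∩ Perforated.perforated T ε η) G →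
        (∀ᵐ x ∂volume.restrict (Perforated.cube d R \ Perforated.perforated T ε η), u x = 0) →
        ∀ r : ℝ, ε ≤ r → r ≤ R →
          Perforated.l2Average (Perforated.cube d r) G
            ≤ C * Perforated.l2Average (Perforated.cube d R) G := by
  obtain ⟨A, hA, hmain⟩ := Perforated.exists_scaledEnergy_le hd hc₀
  have hd0 : (2 : ℝ) ≤ d := mod_cast hd
  refine ⟨Real.sqrt (A * (2 * d) ^ d), by positivity, ?_⟩
  intro T hT ε η hε _ hη hη1 R hεR u G h hharm hu r hr hrR
  have hr0 : 0 < r := hε.trans_le hr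
  have hR0 : 0 < R := hε.trans_le hεR
  rw [Perforated.l2Average_eq_sqrt, Perforated.l2Average_eq_sqrt, ← Real.sqrt_mul (by positivity),
    Perforated.volume_real_cube hr0, Perforated.volume_real_cube hR0, mul_inv, mul_inv]
  refine Real.sqrt_le_sqrt ?_
  set F := (Perforated.cube d R).indicator G with hF
  have hFi : Integrable fun x => ‖F x‖ ^ 2 :=
    (h.hasWeakGrad (Perforated.isOpen_cube R)).integrable_norm_sq
  have hcube : ∀ s, s ≤ R → ∫ x in Perforated.cube d s, ‖G x‖ ^ 2
      = ∫ x in Perforated.cube d s, ‖F x‖ ^ 2 := fun s hs =>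
    setIntegral_congr_fun (Perforated.isOpen_cube s).measurableSet fun x hx => by
      simp only [hF]
      rw [Set.indicator_of_mem (Perforated.cube_mono hs hx)]
  rw [hcube r hrR, hcube R le_rfl]
  set I := ∫ x in Perforated.cube d R, ‖F x‖ ^ 2 with hI
  have hI0 : 0 ≤ I := integral_nonneg fun _ => sq_nonneg _
  have hmono : ∀ {S S' : Set (Perforated.E d)}, S ⊆ S' →
      ∫ x in S, ‖F x‖ ^ 2 ≤ ∫ x in S', ‖F x‖ ^ 2 := fun hS =>
    Perforated.setIntegral_mono_of_subset hFi (fun _ => sq_nonneg _) hS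
  have key : (r ^ d)⁻¹ * ∫ x in Perforated.cube d r, ‖F x‖ ^ 2
      ≤ A * (2 * d) ^ d * ((R ^ d)⁻¹ * I) := by
    -- `Q_r ⊆ B(0, d r)` and `B(0, R/2) ⊆ Q_R`. If `d r > R/2` the cubes are comparable.
    rcases le_total (d * r) (R / 2) with hs | hs
    · have h1 := hmain T hT ε η hε hη hη1 R u G h hharm hu (d * r) (by nlinarith) hs
      have h2 := hmono (Perforated.cube_subset_ball hd hr0)
      have h3 := hmono (Perforated.ball_subset_cube (d := d) R)
      rw [Perforated.scaledEnergy, Perforated.scaledEnergy] at h1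
      calc (r ^ d)⁻¹ * ∫ x in Perforated.cube d r, ‖F x‖ ^ 2
          ≤ (r ^ d)⁻¹ * ∫ x in Metric.ball (0 : Perforated.E d) (d * r), ‖F x‖ ^ 2 := by gcongr
        _ = (d : ℝ) ^ d * (((d * r) ^ d)⁻¹
              * ∫ x in Metric.ball (0 : Perforated.E d) (d * r), ‖F x‖ ^ 2) := by
            rw [mul_pow]; field_simp
        _ ≤ (d : ℝ) ^ d * (A * (((R / 2) ^ d)⁻¹ * I)) := by
            refine mul_le_mul_of_nonneg_left (h1.trans ?_) (by positivity)
            gcongr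
        _ = _ := by rw [div_pow, mul_pow]; field_simp
    · have h1 : (r ^ d)⁻¹ ≤ (2 * d) ^ d * (R ^ d)⁻¹ := by
        rw [inv_le_iff_one_le_mul₀ (by positivity), mul_comm, ← mul_assoc, ← mul_pow,
          ← div_eq_mul_inv, one_le_div (by positivity)]
        gcongr
        linarith
      have h2 := hmono (Perforated.cube_mono (d := d) hrR)
      calc _ ≤ (2 * d) ^ d * (R ^ d)⁻¹ * I := by gcongr
        _ = 1 * ((2 * d) ^ d * ((R ^ d)⁻¹ * I)) := by ring
        _ ≤ A * ((2 * d) ^ d * ((R ^ d)⁻¹ * I)) := by gcongr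
        _ = _ := by ring
  have hV : 0 ≤ (volume.real (Perforated.cube d 1))⁻¹ := inv_nonneg.2 measureReal_nonneg
  calc _ = (volume.real (Perforated.cube d 1))⁻¹
        * ((r ^ d)⁻¹ * ∫ x in Perforated.cube d r, ‖F x‖ ^ 2) := by ring
    _ ≤ (volume.real (Perforated.cube d 1))⁻¹ * (A * (2 * d) ^ d * ((R ^ d)⁻¹ * I)) := by gcongr
    _ = _ := by ring
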